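/- Let $\lambda_e,\lambda>0$ and $q\in(0,1]$, and let $C=C_n\ge 0$ be constants with $C_n\to 0$ as $n\to\infty$. For each $n$ consider a network of a source and nodes $1,\dots,n$. The source updates itself at times $0=T_0<T_1<T_2<\cdots$, where the $T_{k+1}-T_k$ are i.i.d. exponential with rate $\lambda_e$; its version at time $t$ is $N_s(t)=\max\{k: T_k\le t\}$. The source sends its current version to each node according to independent Poisson processes of rate $\lambda/n$. Let $N_i(t)$ be the version held by node $i$ (with $N_i(0)=0$), and let $\Delta_i(t)=N_s(t)-N_i(t)$ be its version age. The nodes gossip as follows (ASUMAN with partial connectivity). In the interval $[T_k,T_{k+1})$ let $\tilde\Delta[k]=\min_i\Delta_i(T_k)$ and $\mathcal M_k=\{i:\Delta_i(T_k)=\tilde\Delta[k]\}$. Each $j\in\mathcal M_k$ draws, independently of everything else, a uniformly random set of $\lfloor q(n-1)\rfloor$ of the other nodes, and during $[T_k+C_n\tilde\Delta[k],T_{k+1})$ (empty if $T_{k+1}\le T_k+C_n\tilde\Delta[k]$) it sends its current version to each node of this set according to independent Poisson processes of rate $\frac{B}{|\mathcal M_k|\lfloor q(n-1)\rfloor}$,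 where $B=n\lambda$ is the total gossip rate; no other node gossips in this interval. A node that receives gossip keeps the fresher of its own and the received version. Then for every $n$ and every node $i$ the average version age $a_i^{(n)}=\lim_{t\to\infty}\mathbb E[\Delta_i(t)]$ exists and is finite, and it is $O(1)$: $\sup_{n}\max_{i\le n}a_i^{(n)}<\infty$. Moreover $$\limsup_{n\to\infty}\ \max_{i\le n} a_i^{(n)}\ \le\ 1+\frac{\lambda_e}{\lambda}+\frac1{\tilde\pi},\qquad \tilde\pi=\frac{q\lambda^2}{(\lambda_e+2\lambda)(\lambda+q\lambda_e)} .$$ -/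

import Mathlib

open MeasureTheory ProbabilityTheory Filter Topology
open scoped NNReal ENNReal

/-! ### Poisson processes -/

/-- `N` is a (homogeneous) Poisson counting process of rate `r` on `[0, ∞)`: it starts at `0`, its
paths are nondecreasing and right-continuous, its increments are independent, and the increment over
`(s, t]` has the Poisson law of mean `r (t - s)`. -/
structure IsPoissonProcess {Ω : Type*} [MeasurableSpace Ω] (P : Measure Ω)
    (N : ℝ≥0 → Ω → ℕ) (r : ℝ≥0) : Prop where
  measurable : ∀ t, Measurable (N t)
  zero : ∀ ω, N 0 ω = 0
  mono : ∀ ω, Monotone fun t => N t ω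
  right_cont : ∀ ω t, ContinuousWithinAt (fun s => N s ω) (Set.Ici t) t
  indep_increments : HasIndepIncrements N P
  law_increments : ∀ s t, s ≤ t →
    HasLaw (fun ω => N t ω - N s ω) (poissonMeasure (r * (t - s))) P

/-- The counting path `N` has an arrival at the time `u > 0`: it jumps there. -/
def IsArrival (N : ℝ≥0 → ℕ) (u : ℝ) : Prop :=
  0 < u ∧ ∀ s : ℝ≥0, (s : ℝ) < u → N s < N u.toNNReal

/-! ### One realization of the network -/

/-- The number `⌊q (n - 1)⌋` of nodes to which a minimum-age node gossips. -/
noncomputable def fanout (n : ℕ) (q : ℝ) : ℕ := ⌊q * ((n : ℝ) - 1)⌋₊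

/-- The random inputs that drive a network of `n` nodes, for one outcome. Time is cut by the
self-updates of the source at `0 = T 0 < T 1 < T 2 < ...` into the intervals `[T k, T (k+1))`. -/
structure Inputs (n : ℕ) where
  /-- `τ k = T (k+1) - T k` is the length of the interval number `k`. -/
  τ : ℕ → ℝ
  /-- `src i t` counts the updates that the source sends to the node `i` up to time `t`. -/
  src : Fin n → ℝ≥0 → ℕ
  /-- `clock k j l` is a counting path of unit rate; run at the gossip rate from the beginning of
  the gossiping phase of the interval `k` on, it gives the gossip messages from `j` to `l`. -/
  clock : ℕ → Fin n → Fin n → ℝ≥0 → ℕ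
  /-- `recv k j` is the set of nodes to which `j` may gossip in the interval `k`. -/
  recv : ℕ → Fin n → Finset (Fin n)

namespace Inputs

variable {n : ℕ}

/-- The time of the `k`-th self-update of the source, with `T 0 = 0`. -/
def T (x : Inputs n) (k : ℕ) : ℝ := ∑ j ∈ Finset.range k, x.τ j

/-- The version of the source at time `t`: the number of its self-updates in `(0, t]`. It is also
the number of the interval that contains `t`. -/
noncomputable def sourceVersion (x : Inputs n) (t : ℝ) : ℕ := sSup {k : ℕ | x.T k ≤ t}

end Inputs

/-- The version ages of the nodes when the source has version `k` and node `i` has `V i`. -/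
def versionAge {n : ℕ} (k : ℕ) (V : Fin n → ℕ) (i : Fin n) : ℕ := k - V i

/-- The minimum of the ages. -/
noncomputable def minAge {n : ℕ} (D : Fin n → ℕ) : ℕ := sInf (Set.range D)

/-- The set of the nodes with minimum age. -/
noncomputable def minAgeNodes {n : ℕ} (D : Fin n → ℕ) : Finset (Fin n) :=
  Finset.univ.filter fun i => D i = minAge D

namespace Inputs

variable {n : ℕ}

/-- With the ages `D` at time `T k`: node `j` sends a gossip message to node `l` at the time `u` of
the interval `k`. Here `j` must be a minimum-age node and `l` one of its `⌊q (n-1)⌋` receivers, the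
gossiping phase starts at `T k + C * minAge D`, and in it the messages from `j` to `l` come with the
rate `B / (number of minimum-age nodes * ⌊q (n-1)⌋)`. -/
def IsGossip (x : Inputs n) (q B C : ℝ) (k : ℕ) (D : Fin n → ℕ) (j l : Fin n) (u : ℝ) : Prop :=
  j ∈ minAgeNodes D ∧ l ∈ x.recv k j ∧ x.T k + C * minAge D < u ∧
    IsArrival (x.clock k j l)
      (B / ((minAgeNodes D).card * fanout n q) * (u - (x.T k + C * minAge D)))

/-- The times at which the source or a gossiping node sends a message, in the interval `k`. -/
def eventTimes (x : Inputs n) (q B C : ℝ) (k : ℕ) (D : Fin n → ℕ) : Set ℝ :=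
  {u | (∃ i, IsArrival (x.src i) u) ∨ ∃ j l, x.IsGossip q B C k D j l u}

open Classical in
/-- What the messages of time `u` do to the versions `V` held just before `u`: a node that hears
from the source gets the current version `k`; a node that receives gossip keeps the fresher one of
its own version and the received version; all other nodes keep what they have. -/
noncomputable def receive (x : Inputs n) (q B C : ℝ) (k : ℕ) (D : Fin n → ℕ) (u : ℝ)
    (V : Fin n → ℕ) (i : Fin n) : ℕ :=
  if IsArrival (x.src i) u then k
  else max (V i) ((Finset.univ.filter fun j => x.IsGossip q B C k D j i u).sup V)

open Classical in
/-- The versions after all messages of the interval `k` with times in `S` have been received in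
chronological order, starting from the versions `V` at `T k`. (Counting paths of Poisson processes
have only finitely many arrivals in a bounded set of times; the other case is a convention.) -/
noncomputable def evolve (x : Inputs n) (q B C : ℝ) (k : ℕ) (V : Fin n → ℕ) (S : Set ℝ) :
    Fin n → ℕ :=
  if h : (S ∩ x.eventTimes q B C k (versionAge k V)).Finite then
    (h.toFinset.sort (· ≤ ·)).foldl (fun W u => x.receive q B C k (versionAge k V) u W) V
  else V

/-- The versions held by the nodes at time `T k`. All of them are `0` at time `0`. -/
noncomputable def startVersions (x : Inputs n) (q B C : ℝ) : ℕ → Fin n → ℕ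
  | 0 => fun _ => 0
  | k + 1 => x.evolve q B C k (startVersions x q B C k) (Set.Ioo (x.T k) (x.T (k + 1)))

/-- The versions held by the nodes at time `t`. -/
noncomputable def versions (x : Inputs n) (q B C t : ℝ) : Fin n → ℕ :=
  x.evolve q B C (x.sourceVersion t) (x.startVersions q B C (x.sourceVersion t))
    (Set.Ioc (x.T (x.sourceVersion t)) t)

/-- The version age of node `i` at time `t`. -/
noncomputable def age (x : Inputs n) (q B C t : ℝ) (i : Fin n) : ℕ :=
  versionAge (x.sourceVersion t) (x.versions q B C t) i

end Inputs

/-! ### The law of the random inputs -/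

/-- The probabilistic assumptions on the inputs `X`: the times between self-updates of the source
are exponential with rate `lamE`; the source updates each node by a Poisson process of rate `lam / n`;
the gossip clocks are Poisson processes of rate `1`; in each interval each node draws the set
of its receivers uniformly from the sets of `⌊q (n-1)⌋` other nodes; and all of these are mutually
independent. -/
structure IsNetwork {Ω : Type*} [MeasurableSpace Ω] (P : Measure Ω) {n : ℕ}
    (X : Ω → Inputs n) (lamE lam q : ℝ) : Prop where
  measurable_τ : ∀ k, Measurable fun ω => (X ω).τ k
  law_τ : ∀ k, HasLaw (fun ω => (X ω).τ k) (expMeasure lamE) P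
  poisson_src : ∀ i, IsPoissonProcess P (fun t ω => (X ω).src i t) (lam / n).toNNReal
  poisson_clock : ∀ k j l, IsPoissonProcess P (fun t ω => (X ω).clock k j l t) 1
  measurable_recv : ∀ k j A, MeasurableSet {ω | (X ω).recv k j = A}
  law_recv : ∀ k j, ∀ A ∈ Finset.powersetCard (fanout n q) (Finset.univ.erase j),
    P {ω | (X ω).recv k j = A} = ((n - 1).choose (fanout n q) : ℝ≥0∞)⁻¹
  indep : iIndep
    (Sum.elim (fun k : ℕ => MeasurableSpace.comap (fun ω => (X ω).τ k) inferInstance)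
    (Sum.elim (fun i : Fin n => ⨆ t : ℝ≥0, MeasurableSpace.comap (fun ω => (X ω).src i t) ⊤)
    (Sum.elim
      (fun c : ℕ × Fin n × Fin n =>
        ⨆ t : ℝ≥0, MeasurableSpace.comap (fun ω => (X ω).clock c.1 c.2.1 c.2.2 t) ⊤)
      (fun d : ℕ × Fin n => MeasurableSpace.comap (fun ω => (X ω).recv d.1 d.2) ⊤)))) P

/-!
The key is to look at the ages `D k` of the nodes at the self-updates `T k` of the source. In the
interval between two self-updates the ages evolve by a measurable function of the messages of this
interval alone (`Inputs.age_eq`; the function `agesAt` is a limit over finer and finer time grids,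
which makes its measurability evident). As Poisson processes have independent stationary
increments and all the other inputs are independent from interval to interval, `(T k, D k)` is a
Markov renewal process with exponential step lengths (`IsNetwork.lintegral_ages_step`), and the
expected age at time `t` is a sum over the steps of this process (`IsNetwork.lintegral_age_eq`).

*Existence of the limit.* With positive probability all nodes hear from the source in a given
interval, and then all ages are `1` at its end, whatever they were before. The chain of ages
regenerates at these times. As the times `T k` form a Poisson process, the renewal equation has an
explicit solution, whose limit is visible (`exists_tendsto_renewalSum`), so that no general
renewal theorem is needed.

*The bound.* A Laplace transform in time, with a small discount rate `θ`, turns the renewal sum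
into a discounted sum over the chain of ages. Three functions of the ages are followed along the
chain: the age `u` of a fixed node, the minimum age `v`, and their product `w`.
- `v` is reset by every message from the source, that is, at the full rate `lam`, which makes its
  mean at most `1 + lamE / lam` (`IsNetwork.lintegral_minAge_le`).
- `u` is pulled to `v` by gossip, except that gossip waits for the time `C * v`
  (`IsNetwork.lintegral_agesBefore_add_le`). The minimum-age nodes share the total gossip rate and
  draw their receivers independently, and by convexity a node gets gossip at least as probably as
  if it had a single sender with the total rate that is connected to it with probability
  `fanout n q / (n - 1)` (`IsNetwork.le_measure_gossip`).
- The price for the waiting time is at most proportional to `C * w`, and `w` has a bounded mean in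
  terms of that of `u`.

Summed along the chain, these three drift inequalities give a mean of `u` of at most
`1 / p + 1 + lamE / lam + O(C)`, where `p` tends to `q * lam / (lam + q * lamE)` when the network
grows (`mul_le_of_drift`, `IsNetwork.limit_age_le`). The bound that is claimed has
`(2 + lamE / lam) / p` in place of `1 / p`. This leaves room for a bound that is uniform in
`θ < lamE / 4`, instead of a limit `θ → 0`, and makes the claim true without `ε` for all large
networks.
-/

/-! ### Counting paths and their arrivals -/

/-- A path that starts at `0`, is nondecreasing and right-continuous, as every path of a Poisson
process is. -/
structure IsCountingPath (N : ℝ≥0 → ℕ) : Prop where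
  zero : N 0 = 0
  mono : Monotone N
  right_cont : ∀ t, ContinuousWithinAt N (Set.Ici t) t

lemma IsPoissonProcess.isCountingPath {Ω : Type*} [MeasurableSpace Ω] {P : Measure Ω}
    {N : ℝ≥0 → Ω → ℕ} {r : ℝ≥0} (h : IsPoissonProcess P N r) (ω : Ω) :
    IsCountingPath fun t => N t ω :=
  ⟨h.zero ω, h.mono ω, h.right_cont ω⟩

lemma IsCountingPath.exists_gt_eq {N : ℝ≥0 → ℕ} (h : IsCountingPath N) (t : ℝ≥0) :
    ∃ u, t < u ∧ N u = N t := by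
  have h1 : ∀ᶠ u in 𝓝[≥] t, N u = N t :=
    h.right_cont t ((isOpen_discrete {N t}).mem_nhds rfl)
  have h2 : ∀ᶠ u in 𝓝[>] t, N u = N t :=
    h1.filter_mono (nhdsWithin_mono _ Set.Ioi_subset_Ici_self)
  obtain ⟨u, hu⟩ := (h2.and self_mem_nhdsWithin).exists
  exact ⟨u, hu.2, hu.1⟩

lemma not_isArrival_of_nonpos {N : ℝ≥0 → ℕ} {u : ℝ} (hu : u ≤ 0) : ¬ IsArrival N u :=
  fun h => absurd h.1 (not_lt.2 hu)

lemma IsCountingPath.lt_iff_exists_isArrival {N : ℝ≥0 → ℕ} (h : IsCountingPath N) {a b : ℝ} :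
    N a.toNNReal < N b.toNNReal ↔ ∃ u ∈ Set.Ioc a b, IsArrival N u := by
  constructor
  · intro hlt
    -- the first time at which the path exceeds its value at `a`
    set S : Set ℝ≥0 := {u | N a.toNNReal < N u} with hS
    have hne : S.Nonempty := ⟨_, hlt⟩
    set u := sInf S with hu
    have hlow : ∀ s, s < u → N s ≤ N a.toNNReal := fun s hs =>
      not_lt.1 fun hc => absurd (csInf_le (OrderBot.bddBelow S) (show s ∈ S from hc)) (not_le.2 hs)
    have hmem : N a.toNNReal < N u := by
      obtain ⟨v, hv, hNv⟩ := h.exists_gt_eq u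
      obtain ⟨w, hw, hwv⟩ := exists_lt_of_csInf_lt hne hv
      exact hNv ▸ lt_of_lt_of_le hw (h.mono hwv.le)
    have hau : a.toNNReal < u := by
      by_contra hc
      exact absurd (h.mono (not_lt.1 hc)) (not_le.2 hmem)
    have hub : u ≤ b.toNNReal := csInf_le (OrderBot.bddBelow S) hlt
    have hupos : 0 < u := lt_of_le_of_lt zero_le hau
    refine ⟨u, ⟨?_, ?_⟩, NNReal.coe_pos.2 hupos, fun s hs => ?_⟩
    · exact lt_of_le_of_lt (Real.le_coe_toNNReal a) (NNReal.coe_lt_coe.2 hau)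
    · rcases le_or_gt b 0 with hb | hb
      · rw [Real.toNNReal_of_nonpos hb] at hub
        exact absurd hupos (not_lt.2 hub)
      · rw [← Real.coe_toNNReal b hb.le]
        exact_mod_cast hub
    · rw [Real.toNNReal_coe]
      exact lt_of_le_of_lt (hlow s (by exact_mod_cast hs)) hmem
  · rintro ⟨u, ⟨hau, hub⟩, hu0, hu⟩
    have : N a.toNNReal < N u.toNNReal := by
      apply hu
      rw [Real.coe_toNNReal']
      exact max_lt hau hu0
    exact this.trans_le (h.mono (Real.toNNReal_le_toNNReal hub))

lemma IsCountingPath.finite_isArrival {N : ℝ≥0 → ℕ} (h : IsCountingPath N) (b : ℝ) :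
    {u | u ≤ b ∧ IsArrival N u}.Finite := by
  refine Set.Finite.of_finite_image (f := fun u : ℝ => N u.toNNReal)
    ((Set.finite_Iic (N b.toNNReal)).subset ?_) ?_
  · rintro _ ⟨u, hu, rfl⟩
    exact h.mono (Real.toNNReal_le_toNNReal hu.1)
  · have key : ∀ u v : ℝ, IsArrival N u → IsArrival N v → u < v →
        N u.toNNReal < N v.toNNReal := fun u v hu hv huv =>
      hv.2 _ (by rwa [Real.coe_toNNReal _ hu.1.le])
    intro u hu v hv huv
    rcases lt_trichotomy u v with hlt | heq | hlt
    · exact absurd huv (key u v hu.2 hv.2 hlt).ne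
    · exact heq
    · exact absurd huv (key v u hv.2 hu.2 hlt).ne'

/-! ### The age process of one interval -/

/-- The part of the random inputs that acts in one interval, with time counted from the beginning of
the interval: the paths that count the source updates of each node, the gossip clocks, and the
relation that says which node may gossip to which. -/
abbrev LocalInputs (n : ℕ) : Type :=
  (Fin n → ℝ≥0 → ℕ) × (Fin n → Fin n → ℝ≥0 → ℕ) × (Fin n → Fin n → Prop)

/-- The local inputs of the interval number `k` when this interval begins at time `s`. -/
def Inputs.localInputs {n : ℕ} (x : Inputs n) (s : ℝ≥0) (k : ℕ) : LocalInputs n :=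
  (fun i u => x.src i (s + u) - x.src i s, x.clock k, fun j l => l ∈ x.recv k j)

/-- Every counting path among the inputs is a genuine one. -/
structure Inputs.IsRegular {n : ℕ} (x : Inputs n) : Prop where
  src : ∀ i, IsCountingPath (x.src i)
  clock : ∀ k j l, IsCountingPath (x.clock k j l)

/-- The rate at which a minimum-age node gossips to one of its receivers. -/
noncomputable def gossipRate {n : ℕ} (q B : ℝ) (D : Fin n → ℕ) : ℝ :=
  B / ((minAgeNodes D).card * fanout n q)

/-- The reading of the gossip clocks after the time `a` has elapsed in an interval that starts with
the ages `D`. -/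
noncomputable def gossipReading {n : ℕ} (q B C : ℝ) (D : Fin n → ℕ) (a : ℝ) : ℝ≥0 :=
  (gossipRate q B D * (a - C * minAge D)).toNNReal

/-- What happens to the ages `A` between the elapsed times `a` and `b` if the messages of this time
span are all treated as simultaneous. -/
noncomputable def cell {n : ℕ} (q B C : ℝ) (y : LocalInputs n) (D : Fin n → ℕ) (a b : ℝ)
    (A : Fin n → ℕ) : Fin n → ℕ := fun i =>
  open Classical in
  if y.1 i a.toNNReal < y.1 i b.toNNReal then 0
  else sInf (A '' {j | j = i ∨ (j ∈ minAgeNodes D ∧ y.2.2 j i ∧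
    y.2.1 j i (gossipReading q B C D a) < y.2.1 j i (gossipReading q B C D b))})

/-- The ages after the first `j` of `M` time spans of equal length into which `[0, r]` is cut, with
the messages in each of these time spans treated as simultaneous. -/
noncomputable def grid {n : ℕ} (q B C : ℝ) (y : LocalInputs n) (D : Fin n → ℕ) (r : ℝ) (M : ℕ) :
    ℕ → Fin n → ℕ
  | 0 => D
  | j + 1 => cell q B C y D (r * (j / M)) (r * ((j + 1 : ℕ) / M)) (grid q B C y D r M j)

/-- The ages after the elapsed time `r`, messages at this very time included: the limit of the ages
on finer and finer grids. The limit inferior makes this a measurable function of all paths. -/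
noncomputable def agesAt {n : ℕ} (q B C : ℝ) (y : LocalInputs n) (D : Fin n → ℕ) (r : ℝ) :
    Fin n → ℕ := fun i =>
  liminf (fun M : ℕ => grid q B C y D r M M i) atTop

/-- The ages just before the elapsed time `r`. -/
noncomputable def agesBefore {n : ℕ} (q B C : ℝ) (y : LocalInputs n) (D : Fin n → ℕ) (r : ℝ) :
    Fin n → ℕ := fun i =>
  liminf (fun m : ℕ => agesAt q B C y D (r - 1 / ((m : ℝ) + 1)) i) atTop

namespace Inputs

variable {n : ℕ}

open Classical in
/-- The versions after all messages with times in `S` in the interval `k`, starting from `W`, where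
the minimum-age nodes are those of the ages `D`. -/
noncomputable def run (x : Inputs n) (q B C : ℝ) (k : ℕ) (D : Fin n → ℕ) (S : Set ℝ)
    (W : Fin n → ℕ) : Fin n → ℕ :=
  if h : (S ∩ x.eventTimes q B C k D).Finite then
    (h.toFinset.sort (· ≤ ·)).foldl (fun W u => x.receive q B C k D u W) W
  else W

lemma evolve_eq_run (x : Inputs n) (q B C : ℝ) (k : ℕ) (V : Fin n → ℕ) (S : Set ℝ) :
    x.evolve q B C k V S = x.run q B C k (versionAge k V) S V := rfl

lemma run_congr {x : Inputs n} {q B C : ℝ} {k : ℕ} {D : Fin n → ℕ} {S S' : Set ℝ}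
    (h : S ∩ x.eventTimes q B C k D = S' ∩ x.eventTimes q B C k D) (W : Fin n → ℕ) :
    x.run q B C k D S W = x.run q B C k D S' W := by
  unfold run
  revert h
  generalize S ∩ x.eventTimes q B C k D = E
  generalize S' ∩ x.eventTimes q B C k D = E'
  rintro rfl
  rfl

lemma run_of_eq_empty {x : Inputs n} {q B C : ℝ} {k : ℕ} {D : Fin n → ℕ} {S : Set ℝ}
    (h : S ∩ x.eventTimes q B C k D = ∅) (W : Fin n → ℕ) :
    x.run q B C k D S W = W := by
  rw [run_congr (S' := ∅) (by rw [h, Set.empty_inter])]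
  simp [run]

lemma run_of_eq_singleton {x : Inputs n} {q B C : ℝ} {k : ℕ} {D : Fin n → ℕ} {S : Set ℝ} {u : ℝ}
    (h : S ∩ x.eventTimes q B C k D = {u}) (W : Fin n → ℕ) :
    x.run q B C k D S W = x.receive q B C k D u W := by
  unfold run
  simp [h]

lemma run_Ioc_append {x : Inputs n} {q B C : ℝ} {k : ℕ} {D : Fin n → ℕ} {a b c : ℝ}
    (hab : a ≤ b) (hbc : b ≤ c) (hfin : (Set.Ioc a c ∩ x.eventTimes q B C k D).Finite)
    (W : Fin n → ℕ) :
    x.run q B C k D (Set.Ioc a c) W =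
      x.run q B C k D (Set.Ioc b c) (x.run q B C k D (Set.Ioc a b) W) := by
  have h1 : (Set.Ioc a b ∩ x.eventTimes q B C k D).Finite :=
    hfin.subset (Set.inter_subset_inter_left _ (Set.Ioc_subset_Ioc_right hbc))
  have h2 : (Set.Ioc b c ∩ x.eventTimes q B C k D).Finite :=
    hfin.subset (Set.inter_subset_inter_left _ (Set.Ioc_subset_Ioc_left hab))
  unfold run
  rw [dif_pos hfin, dif_pos h1, dif_pos h2, ← List.foldl_append]
  congr 1
  refine List.Perm.eq_of_pairwise (le := (· ≤ ·)) (fun _ _ _ _ h h' => le_antisymm h h')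
    (Finset.pairwise_sort _ _) ?_ ?_
  · rw [List.pairwise_append]
    refine ⟨Finset.pairwise_sort _ _, Finset.pairwise_sort _ _, fun u hu v hv => ?_⟩
    simp only [Finset.mem_sort, Set.Finite.mem_toFinset] at hu hv
    exact hu.1.2.trans hv.1.1.le
  · refine (List.perm_ext_iff_of_nodup (Finset.sort_nodup _ _) ?_).2 fun u => ?_
    · rw [List.nodup_append']
      refine ⟨Finset.sort_nodup _ _, Finset.sort_nodup _ _, fun u hu hv => ?_⟩
      simp only [Finset.mem_sort, Set.Finite.mem_toFinset] at hu hv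
      exact absurd hu.1.2 (not_le.2 hv.1.1)
    · simp only [Finset.mem_sort, Set.Finite.mem_toFinset, List.mem_append, Set.mem_inter_iff,
        Set.mem_Ioc]
      constructor
      · rintro ⟨⟨h, h'⟩, hE⟩
        rcases le_or_gt u b with hub | hub
        · exact Or.inl ⟨⟨h, hub⟩, hE⟩
        · exact Or.inr ⟨⟨hub, h'⟩, hE⟩
      · rintro (⟨⟨h, h'⟩, hE⟩ | ⟨⟨h, h'⟩, hE⟩)
        · exact ⟨⟨h, h'.trans hbc⟩, hE⟩
        · exact ⟨⟨hab.trans_lt h, h'⟩, hE⟩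

lemma finite_eventTimes {x : Inputs n} (hx : x.IsRegular) (q B C : ℝ) (k : ℕ) (D : Fin n → ℕ)
    (a c : ℝ) : (Set.Ioc a c ∩ x.eventTimes q B C k D).Finite := by
  have h1 : (⋃ i, {u | u ≤ c ∧ IsArrival (x.src i) u}).Finite :=
    Set.finite_iUnion fun i => (hx.src i).finite_isArrival c
  have h2 : (⋃ j, ⋃ l, {u | u ≤ c ∧ x.IsGossip q B C k D j l u}).Finite := by
    refine Set.finite_iUnion fun j => Set.finite_iUnion fun l => ?_
    by_cases hρ : 0 < gossipRate q B D
    · refine (Set.Finite.preimage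
        (f := fun u : ℝ => gossipRate q B D * (u - (x.T k + C * minAge D))) ?_ ((hx.clock k j l).finite_isArrival
          (gossipRate q B D * (c - (x.T k + C * minAge D))))).subset ?_
      · intro u _ v _ huv
        simpa [hρ.ne'] using huv
      · rintro u ⟨huc, -, -, -, harr⟩
        exact ⟨mul_le_mul_of_nonneg_left (by linarith) hρ.le, harr⟩
    · refine Set.Finite.subset Set.finite_empty ?_
      rintro u ⟨-, -, -, hu, harr⟩
      refine not_isArrival_of_nonpos ?_ harr
      exact mul_nonpos_of_nonpos_of_nonneg (not_lt.1 hρ) (by linarith)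
  refine (h1.union h2).subset ?_
  rintro u ⟨⟨-, huc⟩, ⟨i, hi⟩ | ⟨j, l, hjl⟩⟩
  · exact Or.inl (Set.mem_iUnion.2 ⟨i, huc, hi⟩)
  · exact Or.inr (Set.mem_iUnion.2 ⟨j, Set.mem_iUnion.2 ⟨l, huc, hjl⟩⟩)

end Inputs

lemma gossipRate_nonneg {n : ℕ} {q B : ℝ} (hB : 0 ≤ B) (D : Fin n → ℕ) :
    0 ≤ gossipRate q B D := by
  unfold gossipRate
  positivity

namespace Inputs

variable {n : ℕ} {x : Inputs n} {q B C : ℝ} {k : ℕ} {D : Fin n → ℕ}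

lemma isGossip_iff (hB : 0 ≤ B) {j l : Fin n} {u : ℝ} :
    x.IsGossip q B C k D j l u ↔ j ∈ minAgeNodes D ∧ l ∈ x.recv k j ∧
      IsArrival (x.clock k j l) (gossipRate q B D * (u - (x.T k + C * minAge D))) := by
  unfold IsGossip gossipRate
  refine ⟨fun h => ⟨h.1, h.2.1, h.2.2.2⟩, fun h => ⟨h.1, h.2.1, ?_, h.2.2⟩⟩
  have := pos_of_mul_pos_right h.2.2.1 (gossipRate_nonneg hB D)
  linarith

lemma localInputs_src_lt_iff (hx : x.IsRegular) {s : ℝ≥0} (hs : (s : ℝ) = x.T k) {a b : ℝ}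
    (ha : 0 ≤ a) (hab : a ≤ b) (i : Fin n) :
    (x.localInputs s k).1 i a.toNNReal < (x.localInputs s k).1 i b.toNNReal ↔
      ∃ u ∈ Set.Ioc (x.T k + a) (x.T k + b), IsArrival (x.src i) u := by
  rw [← (hx.src i).lt_iff_exists_isArrival, ← hs, Real.toNNReal_add s.coe_nonneg ha,
    Real.toNNReal_add s.coe_nonneg (ha.trans hab), Real.toNNReal_coe]
  have h1 := (hx.src i).mono (le_self_add : s ≤ s + a.toNNReal)
  have h2 := (hx.src i).mono (le_self_add : s ≤ s + b.toNNReal)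
  simp only [localInputs]
  omega

lemma clock_gossipReading_lt_iff (hx : x.IsRegular) (hB : 0 ≤ B) {a b : ℝ} (j l : Fin n) :
    x.clock k j l (gossipReading q B C D a) < x.clock k j l (gossipReading q B C D b) ↔
      ∃ u ∈ Set.Ioc (x.T k + a) (x.T k + b),
        IsArrival (x.clock k j l) (gossipRate q B D * (u - (x.T k + C * minAge D))) := by
  unfold gossipReading
  rw [(hx.clock k j l).lt_iff_exists_isArrival]
  rcases (gossipRate_nonneg (q := q) hB D).eq_or_lt with h0 | h0
  · simp only [← h0, zero_mul]
    exact ⟨fun ⟨u, hu, _⟩ => by simp at hu,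
      fun ⟨u, _, hu⟩ => absurd hu (not_isArrival_of_nonpos le_rfl)⟩
  · constructor
    · rintro ⟨v, ⟨hv1, hv2⟩, hv⟩
      refine ⟨v / gossipRate q B D + (x.T k + C * minAge D), ⟨?_, ?_⟩, ?_⟩
      · have := (lt_div_iff₀' h0).2 hv1
        linarith
      · have := (div_le_iff₀' h0).2 hv2
        linarith
      · rwa [add_sub_cancel_right, mul_div_cancel₀ _ h0.ne']
    · rintro ⟨u, ⟨hu1, hu2⟩, hu⟩
      exact ⟨_, ⟨mul_lt_mul_of_pos_left (by linarith) h0,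
        mul_le_mul_of_nonneg_left (by linarith) h0.le⟩, hu⟩

lemma receive_le {W : Fin n → ℕ} (hW : ∀ i, W i ≤ k) (u : ℝ) (i : Fin n) :
    x.receive q B C k D u W i ≤ k := by
  unfold receive
  split_ifs
  · exact le_rfl
  · exact max_le (hW i) (Finset.sup_le fun j _ => hW j)

lemma run_le {W : Fin n → ℕ} (hW : ∀ i, W i ≤ k) (S : Set ℝ) (i : Fin n) :
    x.run q B C k D S W i ≤ k := by
  unfold run
  split_ifs with h
  · generalize h.toFinset.sort (· ≤ ·) = L
    clear h
    induction L generalizing W with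
    | nil => exact hW i
    | cons u L ih => exact ih fun i => receive_le hW u i
  · exact hW i

lemma versionAge_receive (W : Fin n → ℕ) (u : ℝ) (i : Fin n) :
    versionAge k (x.receive q B C k D u W) i =
      open Classical in if IsArrival (x.src i) u then 0
      else sInf (versionAge k W '' {j | j = i ∨ x.IsGossip q B C k D j i u}) := by
  classical
  unfold versionAge receive
  split_ifs with h
  · exact Nat.sub_self k
  · set J : Finset (Fin n) := Finset.univ.filter fun j => x.IsGossip q B C k D j i u with hJ
    have hmem : ∀ j, x.IsGossip q B C k D j i u ↔ j ∈ J := fun j => by simp [hJ]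
    apply le_antisymm
    · refine le_csInf ⟨_, i, Or.inl rfl, rfl⟩ ?_
      rintro _ ⟨j, rfl | hj, rfl⟩
      · exact Nat.sub_le_sub_left (le_max_left _ _) k
      · exact Nat.sub_le_sub_left
          ((Finset.le_sup (f := W) ((hmem j).1 hj)).trans (le_max_right _ _)) k
    · rcases le_total (J.sup W) (W i) with hle | hle
      · rw [max_eq_left hle]
        exact Nat.sInf_le ⟨i, Or.inl rfl, rfl⟩
      · rw [max_eq_right hle]
        rcases J.eq_empty_or_nonempty with he | hne
        · rw [he, Finset.sup_empty, Nat.bot_eq_zero, Nat.sub_zero]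
          have h0 : sInf ((fun i => k - W i) '' {j | j = i ∨ x.IsGossip q B C k D j i u}) ≤
              k - W i :=
            Nat.sInf_le ⟨i, Or.inl rfl, rfl⟩
          exact h0.trans (Nat.sub_le _ _)
        · obtain ⟨j, hj, hjW⟩ := J.exists_mem_eq_sup hne W
          rw [hjW]
          exact Nat.sInf_le ⟨j, Or.inr ((hmem j).2 hj), rfl⟩

/-- If at most one time in a time span carries messages, then it is immaterial that `cell` treats
the messages as simultaneous. -/
lemma versionAge_run_Ioc (hx : x.IsRegular) (hB : 0 ≤ B) {s : ℝ≥0} (hs : (s : ℝ) = x.T k)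
    {a b : ℝ} (ha : 0 ≤ a) (hab : a ≤ b) (W : Fin n → ℕ)
    (h1 : (Set.Ioc (x.T k + a) (x.T k + b) ∩ x.eventTimes q B C k D).Subsingleton) :
    versionAge k (x.run q B C k D (Set.Ioc (x.T k + a) (x.T k + b)) W) =
      cell q B C (x.localInputs s k) D a b (versionAge k W) := by
  classical
  funext i
  unfold cell
  have hclk : ∀ j, (x.localInputs s k).2.1 j i = x.clock k j i := fun j => rfl
  have hrcv : ∀ j, (x.localInputs s k).2.2 j i ↔ i ∈ x.recv k j := fun j => Iff.rfl
  rw [if_congr (localInputs_src_lt_iff hx hs ha hab i) rfl rfl]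
  simp only [hclk, hrcv, clock_gossipReading_lt_iff hx hB]
  rcases h1.eq_empty_or_singleton with he | ⟨u, hu⟩
  · rw [run_of_eq_empty he]
    have hno : ∀ u ∈ Set.Ioc (x.T k + a) (x.T k + b), u ∉ x.eventTimes q B C k D :=
      fun u hu hE => by
        have : u ∈ (∅ : Set ℝ) := he ▸ ⟨hu, hE⟩
        exact this
    rw [if_neg (fun ⟨u, hu, hE⟩ => hno u hu (Or.inl ⟨i, hE⟩))]
    have : {j | j = i ∨ (j ∈ minAgeNodes D ∧ i ∈ x.recv k j ∧
        ∃ u ∈ Set.Ioc (x.T k + a) (x.T k + b), IsArrival (x.clock k j i)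
          (gossipRate q B D * (u - (x.T k + C * minAge D))))} = {i} := by
      ext j
      simp only [Set.mem_ofPred_eq, Set.mem_singleton_iff, or_iff_left_iff_imp]
      rintro ⟨h1, h2, u, hu, h3⟩
      exact absurd (Or.inr ⟨j, i, (isGossip_iff hB).2 ⟨h1, h2, h3⟩⟩) (hno u hu)
    rw [this, Set.image_singleton, csInf_singleton]
  · rw [run_of_eq_singleton hu, versionAge_receive]
    have hmem : u ∈ Set.Ioc (x.T k + a) (x.T k + b) := (hu.symm ▸ Set.mem_singleton u :
      u ∈ Set.Ioc (x.T k + a) (x.T k + b) ∩ x.eventTimes q B C k D).1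
    have honly : ∀ v ∈ Set.Ioc (x.T k + a) (x.T k + b), v ∈ x.eventTimes q B C k D → v = u :=
      fun v hv hE => by
        have : v ∈ ({u} : Set ℝ) := hu ▸ ⟨hv, hE⟩
        exact this
    have e1 : (∃ v ∈ Set.Ioc (x.T k + a) (x.T k + b), IsArrival (x.src i) v) ↔
        IsArrival (x.src i) u :=
      ⟨fun ⟨v, hv, hE⟩ => honly v hv (Or.inl ⟨i, hE⟩) ▸ hE, fun h => ⟨u, hmem, h⟩⟩
    have e2 : ∀ j, (j ∈ minAgeNodes D ∧ i ∈ x.recv k j ∧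
        ∃ v ∈ Set.Ioc (x.T k + a) (x.T k + b), IsArrival (x.clock k j i)
          (gossipRate q B D * (v - (x.T k + C * minAge D)))) ↔ x.IsGossip q B C k D j i u := by
      intro j
      rw [isGossip_iff hB]
      constructor
      · rintro ⟨h1, h2, v, hv, h3⟩
        have := honly v hv (Or.inr ⟨j, i, (isGossip_iff hB).2 ⟨h1, h2, h3⟩⟩)
        exact ⟨h1, h2, this ▸ h3⟩
      · rintro ⟨h1, h2, h3⟩
        exact ⟨h1, h2, u, hmem, h3⟩
    simp only [e1, e2]

/-- On a fine enough grid the discretized ages are the true ones. -/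
lemma eventually_grid_eq (hx : x.IsRegular) (hB : 0 ≤ B) {s : ℝ≥0} (hs : (s : ℝ) = x.T k)
    {r : ℝ} (hr : 0 ≤ r) (V : Fin n → ℕ) :
    ∀ᶠ M : ℕ in atTop, grid q B C (x.localInputs s k) (versionAge k V) r M M =
      versionAge k (x.evolve q B C k V (Set.Ioc (x.T k) (x.T k + r))) := by
  set D := versionAge k V with hD
  have hfin := finite_eventTimes hx q B C k D (x.T k) (x.T k + r)
  -- the mesh must be finer than the least gap between two event times
  obtain ⟨δ, hδ, hgap⟩ : ∃ δ > 0, ∀ u ∈ Set.Ioc (x.T k) (x.T k + r) ∩ x.eventTimes q B C k D,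
      ∀ v ∈ Set.Ioc (x.T k) (x.T k + r) ∩ x.eventTimes q B C k D, u < v → δ ≤ v - u := by
    by_cases hne : ((hfin.toFinset ×ˢ hfin.toFinset).filter fun p => p.1 < p.2).Nonempty
    · obtain ⟨p, hp, hmin⟩ := Finset.exists_min_image _ (fun p : ℝ × ℝ => p.2 - p.1) hne
      refine ⟨p.2 - p.1, sub_pos.2 (Finset.mem_filter.1 hp).2, fun u hu v hv huv => ?_⟩
      exact hmin (u, v) (by simp [huv, hu.1.1, hu.1.2, hu.2, hv.1.1, hv.1.2, hv.2])
    · refine ⟨1, one_pos, fun u hu v hv huv => absurd ⟨(u, v), ?_⟩ hne⟩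
      simp [huv, hu.1.1, hu.1.2, hu.2, hv.1.1, hv.1.2, hv.2]
  have hmesh : ∀ᶠ M : ℕ in atTop, r / M < δ :=
    (tendsto_const_div_atTop_nhds_zero_nat r).eventually (gt_mem_nhds hδ)
  filter_upwards [hmesh, eventually_gt_atTop 0] with M hM hM0
  have hM0' : (0 : ℝ) < M := Nat.cast_pos.2 hM0
  have key : ∀ j ≤ M, grid q B C (x.localInputs s k) D r M j =
      versionAge k (x.run q B C k D (Set.Ioc (x.T k) (x.T k + r * (j / M))) V) := by
    intro j
    induction j with
    | zero =>
      intro _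
      rw [run_of_eq_empty (by simp)]
      rfl
    | succ j ih =>
      intro hj
      have hlt : r * (j / M) ≤ r * ((j + 1 : ℕ) / M) := by
        gcongr
        omega
      have hle : r * ((j + 1 : ℕ) / M) ≤ r := by
        refine mul_le_of_le_one_right hr ((div_le_one hM0').2 (by exact_mod_cast hj))
      have h0 : 0 ≤ r * (j / M) := by positivity
      rw [grid, ih (by omega),
        run_Ioc_append (a := x.T k) (b := x.T k + r * (j / M))
            (c := x.T k + r * ((j + 1 : ℕ) / M)) (by linarith) (by linarith)
          (finite_eventTimes hx ..), versionAge_run_Ioc hx hB hs h0 hlt]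
      have hsub : ∀ u ∈ Set.Ioc (x.T k + r * (j / M)) (x.T k + r * ((j + 1 : ℕ) / M)) ∩
          x.eventTimes q B C k D, ∀ v ∈ Set.Ioc (x.T k + r * (j / M))
          (x.T k + r * ((j + 1 : ℕ) / M)) ∩ x.eventTimes q B C k D, ¬ u < v := by
        rintro u ⟨⟨hu1, hu2⟩, hu⟩ v ⟨⟨hv1, hv2⟩, hv⟩ huv
        have h3 := hgap u ⟨⟨by linarith, by linarith⟩, hu⟩ v ⟨⟨by linarith, by linarith⟩, hv⟩ huv
        have h4 : r * ((j + 1 : ℕ) / M) = r * (j / M) + r / M := by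
          push_cast
          ring
        linarith
      intro u hu v hv
      exact le_antisymm (not_lt.1 (hsub v hv u hu)) (not_lt.1 (hsub u hu v hv))
  rw [key M le_rfl, div_self hM0'.ne', mul_one, evolve_eq_run]

/-- The ages in an interval are the limits of the discretized ages. -/
lemma agesAt_localInputs (hx : x.IsRegular) (hB : 0 ≤ B) {s : ℝ≥0} (hs : (s : ℝ) = x.T k)
    {r : ℝ} (hr : 0 ≤ r) (V : Fin n → ℕ) :
    agesAt q B C (x.localInputs s k) (versionAge k V) r =
      versionAge k (x.evolve q B C k V (Set.Ioc (x.T k) (x.T k + r))) := by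
  funext i
  refine Tendsto.liminf_eq (tendsto_const_nhds.congr' ?_)
  filter_upwards [eventually_grid_eq hx hB hs hr V (q := q) (C := C)] with M hM
  rw [hM]

lemma agesBefore_localInputs (hx : x.IsRegular) (hB : 0 ≤ B) {s : ℝ≥0} (hs : (s : ℝ) = x.T k)
    {r : ℝ} (hr : 0 < r) (V : Fin n → ℕ) :
    agesBefore q B C (x.localInputs s k) (versionAge k V) r =
      versionAge k (x.evolve q B C k V (Set.Ioo (x.T k) (x.T k + r))) := by
  funext i
  set D := versionAge k V with hD
  have hfin : (Set.Ioo (x.T k) (x.T k + r) ∩ x.eventTimes q B C k D).Finite :=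
    (finite_eventTimes hx q B C k D (x.T k) (x.T k + r)).subset
      (Set.inter_subset_inter_left _ Set.Ioo_subset_Ioc_self)
  have hlim : Tendsto (fun m : ℕ => r - 1 / ((m : ℝ) + 1)) atTop (𝓝 (r - 0)) :=
    tendsto_const_nhds.sub tendsto_one_div_add_atTop_nhds_zero_nat
  rw [sub_zero] at hlim
  have h1 : ∀ᶠ m : ℕ in atTop, 0 ≤ r - 1 / ((m : ℝ) + 1) :=
    (hlim.eventually (lt_mem_nhds hr)).mono fun _ => le_of_lt
  have h2 : ∀ᶠ m : ℕ in atTop, ∀ u ∈ Set.Ioo (x.T k) (x.T k + r) ∩ x.eventTimes q B C k D,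
      u ≤ x.T k + (r - 1 / ((m : ℝ) + 1)) := by
    rw [eventually_all_finite hfin]
    intro u hu
    have h3 : u - x.T k < r := by linarith [hu.1.2]
    filter_upwards [hlim.eventually (lt_mem_nhds h3)] with m hm
    linarith
  refine Tendsto.liminf_eq (tendsto_const_nhds.congr' ?_)
  filter_upwards [h1, h2] with m hm1 hm2
  rw [hD, agesAt_localInputs hx hB hs hm1, evolve_eq_run, evolve_eq_run]
  refine congrArg (fun W => versionAge k W i) (run_congr ?_ V)
  ext u
  constructor
  · exact fun hu => ⟨⟨hu.1.1, hm2 u hu⟩, hu.2⟩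
  · intro hu
    have : (0 : ℝ) < 1 / ((m : ℝ) + 1) := Nat.one_div_pos_of_nat
    exact ⟨⟨hu.1.1, by linarith [hu.1.2]⟩, hu.2⟩

end Inputs

/-! ### Monotonicity properties of the ages in one interval -/

section Ages

variable {n : ℕ} {q B C : ℝ} {y : LocalInputs n} {D : Fin n → ℕ}

lemma minAge_le (D : Fin n → ℕ) (i : Fin n) : minAge D ≤ D i := Nat.sInf_le ⟨i, rfl⟩

lemma eq_minAge_of_mem {j : Fin n} (hj : j ∈ minAgeNodes D) : D j = minAge D := by
  simpa [minAgeNodes] using hj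

lemma cell_le (a b : ℝ) (A : Fin n → ℕ) (i : Fin n) : cell q B C y D a b A i ≤ A i := by
  unfold cell
  split_ifs
  · exact Nat.zero_le _
  · exact Nat.sInf_le ⟨i, Or.inl rfl, rfl⟩

lemma grid_antitone (r : ℝ) (M : ℕ) (i : Fin n) :
    Antitone fun j => grid q B C y D r M j i :=
  antitone_nat_of_succ_le fun _ => cell_le ..

lemma grid_le (r : ℝ) (M j : ℕ) (i : Fin n) : grid q B C y D r M j i ≤ D i :=
  grid_antitone r M i (Nat.zero_le j)

lemma exists_increase_of_lt (f : ℝ → ℕ) {r : ℝ} {M : ℕ} (hM : 0 < M) (h : f 0 < f r) :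
    ∃ j < M, f (r * (j / M)) < f (r * ((j + 1 : ℕ) / M)) := by
  by_contra! hc
  have key : ∀ j ≤ M, f (r * (j / M)) ≤ f 0 := by
    intro j
    induction j with
    | zero => simp
    | succ j ih => exact fun hj => (hc j hj).trans (ih (by omega))
  have := key M le_rfl
  rw [div_self (Nat.cast_ne_zero.2 hM.ne'), mul_one] at this
  omega

lemma nat_liminf_le {u : ℕ → ℕ} {c : ℕ} (h : ∀ᶠ m in atTop, u m ≤ c) : liminf u atTop ≤ c :=
  csSup_le ⟨0, Eventually.of_forall fun _ => Nat.zero_le _⟩ fun _ ha => by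
    obtain ⟨m, hm1, hm2⟩ := (h.and ha).exists
    exact hm2.trans hm1

lemma agesAt_le (r : ℝ) (i : Fin n) : agesAt q B C y D r i ≤ D i :=
  nat_liminf_le (Eventually.of_forall fun _ => grid_le ..)

lemma agesBefore_le (r : ℝ) (i : Fin n) : agesBefore q B C y D r i ≤ D i :=
  nat_liminf_le (Eventually.of_forall fun _ => agesAt_le ..)

/-- A node that has heard from the source has age `0`. -/
lemma agesAt_eq_zero {r : ℝ} {i : Fin n} (h : y.1 i 0 < y.1 i r.toNNReal) :
    agesAt q B C y D r i = 0 := by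
  refine Nat.le_zero.1 (nat_liminf_le ?_)
  filter_upwards [eventually_gt_atTop 0] with M hM
  obtain ⟨j, hj, hlt⟩ := exists_increase_of_lt (fun t => y.1 i t.toNNReal) hM
    (by simpa using h)
  refine (grid_antitone r M i (Nat.succ_le_of_lt hj)).trans (le_of_eq ?_)
  simp only [grid, cell]
  rw [if_pos hlt]

/-- A node that has received gossip has an age of at most the minimum age. -/
lemma agesAt_le_minAge {r : ℝ} {i j : Fin n} (hj : j ∈ minAgeNodes D) (hji : y.2.2 j i)
    (h : y.2.1 j i (gossipReading q B C D 0) < y.2.1 j i (gossipReading q B C D r)) :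
    agesAt q B C y D r i ≤ minAge D := by
  refine nat_liminf_le ?_
  filter_upwards [eventually_gt_atTop 0] with M hM
  obtain ⟨l, hl, hlt⟩ := exists_increase_of_lt
    (fun t => y.2.1 j i (gossipReading q B C D t)) hM h
  refine (grid_antitone r M i (Nat.succ_le_of_lt hl)).trans ?_
  simp only [grid, cell]
  split_ifs
  · exact Nat.zero_le _
  · have h1 : sInf (grid q B C y D r M l '' {j | j = i ∨ (j ∈ minAgeNodes D ∧ y.2.2 j i ∧
        y.2.1 j i (gossipReading q B C D (r * (l / M))) <
          y.2.1 j i (gossipReading q B C D (r * ((l + 1 : ℕ) / M))))}) ≤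
        grid q B C y D r M l j := Nat.sInf_le ⟨j, Or.inr ⟨hj, hji, hlt⟩, rfl⟩
    exact h1.trans ((grid_le ..).trans (eq_minAge_of_mem hj).le)

lemma eventually_le_sub_one_div {r' r : ℝ} (hr : r' < r) :
    ∀ᶠ m : ℕ in atTop, r' ≤ r - 1 / ((m : ℝ) + 1) := by
  have hlim : Tendsto (fun m : ℕ => r - 1 / ((m : ℝ) + 1)) atTop (𝓝 (r - 0)) :=
    tendsto_const_nhds.sub tendsto_one_div_add_atTop_nhds_zero_nat
  rw [sub_zero] at hlim
  exact (hlim.eventually (lt_mem_nhds hr)).mono fun _ => le_of_lt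

lemma agesBefore_eq_zero (hmono : ∀ i, Monotone (y.1 i)) {r' r : ℝ} (hr : r' < r) {i : Fin n}
    (h : y.1 i 0 < y.1 i r'.toNNReal) : agesBefore q B C y D r i = 0 := by
  refine Nat.le_zero.1 (nat_liminf_le ?_)
  filter_upwards [eventually_le_sub_one_div hr] with m hm
  exact (agesAt_eq_zero (h.trans_le (hmono i (Real.toNNReal_le_toNNReal hm)))).le

lemma agesBefore_le_minAge (hmono : ∀ j i, Monotone (y.2.1 j i)) (hB : 0 ≤ B) {r' r : ℝ}
    (hr : r' < r) {i j : Fin n} (hj : j ∈ minAgeNodes D) (hji : y.2.2 j i)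
    (h : y.2.1 j i (gossipReading q B C D 0) < y.2.1 j i (gossipReading q B C D r')) :
    agesBefore q B C y D r i ≤ minAge D := by
  refine nat_liminf_le ?_
  filter_upwards [eventually_le_sub_one_div hr] with m hm
  refine agesAt_le_minAge hj hji (h.trans_le (hmono j i (Real.toNNReal_le_toNNReal ?_)))
  exact mul_le_mul_of_nonneg_left (by linarith) (gossipRate_nonneg hB D)

end Ages

/-! ### Measurability of the ages in one interval -/

section Measurability

variable {n : ℕ} {q B C : ℝ} {β : Type*} [MeasurableSpace β]

/-- The local inputs `y` can be read in a measurable way: the paths of source updates at all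
times up to `r` that are functions of `r`, and the gossip clocks at all times that are functions
of `r`. -/
structure IsMeasurableAt (y : β → LocalInputs n) (r : β → ℝ) : Prop where
  src : ∀ i (ψ : ℝ → ℝ), Measurable ψ → (∀ t, (ψ t).toNNReal ≤ t.toNNReal) →
    Measurable fun b => (y b).1 i (ψ (r b)).toNNReal
  clock : ∀ j i (ψ : ℝ → ℝ), Measurable ψ → Measurable fun b => (y b).2.1 j i (ψ (r b)).toNNReal
  recv : ∀ j i, MeasurableSet {b | (y b).2.2 j i}

lemma IsMeasurableAt.comp_right {y : β → LocalInputs n} {r : β → ℝ} (h : IsMeasurableAt y r)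
    {ψ : ℝ → ℝ} (hψ : Measurable ψ) (hle : ∀ t, (ψ t).toNNReal ≤ t.toNNReal) :
    IsMeasurableAt y fun b => ψ (r b) :=
  ⟨fun i _ hφ hφle => h.src i _ (hφ.comp hψ) fun t => (hφle _).trans (hle t),
    fun j i _ hφ => h.clock j i _ (hφ.comp hψ), h.recv⟩

lemma toNNReal_mul_le {c : ℝ} (h0 : 0 ≤ c) (h1 : c ≤ 1) (t : ℝ) :
    (t * c).toNNReal ≤ t.toNNReal := by
  rcases le_total 0 t with ht | ht
  · exact Real.toNNReal_le_toNNReal (mul_le_of_le_one_right ht h1)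
  · rw [Real.toNNReal_of_nonpos (mul_nonpos_of_nonpos_of_nonneg ht h0)]
    exact zero_le

lemma IsMeasurableAt.measurable_cell {y : β → LocalInputs n} {r : β → ℝ} (h : IsMeasurableAt y r)
    (D : Fin n → ℕ) {A : β → Fin n → ℕ} (hA : Measurable A) {c d : ℝ} (hc : 0 ≤ c) (hcd : c ≤ d)
    (hd : d ≤ 1) :
    Measurable fun b => cell q B C (y b) D (r b * c) (r b * d) (A b) := by
  refine measurable_pi_lambda _ fun i => ?_
  classical
  unfold cell
  refine Measurable.ite ?_ measurable_const ?_
  · exact measurableSet_lt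
      (h.src i (fun t => t * c) (by fun_prop) (toNNReal_mul_le hc (hcd.trans hd)))
      (h.src i (fun t => t * d) (by fun_prop) (toNNReal_mul_le (hc.trans hcd) hd))
  · have hJ : Measurable fun b => (A b, fun j => j = i ∨ (j ∈ minAgeNodes D ∧ (y b).2.2 j i ∧
        (y b).2.1 j i (gossipReading q B C D (r b * c)) <
          (y b).2.1 j i (gossipReading q B C D (r b * d)))) := by
      refine hA.prodMk (measurable_pi_lambda _ fun j => ?_)
      refine measurable_const.or (measurable_const.and ((h.recv j i).mem.and ?_))
      refine (measurableSet_lt (h.clock j i (fun t => gossipRate q B D * (t * c - C * minAge D))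
        (by fun_prop)) (h.clock j i (fun t => gossipRate q B D * (t * d - C * minAge D))
        (by fun_prop))).mem
    exact (Measurable.of_discrete
      (f := fun p : (Fin n → ℕ) × (Fin n → Prop) => sInf (p.1 '' {j | p.2 j}))).comp hJ

lemma IsMeasurableAt.measurable_grid {y : β → LocalInputs n} {r : β → ℝ} (h : IsMeasurableAt y r)
    (D : Fin n → ℕ) (M : ℕ) {j : ℕ} (hj : j ≤ M) :
    Measurable fun b => grid q B C (y b) D (r b) M j := by
  induction j with
  | zero => exact measurable_const
  | succ j ih =>
    refine h.measurable_cell D (ih (by omega)) (by positivity) (by gcongr; omega) ?_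
    exact div_le_one_of_le₀ (by exact_mod_cast hj) (Nat.cast_nonneg M)

lemma IsMeasurableAt.measurable_agesAt {y : β → LocalInputs n} {r : β → ℝ}
    (h : IsMeasurableAt y r) (D : Fin n → ℕ) :
    Measurable fun b => agesAt q B C (y b) D (r b) :=
  measurable_pi_lambda _ fun i =>
    Measurable.liminf fun M => (measurable_pi_apply i).comp (h.measurable_grid D M le_rfl)

lemma IsMeasurableAt.measurable_agesBefore {y : β → LocalInputs n} {r : β → ℝ}
    (h : IsMeasurableAt y r) (D : Fin n → ℕ) :
    Measurable fun b => agesBefore q B C (y b) D (r b) :=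
  measurable_pi_lambda _ fun i =>
    Measurable.liminf fun m => (measurable_pi_apply i).comp
      ((h.comp_right (ψ := fun t => t - 1 / ((m : ℝ) + 1)) (by fun_prop) fun t =>
        Real.toNNReal_le_toNNReal (sub_le_self t (by positivity))).measurable_agesAt D)

lemma isMeasurableAt_id (r : ℝ) : IsMeasurableAt (id : LocalInputs n → LocalInputs n) fun _ => r :=
  ⟨fun i ψ _ _ => by simp only [id]; fun_prop, fun j i ψ _ => by simp only [id]; fun_prop,
    fun j i => measurableSet_setOfPred.2 (by simp only [id]; fun_prop)⟩

/-- A family of random variables that is indexed by the times `t` and has right-continuous paths is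
jointly measurable. -/
lemma measurable_eval_of_right_continuous {Ω : Type*} [MeasurableSpace Ω] {N : ℝ≥0 → Ω → ℕ}
    (hN : ∀ t, Measurable (N t)) (hc : ∀ ω, IsCountingPath fun t => N t ω) :
    Measurable fun p : ℝ≥0 × Ω => N p.1 p.2 := by
  -- approximation of the time from the right by multiples of `1 / (m + 1)`
  set g : ℕ → ℝ≥0 → ℝ≥0 := fun m t => (⌊t * (m + 1)⌋₊ + 1 : ℕ) / (m + 1) with hg
  have hgt : ∀ m t, t < g m t := fun m t => by
    rw [hg, lt_div_iff₀ (by positivity)]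
    exact_mod_cast Nat.lt_floor_add_one (t * (m + 1))
  have hle : ∀ m t, g m t ≤ t + 1 / (m + 1) := fun m t => by
    rw [hg, div_le_iff₀ (by positivity), add_mul, one_div, inv_mul_cancel₀ (by positivity)]
    push_cast
    gcongr
    exact Nat.floor_le zero_le
  have hlim : ∀ t, Tendsto (fun m => g m t) atTop (𝓝[≥] t) := fun t => by
    refine tendsto_nhdsWithin_iff.2 ⟨?_, Eventually.of_forall fun m => (hgt m t).le⟩
    refine tendsto_of_tendsto_of_tendsto_of_le_of_le tendsto_const_nhds ?_
      (fun m => (hgt m t).le) (fun m => hle m t)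
    simpa using tendsto_const_nhds.add (tendsto_one_div_add_atTop_nhds_zero_nat (𝕜 := ℝ≥0))
  refine measurable_of_tendsto_metrizable (f := fun m (p : ℝ≥0 × Ω) => N (g m p.1) p.2) ?_ ?_
  · intro m
    have h1 : Measurable fun p : ℕ × Ω => N ((p.1 + 1 : ℕ) / (m + 1)) p.2 :=
      measurable_from_prod_countable_right fun k => hN (((k + 1 : ℕ) : ℝ≥0) / (m + 1))
    have h2 : Measurable fun p : ℝ≥0 × Ω => (⌊p.1 * (m + 1)⌋₊, p.2) := by fun_prop
    exact h1.comp h2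
  · refine tendsto_pi_nhds.2 fun p => ?_
    exact ((hc p.2).right_cont p.1).tendsto.comp (hlim p.1)

end Measurability

/-! ### Independence of past and future -/

/-- If the σ-algebras `c i` are independent and each of them contains two independent σ-algebras
`a i` and `b i`, then all `a i` together are independent of all `b i` together. -/
lemma indep_iSup_of_pairwise_indep {ι Ω : Type*} {mΩ : MeasurableSpace Ω} {P : Measure Ω}
    [IsProbabilityMeasure P] {a b c : ι → MeasurableSpace Ω} (hc : iIndep c P)
    (hcm : ∀ i, c i ≤ mΩ) (ha : ∀ i, a i ≤ c i) (hb : ∀ i, b i ≤ c i)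
    (hab : ∀ i, Indep (a i) (b i) P) : Indep (⨆ i, a i) (⨆ i, b i) P := by
  classical
  have gen : ∀ m : ι → MeasurableSpace Ω,
      ⨆ i, m i = MeasurableSpace.generateFrom
        (piiUnionInter (fun i => {s | MeasurableSet[m i] s}) Set.univ) := fun m =>
    (by simp : ⨆ i, m i = ⨆ i ∈ Set.univ, m i).trans
      (generateFrom_piiUnionInter_measurableSet m Set.univ).symm
  refine IndepSets.indep (iSup_le fun i => (ha i).trans (hcm i))
    (iSup_le fun i => (hb i).trans (hcm i))
    (isPiSystem_piiUnionInter _ (fun i => @MeasurableSpace.isPiSystem_measurableSet _ (a i)) _)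
    (isPiSystem_piiUnionInter _ (fun i => @MeasurableSpace.isPiSystem_measurableSet _ (b i)) _)
    (gen a) (gen b) ?_
  rw [IndepSets_iff]
  rintro _ _ ⟨p, -, f, hf, rfl⟩ ⟨p', -, g, hg, rfl⟩
  set F : ι → Set Ω := fun i => if i ∈ p then f i else Set.univ with hF
  set G : ι → Set Ω := fun i => if i ∈ p' then g i else Set.univ with hG
  have hFm : ∀ i, MeasurableSet[a i] (F i) := fun i => by
    simp only [hF]
    split_ifs with h
    · exact hf i h
    · exact @MeasurableSet.univ _ (a i)
  have hGm : ∀ i, MeasurableSet[b i] (G i) := fun i => by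
    simp only [hG]
    split_ifs with h
    · exact hg i h
    · exact @MeasurableSet.univ _ (b i)
  have e1 : ⋂ i ∈ p, f i = ⋂ i ∈ p ∪ p', F i := by
    ext ω
    simp only [hF, Set.mem_iInter, Finset.mem_union]
    refine ⟨fun h i _ => ?_, fun h i hi => by simpa [hi] using h i (Or.inl hi)⟩
    split_ifs with hi
    · exact h i hi
    · trivial
  have e2 : ⋂ i ∈ p', g i = ⋂ i ∈ p ∪ p', G i := by
    ext ω
    simp only [hG, Set.mem_iInter, Finset.mem_union]
    refine ⟨fun h i _ => ?_, fun h i hi => by simpa [hi] using h i (Or.inr hi)⟩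
    split_ifs with hi
    · exact h i hi
    · trivial
  have e3 : (⋂ i ∈ p ∪ p', F i) ∩ ⋂ i ∈ p ∪ p', G i = ⋂ i ∈ p ∪ p', F i ∩ G i := by
    ext ω
    simp only [Set.mem_inter_iff, Set.mem_iInter, ← forall_and]
  rw [e1, e2, e3,
    hc.meas_biInter (S := p ∪ p') fun i _ => (ha i _ (hFm i)).inter (hb i _ (hGm i)),
    hc.meas_biInter (S := p ∪ p') fun i _ => ha i _ (hFm i),
    hc.meas_biInter (S := p ∪ p') fun i _ => hb i _ (hGm i), ← Finset.prod_mul_distrib]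
  exact Finset.prod_congr rfl fun i _ => (Indep_iff _ _ _).1 (hab i) _ _ (hFm i) (hGm i)

lemma comap_pi_le {ι Ω : Type*} {β : ι → Type*} [∀ u, MeasurableSpace (β u)]
    {m : MeasurableSpace Ω} {X : ∀ u, Ω → β u}
    (h : ∀ u, MeasurableSpace.comap (X u) inferInstance ≤ m) :
    MeasurableSpace.comap (fun ω u => X u ω) inferInstance ≤ m :=
  measurable_iff_comap_le.1 (measurable_pi_lambda _ fun u => measurable_iff_comap_le.2 (h u))

lemma comap_prodMk_le {Ω β γ : Type*} [MeasurableSpace β] [MeasurableSpace γ]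
    {m : MeasurableSpace Ω} {f : Ω → β} {g : Ω → γ}
    (hf : MeasurableSpace.comap f inferInstance ≤ m)
    (hg : MeasurableSpace.comap g inferInstance ≤ m) :
    MeasurableSpace.comap (fun ω => (f ω, g ω)) inferInstance ≤ m :=
  measurable_iff_comap_le.1 ((measurable_iff_comap_le.2 hf).prodMk (measurable_iff_comap_le.2 hg))

lemma comap_mem_le {ι Ω : Type*} {m : MeasurableSpace Ω} {R : Ω → Finset ι}
    (h : MeasurableSpace.comap R ⊤ ≤ m) (l : ι) :
    MeasurableSpace.comap (fun ω => l ∈ R ω) inferInstance ≤ m :=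
  measurable_iff_comap_le.1
    (MeasurableSet.mem (s := {ω | l ∈ R ω}) (h _ ⟨{A | l ∈ A}, trivial, rfl⟩))

lemma comap_sum_le {ι Ω : Type*} {m : MeasurableSpace Ω} {Y : ι → Ω → ℕ} {s : Finset ι}
    (h : ∀ i ∈ s, MeasurableSpace.comap (Y i) inferInstance ≤ m) :
    MeasurableSpace.comap (fun ω => ∑ i ∈ s, Y i ω) inferInstance ≤ m :=
  measurable_iff_comap_le.1
    (Finset.measurable_sum _ fun i hi => measurable_iff_comap_le.2 (h i hi))

/-- The nondecreasing sequence that starts at `0` and then runs through the elements of the finite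
set `K` in increasing order. -/
noncomputable def ladder (K : Finset ℝ≥0) (m : ℕ) : ℝ≥0 :=
  (K.filter fun u => (K.filter (· ≤ u)).card ≤ m).sup id

lemma ladder_mono (K : Finset ℝ≥0) : Monotone (ladder K) := fun m m' h =>
  Finset.sup_mono fun u hu => by
    simp only [Finset.mem_filter] at hu ⊢
    exact ⟨hu.1, hu.2.trans h⟩

lemma ladder_zero (K : Finset ℝ≥0) : ladder K 0 = 0 := by
  unfold ladder
  rw [Finset.filter_eq_empty_iff.2 fun u hu => ?_]
  · rfl
  · simp only [Nat.le_zero, Finset.card_eq_zero]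
    exact Finset.Nonempty.ne_empty ⟨u, by simp [hu]⟩

lemma ladder_card {K : Finset ℝ≥0} {u : ℝ≥0} (hu : u ∈ K) :
    ladder K (K.filter (· ≤ u)).card = u := by
  refine le_antisymm (Finset.sup_le fun v hv => ?_) (Finset.le_sup (f := id) (by simp [hu]))
  simp only [Finset.mem_filter] at hv
  by_contra! hc
  refine absurd (Finset.card_lt_card (Finset.ssubset_iff_subset_ne.2
    ⟨fun w hw => ?_, fun he => ?_⟩)) (not_lt.2 hv.2)
  · simp only [Finset.mem_filter] at hw ⊢
    exact ⟨hw.1, hw.2.trans hc.le⟩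
  · have : v ∈ K.filter (· ≤ u) := he ▸ (by simp [hv.1])
    exact absurd (Finset.mem_filter.1 this).2 (not_le.2 hc)

namespace IsPoissonProcess

variable {Ω : Type*} [MeasurableSpace Ω] {P : Measure Ω}
  {N : ℝ≥0 → Ω → ℕ} {r : ℝ≥0}

lemma sum_increments (h : IsPoissonProcess P N r) {t : ℕ → ℝ≥0} (ht : Monotone t) (m : ℕ)
    (ω : Ω) : ∑ i ∈ Finset.range m, (N (t (i + 1)) ω - N (t i) ω) = N (t m) ω - N (t 0) ω :=
  Finset.sum_range_tsub (f := fun i => N (t i) ω) (fun _ _ hij => h.mono ω (ht hij)) m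

/-- The path up to time `s` is independent of the increments after time `s`. -/
lemma indepFun_past_future [IsProbabilityMeasure P] (h : IsPoissonProcess P N r) (s : ℝ≥0) :
    IndepFun (fun ω u => N (min u s) ω) (fun ω u => N (s + u) ω - N s ω) P := by
  classical
  refine IndepFun.process_indepFun_process (X := fun u ω => N (min u s) ω)
    (Y := fun u ω => N (s + u) ω - N s ω) (fun u => h.measurable _)
    (fun u => (h.measurable _).sub (h.measurable _)) fun I J => ?_
  set K : Finset ℝ≥0 := insert s (I.image (min · s) ∪ J.image (s + ·)) with hK
  set ix : ℝ≥0 → ℕ := fun u => (K.filter (· ≤ u)).card with hix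
  have hixm : Monotone ix := fun u v huv => Finset.card_le_card fun w hw => by
    simp only [Finset.mem_filter] at hw ⊢
    exact ⟨hw.1, hw.2.trans huv⟩
  have hval : ∀ u ∈ K, ladder K (ix u) = u := fun u hu => ladder_card hu
  have hind := h.indep_increments.nat (ladder_mono K)
  set Y : ℕ → Ω → ℕ := fun i ω => N (ladder K (i + 1)) ω - N (ladder K i) ω with hY
  have hYm : ∀ i, Measurable (Y i) := fun i => (h.measurable _).sub (h.measurable _)
  have hI : Indep (⨆ i ∈ Set.Iio (ix s), MeasurableSpace.comap (Y i) ⊤)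
      (⨆ i ∈ Set.Ici (ix s), MeasurableSpace.comap (Y i) ⊤) P :=
    indep_iSup_of_disjoint (fun i => (hYm i).comap_le) hind
      (Set.disjoint_left.2 fun i hi hi' => absurd (Set.mem_Iio.1 hi) (not_lt.2 hi'))
  have hs : s ∈ K := Finset.mem_insert_self _ _
  refine indep_of_indep_of_le_left (indep_of_indep_of_le_right hI ?_) ?_
  · refine comap_pi_le fun u => ?_
    have hu : s + (u : ℝ≥0) ∈ K := Finset.mem_insert_of_mem
      (Finset.mem_union_right _ (Finset.mem_image_of_mem _ u.2))
    have e : (fun ω => N (s + u) ω - N s ω) =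
        fun ω => ∑ i ∈ Finset.range (ix (s + u) - ix s), Y (ix s + i) ω := by
      funext ω
      have h1 := h.sum_increments (t := fun i => ladder K (ix s + i))
        (fun i j hij => ladder_mono K (by omega)) (ix (s + u) - ix s) ω
      simp only [add_zero] at h1
      rw [Nat.add_sub_cancel' (hixm le_self_add), hval _ hu, hval _ hs] at h1
      exact h1.symm
    rw [e]
    exact comap_sum_le fun i _ => le_iSup₂_of_le (ix s + i) (Nat.le_add_right _ _) le_rfl
  · refine comap_pi_le fun u => ?_
    have hu : min (u : ℝ≥0) s ∈ K := Finset.mem_insert_of_mem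
      (Finset.mem_union_left _ (Finset.mem_image_of_mem _ u.2))
    have e : N (min u s) = fun ω => ∑ i ∈ Finset.range (ix (min u s)), Y i ω := by
      funext ω
      rw [h.sum_increments (ladder_mono K), hval _ hu, ladder_zero, h.zero, Nat.sub_zero]
    rw [e]
    exact comap_sum_le fun i hi =>
      le_iSup₂_of_le i ((Finset.mem_range.1 hi).trans_le (hixm (min_le_right _ _))) le_rfl

/-- The increments after time `s` have the law of the process itself. -/
lemma identDistrib_shift [IsProbabilityMeasure P] {N' : ℝ≥0 → Ω → ℕ} (h : IsPoissonProcess P N r)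
    (h' : IsPoissonProcess P N' r) (s : ℝ≥0) :
    IdentDistrib (fun ω u => N (s + u) ω - N s ω) (fun ω u => N' u ω) P P := by
  refine (identDistrib_iff_forall_finset_identDistrib (X := fun u ω => N (s + u) ω - N s ω)
    (Y := N') (measurable_pi_lambda _ fun u => (h.measurable _).sub (h.measurable _)).aemeasurable
    (measurable_pi_lambda _ fun u => h'.measurable _).aemeasurable).2 fun I => ?_
  have hm : Monotone fun i => s + ladder I i := fun i j hij => by
    exact add_le_add le_rfl (ladder_mono I hij)
  have key := IdentDistrib.pi (μ := P) (ν := P)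
    (X := fun i ω => N (s + ladder I (i + 1)) ω - N (s + ladder I i) ω)
    (Y := fun i ω => N' (ladder I (i + 1)) ω - N' (ladder I i) ω) (fun i => ?_)
    (h.indep_increments.nat hm) (h'.indep_increments.nat (ladder_mono I))
  · have hg : Measurable fun (v : ℕ → ℕ) (u : I) =>
        ∑ i ∈ Finset.range (I.filter (· ≤ (u : ℝ≥0))).card, v i := by fun_prop
    convert! key.comp hg using 1
    · funext ω u
      have h1 := h.sum_increments hm (I.filter (· ≤ (u : ℝ≥0))).card ω
      simp only [ladder_card u.2, ladder_zero, add_zero] at h1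
      exact h1.symm
    · funext ω u
      have h1 := h'.sum_increments (ladder_mono I) (I.filter (· ≤ (u : ℝ≥0))).card ω
      rw [ladder_card u.2, ladder_zero, h'.zero, Nat.sub_zero] at h1
      exact h1.symm
  · have h1 := h.law_increments _ _ (hm (Nat.le_add_right i 1))
    have h2 := h'.law_increments _ _ (ladder_mono I (Nat.le_add_right i 1))
    rw [add_tsub_add_eq_tsub_left] at h1
    exact h1.identDistrib h2

lemma measure_eq_zero (h : IsPoissonProcess P N r) (t : ℝ≥0) :
    P {ω | N t ω = 0} = ENNReal.ofReal (Real.exp (-(r * t))) := by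
  have h1 := (h.law_increments 0 t zero_le).measure_eq (p := fun m => m = 0)
    (measurableSet_singleton 0)
  simp only [h.zero, tsub_zero] at h1
  rw [h1]
  have := poissonMeasure_singleton (r * t) 0
  simpa using this

end IsPoissonProcess

/-! ### The embedded chain of ages at the self-updates of the source -/

/-- Inputs all of whose counting paths are genuine. -/
abbrev RegularInputs (n : ℕ) : Type := {x : Inputs n // x.IsRegular}

/-- The σ-algebra generated by all inputs except the times between the self-updates. -/
instance RegularInputs.instMeasurableSpace (n : ℕ) : MeasurableSpace (RegularInputs n) :=
  (⨆ i : Fin n, MeasurableSpace.comap (fun x u => x.1.src i u) inferInstance) ⊔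
  ((⨆ c : ℕ × Fin n × Fin n,
    MeasurableSpace.comap (fun x u => x.1.clock c.1 c.2.1 c.2.2 u) inferInstance) ⊔
  (⨆ d : ℕ × Fin n, MeasurableSpace.comap (fun x => x.1.recv d.1 d.2) ⊤))

namespace RegularInputs

variable {n : ℕ}

lemma measurable_src (i : Fin n) (u : ℝ≥0) :
    Measurable fun x : RegularInputs n => x.1.src i u := by
  have h : Measurable fun (x : RegularInputs n) u => x.1.src i u :=
    measurable_iff_comap_le.2 (le_sup_of_le_left (le_iSup_of_le i le_rfl))
  exact (measurable_pi_apply u).comp h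

lemma measurable_clock (k : ℕ) (j l : Fin n) (u : ℝ≥0) :
    Measurable fun x : RegularInputs n => x.1.clock k j l u := by
  have h : Measurable fun (x : RegularInputs n) u => x.1.clock k j l u :=
    measurable_iff_comap_le.2
      (le_sup_of_le_right (le_sup_of_le_left (le_iSup_of_le (k, j, l) le_rfl)))
  exact (measurable_pi_apply u).comp h

lemma measurableSet_recv (k : ℕ) (j l : Fin n) :
    MeasurableSet {x : RegularInputs n | l ∈ x.1.recv k j} := by
  have h : MeasurableSpace.comap (fun x : RegularInputs n => x.1.recv k j) ⊤ ≤
      instMeasurableSpace n :=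
    le_sup_of_le_right (le_sup_of_le_right
      (le_iSup_of_le (f := fun d : ℕ × Fin n =>
        MeasurableSpace.comap (fun x : RegularInputs n => x.1.recv d.1 d.2) ⊤) (k, j) le_rfl))
  exact h _ ⟨{A | l ∈ A}, trivial, rfl⟩

variable {β : Type*} [MeasurableSpace β]

/-- The local inputs that begin at a random time can be read at random times. -/
lemma isMeasurableAt {x : β → RegularInputs n} (hx : Measurable x) {s : β → ℝ≥0}
    (hs : Measurable s) {r : β → ℝ} (hr : Measurable r) (k : ℕ) :
    IsMeasurableAt (fun b => (x b).1.localInputs (s b) k) r := by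
  have h1 : ∀ i (v : β → ℝ≥0), Measurable v → Measurable fun b => (x b).1.src i (v b) :=
    fun i v hv => (measurable_eval_of_right_continuous (N := fun t (x : RegularInputs n) =>
      x.1.src i t) (measurable_src i) fun x => x.2.src i).comp (hv.prodMk hx)
  have h2 : ∀ j l (v : β → ℝ≥0), Measurable v → Measurable fun b => (x b).1.clock k j l (v b) :=
    fun j l v hv => (measurable_eval_of_right_continuous (N := fun t (x : RegularInputs n) =>
      x.1.clock k j l t) (measurable_clock k j l) fun x => x.2.clock k j l).comp (hv.prodMk hx)
  refine ⟨fun i ψ hψ _ => ?_, fun j i ψ hψ => ?_, fun j i => hx (measurableSet_recv k j i)⟩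
  · exact (h1 i _ (hs.add (hψ.comp hr).real_toNNReal)).sub (h1 i s hs)
  · exact h2 j i _ (hψ.comp hr).real_toNNReal

end RegularInputs

/-- The time of the self-update number `k` when the times between self-updates are `τ`. -/
def updateTime (τ : ℕ → ℝ) (k : ℕ) : ℝ := ∑ j ∈ Finset.range k, τ j

/-- The ages at the self-updates of the source when the times between self-updates are `τ` and all
other inputs are those of `x`. -/
noncomputable def ageChain {n : ℕ} (q B C : ℝ) (τ : ℕ → ℝ) (x : Inputs n) : ℕ → Fin n → ℕ
  | 0 => 0
  | k + 1 => agesBefore q B C (x.localInputs (updateTime τ k).toNNReal k) (ageChain q B C τ x k)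
      (τ k) + 1

section AgeChain

variable {n : ℕ} {q B C : ℝ}

lemma updateTime_succ (τ : ℕ → ℝ) (k : ℕ) : updateTime τ (k + 1) = updateTime τ k + τ k :=
  Finset.sum_range_succ ..

lemma updateTime_nonneg {τ : ℕ → ℝ} {k : ℕ} (h : ∀ j < k, 0 ≤ τ j) : 0 ≤ updateTime τ k :=
  Finset.sum_nonneg fun j hj => h j (Finset.mem_range.1 hj)

lemma ageChain_congr {τ τ' : ℕ → ℝ} {k : ℕ} (h : ∀ j < k, τ j = τ' j) (x : Inputs n) :
    ageChain q B C τ x k = ageChain q B C τ' x k := by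
  induction k with
  | zero => rfl
  | succ k ih =>
    have e : updateTime τ k = updateTime τ' k :=
      Finset.sum_congr rfl fun j hj => h j ((Finset.mem_range.1 hj).trans (Nat.lt_succ_self k))
    rw [ageChain, ageChain, ih fun j hj => h j (by omega), h k (Nat.lt_succ_self k), e]

lemma Inputs.startVersions_le (x : Inputs n) (k : ℕ) (i : Fin n) :
    x.startVersions q B C k i ≤ k := by
  induction k generalizing i with
  | zero => exact le_rfl
  | succ k ih =>
    rw [Inputs.startVersions, Inputs.evolve_eq_run]
    exact (Inputs.run_le ih _ i).trans (Nat.le_succ k)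

lemma Inputs.versionAge_startVersions {x : Inputs n} (hx : x.IsRegular) (hB : 0 ≤ B)
    (hτ : ∀ k, 0 < x.τ k) (k : ℕ) :
    versionAge k (x.startVersions q B C k) = ageChain q B C x.τ x k := by
  induction k with
  | zero => rfl
  | succ k ih =>
    have hs : ((updateTime x.τ k).toNNReal : ℝ) = x.T k :=
      Real.coe_toNNReal _ (updateTime_nonneg fun j _ => (hτ j).le)
    have hT : x.T (k + 1) = x.T k + x.τ k := updateTime_succ _ _
    rw [ageChain, ← ih, Inputs.agesBefore_localInputs hx hB hs (hτ k), ← hT]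
    funext i
    have h1 := Inputs.run_le (q := q) (B := B) (C := C) (x := x)
      (D := versionAge k (x.startVersions q B C k))
      (x.startVersions_le (q := q) (B := B) (C := C) k)
      (Set.Ioo (x.T k) (x.T (k + 1))) i
    rw [← Inputs.evolve_eq_run] at h1
    simp only [versionAge, Inputs.startVersions, Pi.add_apply, Pi.one_apply]
    omega

lemma Inputs.age_eq {x : Inputs n} (hx : x.IsRegular) (hB : 0 ≤ B) (hτ : ∀ k, 0 < x.τ k)
    {t : ℝ} {k : ℕ} (hk : x.T k ≤ t) (hk' : t < x.T (k + 1)) :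
    x.age q B C t = agesAt q B C (x.localInputs (updateTime x.τ k).toNNReal k)
      (ageChain q B C x.τ x k) (t - updateTime x.τ k) := by
  have hmono : StrictMono x.T := strictMono_nat_of_lt_succ fun j => by
    rw [show x.T (j + 1) = x.T j + x.τ j from updateTime_succ _ _]
    linarith [hτ j]
  have hN : x.sourceVersion t = k := by
    have : {j : ℕ | x.T j ≤ t} = Set.Iic k := by
      ext j
      refine ⟨fun hj => ?_, fun hj => (hmono.monotone hj).trans hk⟩
      exact Nat.lt_succ_iff.1 (hmono.lt_iff_lt.1 (lt_of_le_of_lt hj hk'))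
    rw [Inputs.sourceVersion, this, csSup_Iic]
  have hs : ((updateTime x.τ k).toNNReal : ℝ) = x.T k :=
    Real.coe_toNNReal _ (updateTime_nonneg fun j _ => (hτ j).le)
  have key := Inputs.agesAt_localInputs (q := q) (C := C) hx hB hs (sub_nonneg.2 hk)
    (x.startVersions q B C k)
  rw [add_sub_cancel] at key
  rw [← Inputs.versionAge_startVersions hx hB hτ k]
  refine Eq.trans ?_ key.symm
  funext i
  rw [Inputs.age, Inputs.versions, hN]

variable {β : Type*} [MeasurableSpace β]

lemma measurable_of_fixed_ages {γ : Type*} [MeasurableSpace γ] {F : β → (Fin n → ℕ) → γ}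
    (hF : ∀ D, Measurable fun b => F b D) {D : β → Fin n → ℕ} (hD : Measurable D) :
    Measurable fun b => F b (D b) :=
  (measurable_from_prod_countable_right (f := fun p : (Fin n → ℕ) × β => F p.2 p.1) hF).comp
    (hD.prodMk measurable_id)

lemma measurable_ageChain {τ : β → ℕ → ℝ} {x : β → Inputs n} {k : ℕ}
    (h : ∀ j < k, IsMeasurableAt
      (fun b => (x b).localInputs (updateTime (τ b) j).toNNReal j) fun b => τ b j) :
    Measurable fun b => ageChain q B C (τ b) (x b) k := by
  induction k with
  | zero => exact measurable_const
  | succ k ih =>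
    exact (measurable_of_fixed_ages (fun D => (h k (Nat.lt_succ_self k)).measurable_agesBefore D)
      (ih fun j hj => h j (by omega))).add measurable_const

lemma measurable_updateTime {τ : β → ℕ → ℝ} (hτ : Measurable τ) (k : ℕ) :
    Measurable fun b => updateTime (τ b) k :=
  Finset.measurable_sum _ fun j _ => (measurable_pi_apply j).comp hτ

lemma measurable_ageChain_regular {τ : β → ℕ → ℝ} (hτ : Measurable τ) {x : β → RegularInputs n}
    (hx : Measurable x) (k : ℕ) : Measurable fun b => ageChain q B C (τ b) (x b).1 k :=
  measurable_ageChain fun j _ => RegularInputs.isMeasurableAt hx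
    (measurable_updateTime hτ j).real_toNNReal ((measurable_pi_apply j).comp hτ) j

end AgeChain

/-! ### The Markov property of the embedded chain -/

section

variable {n : ℕ} {q B C : ℝ} {β : Type*} {m : MeasurableSpace β} {X : β → Inputs n}

/-- For fixed times between self-updates, the ages at the `k`-th self-update depend only on the
source updates up to this time and on the gossip inputs of the earlier intervals. -/
lemma comap_ageChain_le {τ : ℕ → ℝ} {k : ℕ} (hτ : ∀ j < k, 0 ≤ τ j)
    (hsrc : ∀ i u, u ≤ (updateTime τ k).toNNReal →
      MeasurableSpace.comap (fun b => (X b).src i u) inferInstance ≤ m)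
    (hclock : ∀ j < k, ∀ a l u,
      MeasurableSpace.comap (fun b => (X b).clock j a l u) inferInstance ≤ m)
    (hrecv : ∀ j < k, ∀ a l, MeasurableSet[m] {b | l ∈ (X b).recv j a}) :
    MeasurableSpace.comap (fun b => ageChain q B C τ (X b) k) inferInstance ≤ m := by
  refine measurable_iff_comap_le.1 (measurable_ageChain (τ := fun _ => τ) fun j hj =>
    ⟨fun i ψ _ hψ => ?_, fun a l ψ _ => measurable_iff_comap_le.2 (hclock j hj a l _),
      fun a l => hrecv j hj a l⟩)
  have h0 : (updateTime τ j).toNNReal + (τ j).toNNReal ≤ (updateTime τ k).toNNReal := by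
    rw [← Real.toNNReal_add (updateTime_nonneg fun i hi => hτ i (hi.trans hj)) (hτ j hj),
      ← updateTime_succ]
    refine Real.toNNReal_le_toNNReal (Finset.sum_le_sum_of_subset_of_nonneg
      (Finset.range_subset_range.2 hj) fun i hi _ => hτ i (Finset.mem_range.1 hi))
  exact (measurable_iff_comap_le.2 (hsrc i _ ((add_le_add le_rfl (hψ _)).trans h0))).sub
    (measurable_iff_comap_le.2 (hsrc i _ (le_self_add.trans h0)))

lemma comap_localInputs_le {s : ℝ≥0} {k : ℕ}
    (hsrc : ∀ i, MeasurableSpace.comap (fun b u => (X b).src i (s + u) - (X b).src i s)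
      inferInstance ≤ m)
    (hclock : ∀ a l u, MeasurableSpace.comap (fun b => (X b).clock k a l u) inferInstance ≤ m)
    (hrecv : ∀ a l, MeasurableSet[m] {b | l ∈ (X b).recv k a}) :
    MeasurableSpace.comap (fun b => (X b).localInputs s k) inferInstance ≤ m :=
  measurable_iff_comap_le.1 ((measurable_pi_lambda _ fun i => measurable_iff_comap_le.2 (hsrc i)).prodMk
    ((measurable_pi_lambda _ fun a => measurable_pi_lambda _ fun l => measurable_pi_lambda _ fun u =>
        measurable_iff_comap_le.2 (hclock a l u)).prodMk
      (measurable_pi_lambda _ fun a => measurable_pi_lambda _ fun l => (hrecv a l).mem)))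

end

namespace IsNetwork

section

variable {Ω : Type*} {n : ℕ}

/-- The σ-algebras generated by the single inputs of the network. -/
abbrev inputAlgebra (X : Ω → Inputs n) :
    ℕ ⊕ Fin n ⊕ (ℕ × Fin n × Fin n) ⊕ (ℕ × Fin n) → MeasurableSpace Ω :=
  Sum.elim (fun k : ℕ => MeasurableSpace.comap (fun ω => (X ω).τ k) inferInstance)
    (Sum.elim (fun i : Fin n => ⨆ t : ℝ≥0, MeasurableSpace.comap (fun ω => (X ω).src i t) ⊤)
    (Sum.elim
      (fun c : ℕ × Fin n × Fin n =>
        ⨆ t : ℝ≥0, MeasurableSpace.comap (fun ω => (X ω).clock c.1 c.2.1 c.2.2 t) ⊤)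
      (fun d : ℕ × Fin n => MeasurableSpace.comap (fun ω => (X ω).recv d.1 d.2) ⊤)))

lemma comap_τ_le (X : Ω → Inputs n) {S : Set (ℕ ⊕ Fin n ⊕ (ℕ × Fin n × Fin n) ⊕ (ℕ × Fin n))}
    {k : ℕ} (hk : Sum.inl k ∈ S) :
    MeasurableSpace.comap (fun ω => (X ω).τ k) inferInstance ≤ ⨆ c ∈ S, inputAlgebra X c :=
  le_iSup₂_of_le (f := fun c (_ : c ∈ S) => inputAlgebra X c) _ hk le_rfl

lemma comap_src_le (X : Ω → Inputs n) {S : Set (ℕ ⊕ Fin n ⊕ (ℕ × Fin n × Fin n) ⊕ (ℕ × Fin n))}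
    {i : Fin n} (hi : Sum.inr (Sum.inl i) ∈ S) :
    MeasurableSpace.comap (fun ω u => (X ω).src i u) inferInstance ≤
      ⨆ c ∈ S, inputAlgebra X c :=
  le_iSup₂_of_le (f := fun c (_ : c ∈ S) => inputAlgebra X c) _ hi
    (comap_pi_le fun u => le_iSup_of_le u le_rfl)

lemma comap_clock_le (X : Ω → Inputs n)
    {S : Set (ℕ ⊕ Fin n ⊕ (ℕ × Fin n × Fin n) ⊕ (ℕ × Fin n))} {k : ℕ} {j l : Fin n}
    (hi : Sum.inr (Sum.inr (Sum.inl (k, j, l))) ∈ S) :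
    MeasurableSpace.comap (fun ω u => (X ω).clock k j l u) inferInstance ≤
      ⨆ c ∈ S, inputAlgebra X c :=
  le_iSup₂_of_le (f := fun c (_ : c ∈ S) => inputAlgebra X c) _ hi
    (comap_pi_le fun u => le_iSup_of_le u le_rfl)

lemma comap_recv_le (X : Ω → Inputs n)
    {S : Set (ℕ ⊕ Fin n ⊕ (ℕ × Fin n × Fin n) ⊕ (ℕ × Fin n))} {k : ℕ} {j : Fin n}
    (hi : Sum.inr (Sum.inr (Sum.inr (k, j))) ∈ S) :
    MeasurableSpace.comap (fun ω => (X ω).recv k j) ⊤ ≤ ⨆ c ∈ S, inputAlgebra X c :=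
  le_iSup₂_of_le (f := fun c (_ : c ∈ S) => inputAlgebra X c) _ hi le_rfl

end

variable {Ω : Type*} [MeasurableSpace Ω] {P : Measure Ω} {n : ℕ} {X : Ω → Inputs n}
  {lamE lam q : ℝ}

lemma isRegular (hX : IsNetwork P X lamE lam q) (ω : Ω) : (X ω).IsRegular :=
  ⟨fun i => (hX.poisson_src i).isCountingPath ω,
    fun k j l => (hX.poisson_clock k j l).isCountingPath ω⟩

/-- The random inputs as a random element of the space of regular inputs. -/
def regularInputs (hX : IsNetwork P X lamE lam q) (ω : Ω) : RegularInputs n :=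
  ⟨X ω, hX.isRegular ω⟩

lemma measurableSet_recv_mem (hX : IsNetwork P X lamE lam q) (k : ℕ) (j : Fin n)
    (E : Set (Finset (Fin n))) : MeasurableSet {ω | (X ω).recv k j ∈ E} := by
  have : {ω | (X ω).recv k j ∈ E} = ⋃ A ∈ E, {ω | (X ω).recv k j = A} := by
    ext ω
    simp
  rw [this]
  exact MeasurableSet.biUnion (Set.to_countable E) fun A _ => hX.measurable_recv k j A

lemma inputAlgebra_le (hX : IsNetwork P X lamE lam q)
    (c : ℕ ⊕ Fin n ⊕ (ℕ × Fin n × Fin n) ⊕ (ℕ × Fin n)) :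
    inputAlgebra X c ≤ (inferInstance : MeasurableSpace Ω) := by
  rcases c with k | i | c | d
  · exact (hX.measurable_τ k).comap_le
  · exact iSup_le fun t => ((hX.poisson_src i).measurable t).comap_le
  · exact iSup_le fun t => ((hX.poisson_clock c.1 c.2.1 c.2.2).measurable t).comap_le
  · rintro _ ⟨E, -, rfl⟩
    exact hX.measurableSet_recv_mem d.1 d.2 E

lemma indepFun_of_disjoint (hX : IsNetwork P X lamE lam q) {β γ : Type*} [MeasurableSpace β]
    [MeasurableSpace γ] {f : Ω → β} {g : Ω → γ}
    {S T : Set (ℕ ⊕ Fin n ⊕ (ℕ × Fin n × Fin n) ⊕ (ℕ × Fin n))} (hST : Disjoint S T)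
    (hf : MeasurableSpace.comap f inferInstance ≤ ⨆ c ∈ S, inputAlgebra X c)
    (hg : MeasurableSpace.comap g inferInstance ≤ ⨆ c ∈ T, inputAlgebra X c) :
    IndepFun f g P :=
  indep_of_indep_of_le_left (indep_of_indep_of_le_right
    (indep_iSup_of_disjoint hX.inputAlgebra_le hX.indep hST) hg) hf

lemma comap_regularInputs_le (hX : IsNetwork P X lamE lam q) :
    MeasurableSpace.comap hX.regularInputs inferInstance ≤
      ⨆ c ∈ Set.range Sum.inr, inputAlgebra X c := by
  simp only [RegularInputs.instMeasurableSpace, MeasurableSpace.comap_sup,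
    MeasurableSpace.comap_iSup, MeasurableSpace.comap_comp]
  refine sup_le (iSup_le fun i => ?_) (sup_le (iSup_le fun c => ?_) (iSup_le fun d => ?_))
  · exact comap_src_le X ⟨_, rfl⟩
  · exact comap_clock_le X ⟨_, rfl⟩
  · exact comap_recv_le X ⟨_, rfl⟩

lemma measurable_regularInputs (hX : IsNetwork P X lamE lam q) : Measurable hX.regularInputs :=
  measurable_iff_comap_le.2 (hX.comap_regularInputs_le.trans
    (iSup₂_le fun c _ => hX.inputAlgebra_le c))

lemma measurable_times (hX : IsNetwork P X lamE lam q) : Measurable fun ω => (X ω).τ :=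
  measurable_pi_lambda _ hX.measurable_τ

lemma indepFun_times_regularInputs (hX : IsNetwork P X lamE lam q) :
    IndepFun (fun ω => (X ω).τ) hX.regularInputs P := by
  refine hX.indepFun_of_disjoint (S := Set.range Sum.inl) (T := Set.range Sum.inr) ?_
    (comap_pi_le fun k => comap_τ_le X ⟨k, rfl⟩) hX.comap_regularInputs_le
  rw [Set.disjoint_left]
  rintro _ ⟨k, rfl⟩ ⟨c, hc⟩
  cases hc

/-- The length of an interval is independent of the lengths of the earlier intervals and of all
messages. -/
lemma indepFun_time_past (hX : IsNetwork P X lamE lam q) (k : ℕ) :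
    IndepFun (fun ω => (X ω).τ k)
      (fun ω => ((fun j : ℕ => if j < k then (X ω).τ j else 0 : ℕ → ℝ), hX.regularInputs ω)) P := by
  refine hX.indepFun_of_disjoint (S := {Sum.inl k}) (T := {Sum.inl k}ᶜ) disjoint_compl_right
    (comap_τ_le X rfl) ?_
  refine measurable_iff_comap_le.1 (Measurable.prodMk ?_ ?_)
  · refine measurable_iff_comap_le.2 (comap_pi_le
      (X := fun (j : ℕ) ω => if j < k then (X ω).τ j else 0) fun j => ?_)
    split_ifs with hj
    · exact comap_τ_le X (by simpa using hj.ne)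
    · exact measurable_iff_comap_le.1 measurable_const
  · refine measurable_iff_comap_le.2 (hX.comap_regularInputs_le.trans
      (biSup_mono fun c hc => ?_))
    obtain ⟨d, rfl⟩ := hc
    simp

variable [IsProbabilityMeasure P]

/-- For fixed times between self-updates, the local inputs of the interval `k` are independent of
the ages at its beginning. -/
lemma indepFun_ageChain_localInputs (hX : IsNetwork P X lamE lam q) (B C : ℝ) {τ : ℕ → ℝ} {k : ℕ}
    (hτ : ∀ j < k, 0 ≤ τ j) :
    IndepFun (fun ω => ageChain q B C τ (X ω) k)
      (fun ω => (X ω).localInputs (updateTime τ k).toNNReal k) P := by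
  classical
  set s := (updateTime τ k).toNNReal with hs
  set a : ℕ ⊕ Fin n ⊕ (ℕ × Fin n × Fin n) ⊕ (ℕ × Fin n) → MeasurableSpace Ω :=
    Sum.elim (fun _ => ⊥)
    (Sum.elim (fun i => MeasurableSpace.comap (fun ω u => (X ω).src i (min u s)) inferInstance)
    (Sum.elim (fun c => if c.1 < k then inputAlgebra X (Sum.inr (Sum.inr (Sum.inl c))) else ⊥)
      (fun d => if d.1 < k then inputAlgebra X (Sum.inr (Sum.inr (Sum.inr d))) else ⊥))) with ha
  set b : ℕ ⊕ Fin n ⊕ (ℕ × Fin n × Fin n) ⊕ (ℕ × Fin n) → MeasurableSpace Ω :=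
    Sum.elim (fun _ => ⊥)
    (Sum.elim (fun i => MeasurableSpace.comap (fun ω u => (X ω).src i (s + u) - (X ω).src i s)
      inferInstance)
    (Sum.elim (fun c => if c.1 = k then inputAlgebra X (Sum.inr (Sum.inr (Sum.inl c))) else ⊥)
      (fun d => if d.1 = k then inputAlgebra X (Sum.inr (Sum.inr (Sum.inr d))) else ⊥))) with hb
  have hind : Indep (⨆ c, a c) (⨆ c, b c) P := by
    refine indep_iSup_of_pairwise_indep hX.indep hX.inputAlgebra_le ?_ ?_ ?_
    · rintro (j | i | c | d)
      · exact bot_le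
      · exact comap_pi_le fun u => le_iSup_of_le (min u s) le_rfl
      · simp only [ha, Sum.elim_inr, Sum.elim_inl]
        split_ifs
        exacts [le_rfl, bot_le]
      · simp only [ha, Sum.elim_inr]
        split_ifs
        exacts [le_rfl, bot_le]
    · rintro (j | i | c | d)
      · exact bot_le
      · refine comap_pi_le (X := fun u ω => (X ω).src i (s + u) - (X ω).src i s) fun u => ?_
        refine measurable_iff_comap_le.1 (Measurable.sub ?_ ?_)
        · exact measurable_iff_comap_le.2 (le_iSup_of_le (s + u) le_rfl)
        · exact measurable_iff_comap_le.2 (le_iSup_of_le s le_rfl)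
      · simp only [hb, Sum.elim_inr, Sum.elim_inl]
        split_ifs
        exacts [le_rfl, bot_le]
      · simp only [hb, Sum.elim_inr]
        split_ifs
        exacts [le_rfl, bot_le]
    · rintro (j | i | c | d)
      · exact indep_bot_left _
      · exact (hX.poisson_src i).indepFun_past_future s
      · by_cases hc : c.1 < k
        · simp only [hb, Sum.elim_inr, Sum.elim_inl, if_neg hc.ne]
          exact indep_bot_right _
        · simp only [ha, Sum.elim_inr, Sum.elim_inl, if_neg hc]
          exact indep_bot_left _
      · by_cases hc : d.1 < k
        · simp only [hb, Sum.elim_inr, if_neg hc.ne]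
          exact indep_bot_right _
        · simp only [ha, Sum.elim_inr, if_neg hc]
          exact indep_bot_left _
  refine indep_of_indep_of_le_left (indep_of_indep_of_le_right hind ?_) ?_
  · refine comap_localInputs_le (fun i => ?_) (fun j l u => ?_) fun j l => ?_
    · exact le_iSup_of_le (f := b) (Sum.inr (Sum.inl i)) le_rfl
    · refine le_iSup_of_le (f := b) (Sum.inr (Sum.inr (Sum.inl (k, j, l)))) ?_
      simp only [hb, Sum.elim_inr, Sum.elim_inl, if_true]
      exact le_iSup_of_le u le_rfl
    · have hbk : b (Sum.inr (Sum.inr (Sum.inr (k, j)))) =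
          MeasurableSpace.comap (fun ω => (X ω).recv k j) ⊤ := by
        simp only [hb, Sum.elim_inr, if_true]
      exact (hbk ▸ le_iSup b _) _ ⟨{A | l ∈ A}, trivial, rfl⟩
  · refine comap_ageChain_le hτ (fun i u hu => ?_) (fun j hj c l u => ?_) fun j hj c l => ?_
    · refine le_iSup_of_le (f := a) (Sum.inr (Sum.inl i)) ?_
      have h1 := (measurable_pi_apply u).comp
        (comap_measurable (fun (ω : Ω) (u : ℝ≥0) => (X ω).src i (min u s)))
      have hu' : u ≤ s := hu
      simp only [Function.comp_def, min_eq_left hu'] at h1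
      exact measurable_iff_comap_le.1 h1
    · refine le_iSup_of_le (f := a) (Sum.inr (Sum.inr (Sum.inl (j, c, l)))) ?_
      simp only [ha, Sum.elim_inr, Sum.elim_inl, if_pos hj]
      exact le_iSup_of_le u le_rfl
    · have haj : a (Sum.inr (Sum.inr (Sum.inr (j, c)))) =
          MeasurableSpace.comap (fun ω => (X ω).recv j c) ⊤ := by
        simp only [ha, Sum.elim_inr, if_pos hj]
      exact (haj ▸ le_iSup a _) _ ⟨{A | l ∈ A}, trivial, rfl⟩

end IsNetwork

lemma fanout_le {n : ℕ} (hn : 0 < n) {q : ℝ} (hq1 : q ≤ 1) : fanout n q ≤ n - 1 := by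
  refine Nat.floor_le_of_le ?_
  rw [Nat.cast_sub hn, Nat.cast_one]
  have : (1 : ℝ) ≤ n := by exact_mod_cast hn
  nlinarith

namespace IsNetwork

variable {Ω : Type*} [MeasurableSpace Ω] {P : Measure Ω} [IsProbabilityMeasure P] {n : ℕ}
  {X : Ω → Inputs n} {lamE lam q : ℝ}

/-- The law of the set of receivers; sets of a wrong size or with the sender have probability
`0`. -/
lemma measure_recv_eq (hX : IsNetwork P X lamE lam q) (hq1 : q ≤ 1) (k : ℕ) (j : Fin n)
    (A : Finset (Fin n)) :
    P {ω | (X ω).recv k j = A} =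
      if A ∈ Finset.powersetCard (fanout n q) (Finset.univ.erase j) then
        ((n - 1).choose (fanout n q) : ℝ≥0∞)⁻¹ else 0 := by
  split_ifs with hA
  · exact hX.law_recv k j A hA
  · set F := Finset.powersetCard (fanout n q) (Finset.univ.erase j) with hF
    have h0 : (n - 1).choose (fanout n q) ≠ 0 :=
      (Nat.choose_pos (fanout_le j.pos hq1)).ne'
    have h1 : P (⋃ A ∈ F, {ω | (X ω).recv k j = A}) = 1 := by
      rw [measure_biUnion_finset (fun A _ A' _ hAA' => Set.disjoint_left.2 fun ω h h' =>
          hAA' (h.symm.trans h')) fun A _ => hX.measurable_recv k j A,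
        Finset.sum_congr rfl fun A hA => hX.law_recv k j A hA, Finset.sum_const,
        Finset.card_powersetCard, Finset.card_erase_of_mem (Finset.mem_univ j), Finset.card_univ,
        Fintype.card_fin, nsmul_eq_mul, ENNReal.mul_inv_cancel (by exact_mod_cast h0)
          (ENNReal.natCast_ne_top _)]
    have h2 : P (⋃ A ∈ F, {ω | (X ω).recv k j = A})ᶜ = 0 :=
      (prob_compl_eq_zero_iff (F.measurableSet_biUnion fun A _ =>
        hX.measurable_recv k j A)).2 h1
    refine measure_mono_null (fun ω hω => ?_) h2
    simp only [Set.mem_compl_iff, Set.mem_iUnion, not_exists]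
    rintro A' hA' rfl
    exact hA (hω ▸ hA')

lemma identDistrib_recv (hX : IsNetwork P X lamE lam q) (hq1 : q ≤ 1) (k : ℕ) (j : Fin n) :
    IdentDistrib (fun ω l => l ∈ (X ω).recv k j) (fun ω l => l ∈ (X ω).recv 0 j) P P := by
  have hm : ∀ k, Measurable fun ω l => l ∈ (X ω).recv k j := fun k =>
    measurable_pi_lambda _ fun l => (hX.measurableSet_recv_mem k j {A | l ∈ A}).mem
  refine ⟨(hm k).aemeasurable, (hm 0).aemeasurable, ?_⟩
  refine Measure.ext_of_singleton fun v => ?_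
  rw [Measure.map_apply (hm k) (measurableSet_singleton v),
    Measure.map_apply (hm 0) (measurableSet_singleton v)]
  classical
  have key : ∀ k, (fun ω l => l ∈ (X ω).recv k j) ⁻¹' {v} =
      {ω | (X ω).recv k j = Finset.univ.filter v} := fun k => by
    ext ω
    simp only [Set.mem_preimage, Set.mem_singleton_iff, Set.mem_ofPred_eq]
    constructor
    · rintro rfl
      ext l
      simp
    · intro h
      funext l
      simp [h]
  rw [key, key, hX.measure_recv_eq hq1, hX.measure_recv_eq hq1]

/-- The local inputs of all intervals have the same law. -/
lemma identDistrib_localInputs (hX : IsNetwork P X lamE lam q) (hq1 : q ≤ 1) (s : ℝ≥0) (k : ℕ) :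
    IdentDistrib (fun ω => (X ω).localInputs s k) (fun ω => (X ω).localInputs 0 0) P P := by
  have ind : ∀ {ι : Type} (g : ι → ℕ ⊕ Fin n ⊕ (ℕ × Fin n × Fin n) ⊕ (ℕ × Fin n)),
      g.Injective → iIndep (fun c => inputAlgebra X (g c)) P := fun g hg => hX.indep.precomp hg
  -- source updates
  have hsrcind : ∀ s, iIndepFun (fun i ω (u : ℝ≥0) => (X ω).src i (s + u) - (X ω).src i s) P :=
    fun s => iIndep_of_iIndep_of_le (ind (fun i => Sum.inr (Sum.inl i))
      (fun i i' h => by simpa using h))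
      fun i => comap_pi_le (X := fun u ω => (X ω).src i (s + u) - (X ω).src i s) fun u =>
        measurable_iff_comap_le.1 (Measurable.sub
          (measurable_iff_comap_le.2 (le_iSup_of_le (s + u) le_rfl))
          (measurable_iff_comap_le.2 (le_iSup_of_le s le_rfl)))
  have hsrc := IdentDistrib.pi (fun i => ((hX.poisson_src i).identDistrib_shift
    (hX.poisson_src i) s).trans ((hX.poisson_src i).identDistrib_shift
    (hX.poisson_src i) 0).symm) (hsrcind s) (hsrcind 0)
  -- gossip clocks
  have hclockind : ∀ k, iIndepFun
      (fun (c : Fin n × Fin n) ω (u : ℝ≥0) => (X ω).clock k c.1 c.2 u) P := fun k =>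
    iIndep_of_iIndep_of_le (ind (fun c : Fin n × Fin n => Sum.inr (Sum.inr (Sum.inl (k, c))))
      (fun c c' h => by simpa using h)) fun c =>
        comap_pi_le (X := fun u ω => (X ω).clock k c.1 c.2 u) fun u => le_iSup_of_le u le_rfl
  have hshift : ∀ k j l, IdentDistrib (fun ω u => (X ω).clock k j l u)
      (fun ω u => (X ω).clock 0 j l u) P P := fun k j l => by
    have h1 := (hX.poisson_clock k j l).identDistrib_shift (hX.poisson_clock 0 j l) 0
    simpa [(hX.poisson_clock k j l).zero] using h1
  have hclock := (IdentDistrib.pi (fun c : Fin n × Fin n => hshift k c.1 c.2) (hclockind k)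
    (hclockind 0)).comp (u := fun v (j l : Fin n) => v (j, l)) (by fun_prop)
  -- receivers
  have hrecvind : ∀ k, iIndepFun (fun (j : Fin n) ω l => l ∈ (X ω).recv k j) P := fun k =>
    iIndep_of_iIndep_of_le (ind (fun j : Fin n => Sum.inr (Sum.inr (Sum.inr (k, j))))
      (fun c c' h => by simpa using h)) fun j =>
        comap_pi_le (X := fun l ω => l ∈ (X ω).recv k j) fun l =>
          comap_mem_le (R := fun ω => (X ω).recv k j) le_rfl l
  have hrecv := IdentDistrib.pi (fun j => hX.identDistrib_recv hq1 k j) (hrecvind k) (hrecvind 0)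
  -- joint law
  have hgossip : ∀ k, IndepFun (fun ω (j l : Fin n) (u : ℝ≥0) => (X ω).clock k j l u)
      (fun ω j l => l ∈ (X ω).recv k j) P := fun k => by
    refine hX.indepFun_of_disjoint
      (S := Set.range fun c => Sum.inr (Sum.inr (Sum.inl c)))
      (T := Set.range fun c => Sum.inr (Sum.inr (Sum.inr c))) ?_ ?_ ?_
    · rw [Set.disjoint_left]
      rintro _ ⟨c, rfl⟩ ⟨d, hd⟩
      simp at hd
    · exact comap_pi_le (X := fun j ω (l : Fin n) (u : ℝ≥0) => (X ω).clock k j l u) fun j =>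
        comap_pi_le (X := fun l ω (u : ℝ≥0) => (X ω).clock k j l u) fun l =>
          comap_clock_le X ⟨(k, j, l), rfl⟩
    · exact comap_pi_le (X := fun j ω l => l ∈ (X ω).recv k j) fun j =>
        comap_pi_le (X := fun l ω => l ∈ (X ω).recv k j) fun l =>
          comap_mem_le (comap_recv_le X (Set.mem_range_self (k, j))) l
  have hall : ∀ s k, IndepFun (fun ω i (u : ℝ≥0) => (X ω).src i (s + u) - (X ω).src i s)
      (fun ω => ((fun (j l : Fin n) (u : ℝ≥0) => (X ω).clock k j l u),
        fun j l => l ∈ (X ω).recv k j)) P := fun s k => by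
    refine hX.indepFun_of_disjoint (S := Set.range fun c => Sum.inr (Sum.inl c))
      (T := Set.range fun c => Sum.inr (Sum.inr c)) ?_ ?_ ?_
    · rw [Set.disjoint_left]
      rintro _ ⟨c, rfl⟩ ⟨d, hd⟩
      simp at hd
    · refine comap_pi_le (X := fun i ω (u : ℝ≥0) => (X ω).src i (s + u) - (X ω).src i s) fun i =>
        comap_pi_le (X := fun u ω => (X ω).src i (s + u) - (X ω).src i s) fun u => ?_
      have h1 := measurable_iff_comap_le.2 (comap_src_le X
        (S := Set.range fun c => Sum.inr (Sum.inl c)) ⟨i, rfl⟩)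
      exact measurable_iff_comap_le.1 (((measurable_pi_apply (s + u)).comp h1).sub
        ((measurable_pi_apply s).comp h1))
    · refine comap_prodMk_le ?_ ?_
      · exact comap_pi_le (X := fun j ω (l : Fin n) (u : ℝ≥0) => (X ω).clock k j l u) fun j =>
          comap_pi_le (X := fun l ω (u : ℝ≥0) => (X ω).clock k j l u) fun l =>
            comap_clock_le X ⟨Sum.inl (k, j, l), rfl⟩
      · exact comap_pi_le (X := fun j ω l => l ∈ (X ω).recv k j) fun j =>
          comap_pi_le (X := fun l ω => l ∈ (X ω).recv k j) fun l =>
            comap_mem_le (comap_recv_le X (Set.mem_range_self (Sum.inr (k, j)))) l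
  exact hsrc.prodMk (hclock.prodMk hrecv (hgossip k) (hgossip 0)) (hall s k) (hall 0 0)

end IsNetwork

lemma lintegral_of_indepFun {Ω β γ : Type*} [MeasurableSpace Ω] [MeasurableSpace β]
    [MeasurableSpace γ] {P : Measure Ω} [IsProbabilityMeasure P] {f : Ω → β} {g : Ω → γ}
    (hfg : IndepFun f g P) (hf : Measurable f) (hg : Measurable g) {Ψ : β → γ → ℝ≥0∞}
    (hΨ : Measurable (Function.uncurry Ψ)) :
    ∫⁻ ω, Ψ (f ω) (g ω) ∂P = ∫⁻ ω, ∫⁻ ω', Ψ (f ω) (g ω') ∂P ∂P := by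
  have h1 := (indepFun_iff_map_prod_eq_prod_map_map hf.aemeasurable hg.aemeasurable).1 hfg
  have h2 : ∫⁻ p, Function.uncurry Ψ p ∂(P.map fun ω => (f ω, g ω)) =
      ∫⁻ ω, Ψ (f ω) (g ω) ∂P := lintegral_map hΨ (hf.prodMk hg)
  have : IsProbabilityMeasure (P.map g) := Measure.isProbabilityMeasure_map hg.aemeasurable
  rw [← h2, h1, lintegral_prod _ hΨ.aemeasurable, lintegral_map hΨ.lintegral_prod_right' hf]
  refine lintegral_congr fun ω => ?_
  exact lintegral_map (f := fun y => Function.uncurry Ψ (f ω, y))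
    (hΨ.comp measurable_prodMk_left) hg

/-- The ages in an interval after some elapsed time, either just before this time or with the
messages at this very time included. -/
noncomputable def ages {n : ℕ} (q B C : ℝ) (before : Bool) (y : LocalInputs n) (D : Fin n → ℕ)
    (r : ℝ) : Fin n → ℕ :=
  bif before then agesBefore q B C y D r else agesAt q B C y D r

lemma IsMeasurableAt.measurable_ages {n : ℕ} {q B C : ℝ} {β : Type*} [MeasurableSpace β]
    {y : β → LocalInputs n} {r : β → ℝ} (h : IsMeasurableAt y r) (e : Bool) (D : Fin n → ℕ) :
    Measurable fun b => ages q B C e (y b) D (r b) := by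
  cases e
  · exact h.measurable_agesAt D
  · exact h.measurable_agesBefore D

namespace IsNetwork

variable {Ω : Type*} [MeasurableSpace Ω] {P : Measure Ω} {n : ℕ} {X : Ω → Inputs n}
  {lamE lam q : ℝ}

lemma ae_time_pos (hX : IsNetwork P X lamE lam q) : ∀ᵐ ω ∂P, ∀ k, 0 < (X ω).τ k := by
  refine ae_all_iff.2 fun k => ?_
  have h0 : expMeasure lamE (Set.Iic 0) = 0 := by
    rw [← Set.Iio_union_right, measure_union_null_iff]
    constructor
    · rw [expMeasure, gammaMeasure, withDensity_apply _ measurableSet_Iio]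
      exact lintegral_gammaPDF_of_nonpos le_rfl
    · exact withDensity_absolutelyContinuous _ _ (measure_singleton 0)
  have h1 := (hX.law_τ k).measure_eq (p := fun r => r ≤ 0) measurableSet_Iic
  rw [ae_iff]
  simp only [not_lt]
  rw [h1]
  exact h0

lemma measurable_localInputs (hX : IsNetwork P X lamE lam q) (s : ℝ≥0) (k : ℕ) :
    Measurable fun ω => (X ω).localInputs s k :=
  measurable_iff_comap_le.2 (comap_localInputs_le
    (fun i => (measurable_pi_lambda _ fun u => ((hX.poisson_src i).measurable (s + u)).sub
      ((hX.poisson_src i).measurable s)).comap_le)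
    (fun a l u => ((hX.poisson_clock k a l).measurable u).comap_le)
    fun a l => hX.measurableSet_recv_mem k a {A | l ∈ A})

/-- The law of the inputs makes the embedded chain a Markov chain: the conditional law of the ages
in the interval `k`, given the time `T k` and the ages at this time, is that of the ages in an
interval that begins at time `0`, with an independent exponential length. -/
lemma lintegral_ages_step [IsProbabilityMeasure P] (hX : IsNetwork P X lamE lam q) (hq1 : q ≤ 1)
    (B C : ℝ) (e : Bool) (k : ℕ) {h : ℝ → ℝ → (Fin n → ℕ) → ℝ≥0∞}
    (hh : ∀ A, Measurable fun p : ℝ × ℝ => h p.1 p.2 A) {ρ : ℝ → ℝ → ℝ}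
    (hρ : Measurable (Function.uncurry ρ)) :
    ∫⁻ ω, h (updateTime (X ω).τ k) ((X ω).τ k)
        (ages q B C e ((X ω).localInputs (updateTime (X ω).τ k).toNNReal k)
          (ageChain q B C (X ω).τ (X ω) k) (ρ (updateTime (X ω).τ k) ((X ω).τ k))) ∂P =
      ∫⁻ ω, ∫⁻ r, ∫⁻ ω', h (updateTime (X ω).τ k) r
        (ages q B C e ((X ω').localInputs 0 0) (ageChain q B C (X ω).τ (X ω) k)
          (ρ (updateTime (X ω).τ k) r)) ∂P ∂(expMeasure lamE) ∂P := by
  set H : ℝ → ℝ → (Fin n → ℕ) → ℝ≥0∞ := fun s r D =>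
    ∫⁻ ω', h s r (ages q B C e ((X ω').localInputs 0 0) D (ρ s r)) ∂P with hH
  have hHm : ∀ D, Measurable fun p : ℝ × ℝ => H p.1 p.2 D := fun D => by
    refine Measurable.lintegral_prod_right' (f := fun z : (ℝ × ℝ) × Ω =>
      h z.1.1 z.1.2 (ages q B C e ((X z.2).localInputs 0 0) D (ρ z.1.1 z.1.2))) ?_
    refine measurable_of_fixed_ages (F := fun (z : (ℝ × ℝ) × Ω) A => h z.1.1 z.1.2 A)
      (fun A => (hh A).comp measurable_fst) ?_
    exact (RegularInputs.isMeasurableAt (x := fun z : (ℝ × ℝ) × Ω => hX.regularInputs z.2)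
      (hX.measurable_regularInputs.comp measurable_snd) (s := fun _ => 0) measurable_const
      (hρ.comp measurable_fst) 0).measurable_ages e D
  have hpm : ∀ j, Measurable fun p : (ℕ → ℝ) × RegularInputs n => p.1 j := fun j =>
    (measurable_pi_apply j).comp measurable_fst
  have hTm := measurable_updateTime (β := (ℕ → ℝ) × RegularInputs n) measurable_fst k
  have hDm := measurable_ageChain_regular (q := q) (B := B) (C := C)
    (β := (ℕ → ℝ) × RegularInputs n) measurable_fst measurable_snd k
  -- fix the times between self-updates
  have hΨ : Measurable (Function.uncurry fun (t : ℕ → ℝ) (x : RegularInputs n) =>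
      h (updateTime t k) (t k) (ages q B C e (x.1.localInputs (updateTime t k).toNNReal k)
        (ageChain q B C t x.1 k) (ρ (updateTime t k) (t k)))) := by
    refine measurable_of_fixed_ages (F := fun (z : (ℕ → ℝ) × RegularInputs n) A =>
      h (updateTime z.1 k) (z.1 k) A) (fun A => (hh A).comp (hTm.prodMk (hpm k))) ?_
    refine measurable_of_fixed_ages (F := fun (z : (ℕ → ℝ) × RegularInputs n) D =>
      ages q B C e (z.2.1.localInputs (updateTime z.1 k).toNNReal k) D
        (ρ (updateTime z.1 k) (z.1 k))) (fun D => ?_) hDm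
    exact (RegularInputs.isMeasurableAt (x := fun z : (ℕ → ℝ) × RegularInputs n => z.2)
      measurable_snd hTm.real_toNNReal (hρ.comp (hTm.prodMk (hpm k))) k).measurable_ages e D
  have hΨ' : Measurable (Function.uncurry fun (t : ℕ → ℝ) (x : RegularInputs n) =>
      H (updateTime t k) (t k) (ageChain q B C t x.1 k)) :=
    measurable_of_fixed_ages (F := fun (z : (ℕ → ℝ) × RegularInputs n) A =>
      H (updateTime z.1 k) (z.1 k) A) (fun A => (hHm A).comp (hTm.prodMk (hpm k))) hDm
  have step1 := lintegral_of_indepFun hX.indepFun_times_regularInputs hX.measurable_times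
    hX.measurable_regularInputs hΨ
  have step2 := lintegral_of_indepFun hX.indepFun_times_regularInputs hX.measurable_times
    hX.measurable_regularInputs hΨ'
  have hmid : ∀ᵐ ω ∂P, ∫⁻ ω', h (updateTime (X ω).τ k) ((X ω).τ k)
      (ages q B C e ((hX.regularInputs ω').1.localInputs (updateTime (X ω).τ k).toNNReal k)
        (ageChain q B C (X ω).τ (hX.regularInputs ω').1 k)
        (ρ (updateTime (X ω).τ k) ((X ω).τ k))) ∂P =
      ∫⁻ ω', H (updateTime (X ω).τ k) ((X ω).τ k)
        (ageChain q B C (X ω).τ (hX.regularInputs ω').1 k) ∂P := by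
    filter_upwards [hX.ae_time_pos] with ω hω
    set t := (X ω).τ with ht
    have hm : ∀ D r, Measurable fun y : LocalInputs n => ages q B C e y D r := fun D r =>
      (isMeasurableAt_id r).measurable_ages e D
    have hid := hX.identDistrib_localInputs hq1 (updateTime t k).toNNReal k
    have hgm := hX.measurable_localInputs (updateTime t k).toNNReal k
    have hfm : Measurable fun ω' => ageChain q B C t (X ω') k :=
      measurable_ageChain_regular (τ := fun _ => t) measurable_const
        hX.measurable_regularInputs k
    have hunc : Measurable (Function.uncurry fun (D : Fin n → ℕ) (y : LocalInputs n) =>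
        h (updateTime t k) (t k) (ages q B C e y D (ρ (updateTime t k) (t k)))) :=
      measurable_from_prod_countable_right fun D =>
        (Measurable.of_discrete (f := fun A => h (updateTime t k) (t k) A)).comp (hm D _)
    rw [show ∫⁻ ω', h (updateTime t k) (t k)
      (ages q B C e ((hX.regularInputs ω').1.localInputs (updateTime t k).toNNReal k)
        (ageChain q B C t (hX.regularInputs ω').1 k) (ρ (updateTime t k) (t k))) ∂P =
      _ from lintegral_of_indepFun (hX.indepFun_ageChain_localInputs B C fun j _ => (hω j).le)
        hfm hgm hunc]
    refine lintegral_congr fun ω' => ?_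
    exact (hid.comp ((Measurable.of_discrete (f := fun A => h (updateTime t k) (t k) A)).comp
      (hm (ageChain q B C t (X ω') k) _))).lintegral_eq
  -- average over the length of the interval
  have step3 := lintegral_of_indepFun (hX.indepFun_time_past k).symm
    (Measurable.prodMk (measurable_pi_lambda _ fun j => by
      split_ifs
      exacts [hX.measurable_τ j, measurable_const]) hX.measurable_regularInputs)
    (hX.measurable_τ k) (Ψ := fun z r => H (updateTime z.1 k) r (ageChain q B C z.1 z.2.1 k))
    (measurable_of_fixed_ages (F := fun (z : ((ℕ → ℝ) × RegularInputs n) × ℝ) A =>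
      H (updateTime z.1.1 k) z.2 A) (fun A => (hHm A).comp
        ((hTm.comp measurable_fst).prodMk measurable_snd)) (hDm.comp measurable_fst))
  have e1 : ∀ ω, updateTime (fun j => if j < k then (X ω).τ j else 0) k =
      updateTime (X ω).τ k := fun ω =>
    Finset.sum_congr rfl fun j hj => if_pos (Finset.mem_range.1 hj)
  have e2 : ∀ ω, ageChain q B C (fun j => if j < k then (X ω).τ j else 0)
      (hX.regularInputs ω).1 k = ageChain q B C (X ω).τ (X ω) k := fun ω =>
    ageChain_congr (fun j hj => if_pos hj) _
  simp only [e1, e2] at step3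
  calc _ = _ := step1
    _ = _ := lintegral_congr_ae hmid
    _ = _ := step2.symm
    _ = _ := step3
    _ = _ := lintegral_congr fun ω => (hX.law_τ k).lintegral_comp
      (f := fun r => H (updateTime (X ω).τ k) r (ageChain q B C (X ω).τ (X ω) k))
      ((hHm _).comp (measurable_const.prodMk measurable_id)).aemeasurable

end IsNetwork

/-! ### Exponential integrals -/

lemma measurable_exponentialPDF (lam : ℝ) : Measurable (exponentialPDF lam) :=
  (measurable_exponentialPDFReal lam).ennreal_ofReal

lemma lintegral_expMeasure (lam : ℝ) {f : ℝ → ℝ≥0∞} (hf : Measurable f) :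
    ∫⁻ r, f r ∂(expMeasure lam) = ∫⁻ r, exponentialPDF lam r * f r :=
  lintegral_withDensity_eq_lintegral_mul _ (measurable_exponentialPDF lam) hf

lemma lintegral_Ici_exp_neg {b : ℝ} (hb : 0 < b) (s : ℝ) :
    ∫⁻ r in Set.Ici s, ENNReal.ofReal (Real.exp (-(b * r))) =
      ENNReal.ofReal (Real.exp (-(b * s)) / b) := by
  have h1 := integral_exp_mul_Ioi (a := -b) (by linarith) s
  have h2 : IntegrableOn (fun r => Real.exp (-b * r)) (Set.Ioi s) :=
    exp_neg_integrableOn_Ioi s hb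
  rw [setLIntegral_congr Ioi_ae_eq_Ici.symm]
  simp only [← neg_mul]
  rw [← ofReal_integral_eq_lintegral_ofReal h2 (ae_of_all _ fun r => (Real.exp_pos _).le), h1]
  congr 1
  field_simp

/-- The Laplace transform of an exponential law, from some time `s` on. -/
lemma lintegral_Ici_exp_expMeasure {lam b : ℝ} (hlam : 0 < lam) (hb : b < lam) {s : ℝ}
    (hs : 0 ≤ s) :
    ∫⁻ r in Set.Ici s, ENNReal.ofReal (Real.exp (b * r)) ∂(expMeasure lam) =
      ENNReal.ofReal (lam / (lam - b) * Real.exp (-((lam - b) * s))) := by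
  have hm : Measurable fun r : ℝ => ENNReal.ofReal (Real.exp (b * r)) := by fun_prop
  rw [← lintegral_indicator measurableSet_Ici,
    lintegral_expMeasure _ (hm.indicator measurableSet_Ici)]
  have : ∀ r, exponentialPDF lam r * (Set.Ici s).indicator
      (fun r => ENNReal.ofReal (Real.exp (b * r))) r = (Set.Ici s).indicator
      (fun r => ENNReal.ofReal lam * ENNReal.ofReal (Real.exp (-((lam - b) * r)))) r := by
    intro r
    by_cases hr : s ≤ r
    · rw [Set.indicator_of_mem (Set.mem_Ici.2 hr), Set.indicator_of_mem (Set.mem_Ici.2 hr),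
        exponentialPDF_of_nonneg (hs.trans hr), ← ENNReal.ofReal_mul (by positivity),
        ← ENNReal.ofReal_mul hlam.le, mul_assoc, ← Real.exp_add]
      ring_nf
    · rw [Set.indicator_of_notMem (by simpa using hr), Set.indicator_of_notMem (by simpa using hr),
        mul_zero]
  simp only [this]
  rw [lintegral_indicator measurableSet_Ici, lintegral_const_mul _ (by fun_prop),
    lintegral_Ici_exp_neg (sub_pos.2 hb), ← ENNReal.ofReal_mul hlam.le]
  ring_nf

lemma ae_nonneg_expMeasure (lam : ℝ) : ∀ᵐ r ∂(expMeasure lam), 0 ≤ r := by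
  rw [ae_iff]
  simp only [not_le]
  change expMeasure lam (Set.Iio 0) = 0
  rw [expMeasure, gammaMeasure, withDensity_apply _ measurableSet_Iio]
  exact lintegral_gammaPDF_of_nonpos le_rfl

lemma lintegral_exp_expMeasure {lam b : ℝ} (hlam : 0 < lam) (hb : b < lam) :
    ∫⁻ r, ENNReal.ofReal (Real.exp (b * r)) ∂(expMeasure lam) =
      ENNReal.ofReal (lam / (lam - b)) := by
  have h1 := lintegral_Ici_exp_expMeasure hlam hb le_rfl
  rw [mul_zero, neg_zero, Real.exp_zero, mul_one] at h1
  rw [← h1, Measure.restrict_eq_self_of_ae_mem]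
  exact ae_nonneg_expMeasure lam

lemma expMeasure_Ici {lam : ℝ} (hlam : 0 < lam) {s : ℝ} (hs : 0 ≤ s) :
    expMeasure lam (Set.Ici s) = ENNReal.ofReal (Real.exp (-(lam * s))) := by
  have h1 := lintegral_Ici_exp_expMeasure hlam hlam hs (b := 0)
  simpa [hlam.ne'] using h1

lemma expMeasure_Iic {lam : ℝ} (hlam : 0 < lam) (s : ℝ) :
    expMeasure lam (Set.Iic s) =
      ENNReal.ofReal (if 0 ≤ s then 1 - Real.exp (-(lam * s)) else 0) := by
  rw [← lintegral_exponentialPDF_eq_antiDeriv hlam]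
  exact withDensity_apply _ measurableSet_Iic

/-! ### Renewal theory for random maps -/

section RandomMaps

variable {Y S : Type*} [MeasurableSpace Y] {m : Measure Y} {ℓ : Y → ℝ} {U : Y → S → S}

/-- One step of a Markov renewal process, acting on functions of the remaining time and the state:
the time advances by the random length `ℓ` and the state changes by the random map `U`. -/
noncomputable def renewalStep (m : Measure Y) (ℓ : Y → ℝ) (U : Y → S → S)
    (h : ℝ → S → ℝ≥0∞) : ℝ → S → ℝ≥0∞ :=
  fun x D => ∫⁻ y, h (x - ℓ y) (U y D) ∂m

/-- The total contribution of a reward `h` over all steps. -/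
noncomputable def renewalSum (m : Measure Y) (ℓ : Y → ℝ) (U : Y → S → S)
    (h : ℝ → S → ℝ≥0∞) : ℝ → S → ℝ≥0∞ :=
  fun x D => ∑' k, (renewalStep m ℓ U)^[k] h x D

lemma renewalStep_of_neg {h : ℝ → S → ℝ≥0∞} (hpos : ∀ᵐ y ∂m, 0 ≤ ℓ y)
    (hneg : ∀ x < 0, ∀ D, h x D = 0) {x : ℝ} (hx : x < 0) (D : S) :
    renewalStep m ℓ U h x D = 0 := by
  refine lintegral_eq_zero_of_ae_eq_zero ?_
  filter_upwards [hpos] with y hy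
  exact hneg _ (by linarith) _

lemma renewalSum_of_neg {h : ℝ → S → ℝ≥0∞} (hpos : ∀ᵐ y ∂m, 0 ≤ ℓ y)
    (hneg : ∀ x < 0, ∀ D, h x D = 0) {x : ℝ} (hx : x < 0) (D : S) :
    renewalSum m ℓ U h x D = 0 := by
  refine ENNReal.tsum_eq_zero.2 fun k => ?_
  induction k generalizing x D with
  | zero => exact hneg x hx D
  | succ k ih =>
    simp only [Function.iterate_succ_apply']
    exact renewalStep_of_neg hpos (fun x hx D => ih hx D) hx D

/-- If the state grows by at most one unit in a step, then `k` steps multiply an exponential bound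
by the `k`-th power of the exponential moment of the step length. -/
lemma renewalStep_iterate_le {φ : S → ℕ} (hφ : ∀ y D, φ (U y D) ≤ φ D + 1) {c : ℝ}
    {h : ℝ → S → ℝ≥0∞} {b d : ℝ≥0∞} (hℓ : Measurable ℓ)
    (hle : ∀ x D, h x D ≤ ENNReal.ofReal (Real.exp (-(c * x))) * (b * φ D + d)) (k : ℕ)
    (x : ℝ) (D : S) :
    (renewalStep m ℓ U)^[k] h x D ≤ ENNReal.ofReal (Real.exp (-(c * x))) *
      ((∫⁻ y, ENNReal.ofReal (Real.exp (c * ℓ y)) ∂m) ^ k * (b * (φ D + k : ℕ) + d)) := by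
  set γ := ∫⁻ y, ENNReal.ofReal (Real.exp (c * ℓ y)) ∂m with hγ
  induction k generalizing x D with
  | zero => simpa using hle x D
  | succ k ih =>
    simp only [Function.iterate_succ_apply']
    have hm : Measurable fun y => ENNReal.ofReal (Real.exp (c * ℓ y)) := by fun_prop
    calc renewalStep m ℓ U ((renewalStep m ℓ U)^[k] h) x D
        ≤ ∫⁻ y, ENNReal.ofReal (Real.exp (c * ℓ y)) * (ENNReal.ofReal (Real.exp (-(c * x))) *
            (γ ^ k * (b * (φ D + (k + 1) : ℕ) + d))) ∂m := by
          refine lintegral_mono fun y => (ih _ _).trans ?_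
          have he : ENNReal.ofReal (Real.exp (-(c * (x - ℓ y)))) =
              ENNReal.ofReal (Real.exp (c * ℓ y)) * ENNReal.ofReal (Real.exp (-(c * x))) := by
            rw [← ENNReal.ofReal_mul (Real.exp_pos _).le, ← Real.exp_add]
            ring_nf
          rw [he, mul_assoc]
          have hφ' : φ (U y D) + k ≤ φ D + (k + 1) := by
            have := hφ y D
            omega
          gcongr
      _ = γ * (ENNReal.ofReal (Real.exp (-(c * x))) *
            (γ ^ k * (b * (φ D + (k + 1) : ℕ) + d))) := lintegral_mul_const _ hm
      _ = _ := by ring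

variable [MeasurableSpace S] [Countable S] [MeasurableSingletonClass S]

lemma measurable_renewalStep_integrand (hℓ : Measurable ℓ) (hU : ∀ D, Measurable fun y => U y D)
    {h : ℝ → S → ℝ≥0∞} (hh : ∀ D, Measurable fun x => h x D) (D : S) :
    Measurable fun p : ℝ × Y => h (p.1 - ℓ p.2) (U p.2 D) := by
  have h1 : Measurable fun p : S × ℝ => h p.2 p.1 := measurable_from_prod_countable_right hh
  exact h1.comp (((hU D).comp measurable_snd).prodMk
    (measurable_fst.sub (hℓ.comp measurable_snd)))

lemma measurable_renewalStep [SFinite m] (hℓ : Measurable ℓ)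
    (hU : ∀ D, Measurable fun y => U y D) {h : ℝ → S → ℝ≥0∞}
    (hh : ∀ D, Measurable fun x => h x D) (D : S) :
    Measurable fun x => renewalStep m ℓ U h x D :=
  (measurable_renewalStep_integrand hℓ hU hh D).lintegral_prod_right'

lemma measurable_renewalStep_iterate [SFinite m] (hℓ : Measurable ℓ)
    (hU : ∀ D, Measurable fun y => U y D) {h : ℝ → S → ℝ≥0∞}
    (hh : ∀ D, Measurable fun x => h x D) (k : ℕ) (D : S) :
    Measurable fun x => (renewalStep m ℓ U)^[k] h x D := by
  induction k generalizing D with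
  | zero => exact hh D
  | succ k ih =>
    simp only [Function.iterate_succ_apply']
    exact measurable_renewalStep hℓ hU ih D

lemma renewalStep_add (hℓ : Measurable ℓ) (hU : ∀ D, Measurable fun y => U y D)
    {h h' : ℝ → S → ℝ≥0∞} (hh : ∀ D, Measurable fun x => h x D) :
    renewalStep m ℓ U (h + h') = renewalStep m ℓ U h + renewalStep m ℓ U h' := by
  funext x D
  exact lintegral_add_left
    ((measurable_renewalStep_integrand hℓ hU hh D).comp measurable_prodMk_left) _

lemma measurable_renewalSum [SFinite m] (hℓ : Measurable ℓ)
    (hU : ∀ D, Measurable fun y => U y D) {h : ℝ → S → ℝ≥0∞}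
    (hh : ∀ D, Measurable fun x => h x D) (D : S) :
    Measurable fun x => renewalSum m ℓ U h x D :=
  Measurable.tsum fun k => measurable_renewalStep_iterate hℓ hU hh k D

lemma renewalSum_eq [SFinite m] (hℓ : Measurable ℓ) (hU : ∀ D, Measurable fun y => U y D)
    {h : ℝ → S → ℝ≥0∞} (hh : ∀ D, Measurable fun x => h x D) :
    renewalSum m ℓ U h = h + renewalStep m ℓ U (renewalSum m ℓ U h) := by
  funext x D
  rw [renewalSum, tsum_eq_zero_add' ENNReal.summable]
  refine congrArg (h x D + ·) ?_
  simp only [Function.iterate_succ_apply']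
  exact (lintegral_tsum fun k => ((measurable_renewalStep_integrand hℓ hU
    (measurable_renewalStep_iterate hℓ hU hh k) D).comp
      measurable_prodMk_left).aemeasurable).symm

/-- A solution of the renewal equation that tends to `0` under iteration is the renewal sum. -/
lemma eq_renewalSum [SFinite m] (hℓ : Measurable ℓ) (hU : ∀ D, Measurable fun y => U y D)
    {h Ψ : ℝ → S → ℝ≥0∞} (hh : ∀ D, Measurable fun x => h x D)
    (hΨ : Ψ = h + renewalStep m ℓ U Ψ) {x : ℝ} {D : S}
    (hlim : Tendsto (fun k => (renewalStep m ℓ U)^[k] Ψ x D) atTop (𝓝 0)) :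
    Ψ x D = renewalSum m ℓ U h x D := by
  have key : ∀ k, Ψ = ∑ j ∈ Finset.range k, (renewalStep m ℓ U)^[j] h +
      (renewalStep m ℓ U)^[k] Ψ := by
    intro k
    induction k with
    | zero => simp
    | succ k ih =>
      have h1 : ∀ k, (renewalStep m ℓ U)^[k] Ψ =
          (renewalStep m ℓ U)^[k] h + (renewalStep m ℓ U)^[k + 1] Ψ := by
        intro k
        induction k with
        | zero => exact hΨ
        | succ k ih' =>
          rw [Function.iterate_succ_apply', Function.iterate_succ_apply',
            Function.iterate_succ_apply', ← renewalStep_add hℓ hU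
              (measurable_renewalStep_iterate hℓ hU hh k), ← ih']
      rw [Finset.sum_range_succ, add_assoc, ← h1]
      exact ih
  have h2 : Tendsto (fun k => ∑ j ∈ Finset.range k, (renewalStep m ℓ U)^[j] h x D +
      (renewalStep m ℓ U)^[k] Ψ x D) atTop (𝓝 (renewalSum m ℓ U h x D + 0)) :=
    (ENNReal.summable.hasSum.tendsto_sum_nat).add hlim
  rw [add_zero] at h2
  refine tendsto_nhds_unique (tendsto_const_nhds.congr fun k => ?_) h2
  have := congrFun (congrFun (key k) x) D
  simpa using this

end RandomMaps

/-! ### Convergence to equilibrium -/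

lemma tsum_pow_mul_ne_top {γ : ℝ≥0∞} (hγ : γ < 1) (b d : ℝ≥0) (N : ℕ) :
    ∑' k, γ ^ k * (b * (N + k : ℕ) + d) ≠ ⊤ := by
  lift γ to ℝ≥0 using (hγ.trans ENNReal.one_lt_top).ne
  have hγ' : γ < 1 := by exact_mod_cast hγ
  have h1 : ∀ k : ℕ, (γ : ℝ≥0∞) ^ k * (b * (N + k : ℕ) + d) =
      ((γ ^ k * (b * (N + k : ℕ) + d) : ℝ≥0) : ℝ≥0∞) := fun k => by push_cast; rfl
  simp only [h1]
  rw [ENNReal.tsum_coe_ne_top_iff_summable, ← NNReal.summable_coe]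
  have hn : ‖(γ : ℝ)‖ < 1 := by simpa using hγ'
  have h2 := ((summable_geometric_of_norm_lt_one hn).mul_left ((b : ℝ) * N + d)).add
    ((summable_pow_mul_geometric_of_norm_lt_one 1 hn).mul_left (b : ℝ))
  refine h2.congr fun k => ?_
  push_cast
  ring

lemma lintegral_Iic_eq_conv {lam : ℝ} (hlam : 0 < lam) {w : ℝ → ℝ≥0∞} (hw : Measurable w)
    (x : ℝ) :
    ∫⁻ s in Set.Iic x, ENNReal.ofReal lam * w s =
      ∫⁻ r, (w (x - r) + ∫⁻ s in Set.Iic (x - r), ENNReal.ofReal lam * w s)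
        ∂(expMeasure lam) := by
  have hpdf := measurable_exponentialPDF lam
  have h1 : ∫⁻ r, w (x - r) ∂(expMeasure lam) = ∫⁻ s, exponentialPDF lam (x - s) * w s := by
    rw [lintegral_expMeasure _ (by fun_prop),
      ← lintegral_sub_left_eq_self (fun r => exponentialPDF lam r * w (x - r)) x]
    simp only [sub_sub_cancel]
  have h2 : ∫⁻ r, (∫⁻ s in Set.Iic (x - r), ENNReal.ofReal lam * w s) ∂(expMeasure lam) =
      ∫⁻ s, expMeasure lam (Set.Iic (x - s)) * (ENNReal.ofReal lam * w s) := by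
    have : ∀ r, ∫⁻ s in Set.Iic (x - r), ENNReal.ofReal lam * w s =
        ∫⁻ s, (Set.Iic (x - s)).indicator (fun _ => ENNReal.ofReal lam * w s) r := by
      intro r
      rw [← lintegral_indicator measurableSet_Iic]
      refine lintegral_congr fun s => ?_
      simp only [Set.indicator, Set.mem_Iic, le_sub_comm]
    simp only [this]
    have := isProbabilityMeasure_expMeasure hlam
    rw [lintegral_lintegral_swap]
    · refine lintegral_congr fun s => ?_
      rw [lintegral_indicator_const measurableSet_Iic, mul_comm]
    · have hset : MeasurableSet {p : ℝ × ℝ | p.1 ≤ x - p.2} :=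
        measurableSet_le measurable_fst (by fun_prop)
      have hm : Measurable fun p : ℝ × ℝ => ENNReal.ofReal lam * w p.2 := by fun_prop
      exact (hm.indicator hset).aemeasurable
  rw [lintegral_add_left (by fun_prop), h1, h2, ← lintegral_add_left (by fun_prop),
    ← lintegral_indicator measurableSet_Iic]
  refine lintegral_congr fun s => ?_
  rw [expMeasure_Iic hlam]
  by_cases hs : s ≤ x
  · have he : 0 ≤ 1 - Real.exp (-(lam * (x - s))) := by
      rw [sub_nonneg, Real.exp_le_one_iff, neg_nonpos]
      exact mul_nonneg hlam.le (sub_nonneg.2 hs)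
    rw [Set.indicator_of_mem (Set.mem_Iic.2 hs), exponentialPDF_of_nonneg (sub_nonneg.2 hs),
      if_pos (sub_nonneg.2 hs), ← mul_assoc, ← add_mul, ← ENNReal.ofReal_mul he,
      ← ENNReal.ofReal_add (by positivity) (mul_nonneg he hlam.le)]
    congr 2
    ring
  · rw [Set.indicator_of_notMem (by simpa using hs), if_neg (by simpa using hs),
      exponentialPDF_of_neg (by linarith [not_le.1 hs])]
    simp

section RandomMaps

variable {Y S : Type*} [MeasurableSpace Y] [MeasurableSpace S] [Countable S]
  [MeasurableSingletonClass S] {m : Measure Y} [IsProbabilityMeasure m] {ℓ : Y → ℝ}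
  {U : Y → S → S}

/-- If the event `G` has positive probability, then a small exponential moment of the length of a
step, restricted to the complement of `G`, is less than `1`. -/
lemma exists_exp_moment_lt_one {lam : ℝ} (hlam : 0 < lam) (hℓ : Measurable ℓ)
    (hlaw : m.map ℓ = expMeasure lam) {G : Set Y} (hG : MeasurableSet G) (hG0 : m G ≠ 0) :
    ∃ c, 0 < c ∧ c < lam ∧ ∫⁻ y in Gᶜ, ENNReal.ofReal (Real.exp (c * ℓ y)) ∂m < 1 := by
  set p := (m G).toReal with hp
  have hp0 : 0 < p := ENNReal.toReal_pos hG0 (measure_ne_top _ _)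
  have hp1 : p ≤ 1 := ENNReal.toReal_le_of_le_ofReal zero_le_one (by simpa using prob_le_one)
  have hc : lam * p / 4 < lam := by nlinarith
  refine ⟨lam * p / 4, by positivity, hc, ?_⟩
  have hpos : ∀ᵐ y ∂m, 0 ≤ ℓ y := by
    refine ae_of_ae_map hℓ.aemeasurable ?_
    rw [hlaw]
    exact ae_nonneg_expMeasure lam
  have h1 : ∫⁻ y, ENNReal.ofReal (Real.exp (lam * p / 4 * ℓ y)) ∂m =
      ENNReal.ofReal (lam / (lam - lam * p / 4)) := by
    rw [← lintegral_exp_expMeasure hlam hc, ← hlaw, lintegral_map (by fun_prop) hℓ]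
  rw [← lintegral_add_compl _ hG] at h1
  have h2 : m G ≤ ∫⁻ y in G, ENNReal.ofReal (Real.exp (lam * p / 4 * ℓ y)) ∂m := by
    rw [← setLIntegral_one]
    refine lintegral_mono_ae ?_
    filter_upwards [ae_restrict_of_ae hpos] with y hy
    rw [ENNReal.one_le_ofReal, Real.one_le_exp_iff]
    positivity
  by_contra! h3
  have h4 : ENNReal.ofReal (p + 1) ≤ ENNReal.ofReal (lam / (lam - lam * p / 4)) := by
    rw [← h1, ENNReal.ofReal_add hp0.le zero_le_one, ENNReal.ofReal_one,
      ENNReal.ofReal_toReal (measure_ne_top _ _)]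
    exact add_le_add h2 h3
  rw [ENNReal.ofReal_le_ofReal_iff (div_nonneg hlam.le (by linarith)),
    le_div_iff₀ (by linarith)] at h4
  nlinarith [mul_pos hlam hp0]

/-- A Markov renewal process with exponential step lengths that, with positive probability in each
step, forgets its state, converges to equilibrium: the expected reward at time `t` has a finite
limit. The idea is to decompose at the steps in `G`. Between them there is only an exponentially
small contribution; and as the steps form a Poisson process, whose renewal measure is `lam` times
the Lebesgue measure, the renewal equation has an explicit solution. -/
theorem exists_tendsto_renewalSum {lam : ℝ} (hlam : 0 < lam) (hℓ : Measurable ℓ)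
    (hlaw : m.map ℓ = expMeasure lam) (hU : ∀ D, Measurable fun y => U y D)
    {G : Set Y} (hG : MeasurableSet G) (hG0 : m G ≠ 0) {A : S} (hA : ∀ y ∈ G, ∀ D, U y D = A)
    {φ : S → ℕ} (hφ : ∀ y D, φ (U y D) ≤ φ D + 1) {F : ℝ → S → ℝ≥0∞}
    (hF : ∀ D, Measurable fun x => F x D) (hF0 : ∀ x < 0, ∀ D, F x D = 0)
    (hFle : ∀ x, 0 ≤ x → ∀ D, F x D ≤ ENNReal.ofReal (Real.exp (-(lam * x))) * φ D) (D : S) :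
    (∀ t, renewalSum m ℓ U F t D ≠ ⊤) ∧
      ∃ a ≠ ⊤, Tendsto (fun t => renewalSum m ℓ U F t D) atTop (𝓝 a) := by
  obtain ⟨c, hc, hcl, hγ⟩ := exists_exp_moment_lt_one hlam hℓ hlaw hG hG0
  set γ := ∫⁻ y in Gᶜ, ENNReal.ofReal (Real.exp (c * ℓ y)) ∂m with hγd
  have hpos : ∀ᵐ y ∂m, 0 ≤ ℓ y := by
    refine ae_of_ae_map hℓ.aemeasurable ?_
    rw [hlaw]
    exact ae_nonneg_expMeasure lam
  -- the contribution of the steps before the first one in `G`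
  set z := renewalSum (m.restrict Gᶜ) ℓ U F with hz
  have hzm : ∀ D, Measurable fun x => z x D := measurable_renewalSum hℓ hU hF
  have hz0 : ∀ x < 0, ∀ D, z x D = 0 := fun x hx D =>
    renewalSum_of_neg (ae_restrict_of_ae hpos) hF0 hx D
  have hzeq : ∀ x D, z x D = F x D + renewalStep (m.restrict Gᶜ) ℓ U z x D := fun x D =>
    congrFun (congrFun (renewalSum_eq hℓ hU hF) x) D
  set Z : S → ℝ≥0∞ := fun D => ∑' k, γ ^ k * ((1 : ℝ≥0) * (φ D + k : ℕ) + (0 : ℝ≥0)) with hZ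
  have hZtop : ∀ D, Z D ≠ ⊤ := fun D => tsum_pow_mul_ne_top hγ 1 0 (φ D)
  have hFle' : ∀ x D, F x D ≤ ENNReal.ofReal (Real.exp (-(c * x))) *
      ((1 : ℝ≥0) * φ D + (0 : ℝ≥0)) := by
    intro x D
    rcases lt_or_ge x 0 with hx | hx
    · rw [hF0 x hx]; exact zero_le
    · refine (hFle x hx D).trans ?_
      rw [ENNReal.coe_one, one_mul, ENNReal.coe_zero, add_zero]
      gcongr
  have hzle : ∀ x D, z x D ≤ ENNReal.ofReal (Real.exp (-(c * x))) * Z D := by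
    intro x D
    rw [hZ, ← ENNReal.tsum_mul_left]
    exact ENNReal.tsum_le_tsum fun k => renewalStep_iterate_le hφ hℓ hFle' k x D
  -- the contribution between two consecutive steps in `G`
  set w : ℝ → ℝ≥0∞ := fun x => ∫⁻ y in G, z (x - ℓ y) A ∂m with hw
  have hwm : Measurable w :=
    (((hzm A).comp (measurable_fst.sub (hℓ.comp measurable_snd)) :
      Measurable fun p : ℝ × Y => z (p.1 - ℓ p.2) A)).lintegral_prod_right'
  have hw0 : ∀ x < 0, w x = 0 := by
    intro x hx
    refine lintegral_eq_zero_of_ae_eq_zero ?_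
    filter_upwards [ae_restrict_of_ae hpos] with y hy
    exact hz0 _ (by linarith) _
  set W : ℝ≥0∞ := ENNReal.ofReal (lam / (lam - c)) * Z A with hW
  have hWtop : W ≠ ⊤ := ENNReal.mul_ne_top ENNReal.ofReal_ne_top (hZtop A)
  have hwle : ∀ x, w x ≤ ENNReal.ofReal (Real.exp (-(c * x))) * W := by
    intro x
    calc w x ≤ ∫⁻ y, z (x - ℓ y) A ∂m := setLIntegral_le_lintegral _ _
      _ ≤ ∫⁻ y, ENNReal.ofReal (Real.exp (c * ℓ y)) *
          (ENNReal.ofReal (Real.exp (-(c * x))) * Z A) ∂m := by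
        refine lintegral_mono fun y => (hzle _ _).trans_eq ?_
        rw [← mul_assoc, ← ENNReal.ofReal_mul (Real.exp_pos _).le, ← Real.exp_add]
        ring_nf
      _ = _ := by
        have he : ∫⁻ y, ENNReal.ofReal (Real.exp (c * ℓ y)) ∂m =
            ENNReal.ofReal (lam / (lam - c)) := by
          rw [← lintegral_exp_expMeasure hlam hcl, ← hlaw, lintegral_map (by fun_prop) hℓ]
        rw [lintegral_mul_const _ (by fun_prop), he]
        ring
  set I : ℝ≥0∞ := ∫⁻ s, ENNReal.ofReal lam * w s with hI
  have hItop : I ≠ ⊤ := by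
    have h1 : I ≤ ∫⁻ s in Set.Ici (0 : ℝ), ENNReal.ofReal (Real.exp (-(c * s))) *
        (ENNReal.ofReal lam * W) := by
      rw [← lintegral_indicator measurableSet_Ici]
      refine lintegral_mono fun s => ?_
      rcases lt_or_ge s 0 with hs | hs
      · rw [hw0 s hs, mul_zero]; exact zero_le
      · rw [Set.indicator_of_mem (Set.mem_Ici.2 hs)]
        calc _ ≤ _ := mul_le_mul_right (hwle s) _
          _ = _ := by ring
    refine ne_top_of_le_ne_top ?_ h1
    rw [lintegral_mul_const _ (by fun_prop), lintegral_Ici_exp_neg hc]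
    exact ENNReal.mul_ne_top ENNReal.ofReal_ne_top
      (ENNReal.mul_ne_top ENNReal.ofReal_ne_top hWtop)
  -- the explicit solution
  set J : ℝ → ℝ≥0∞ := fun x => ∫⁻ s in Set.Iic x, ENNReal.ofReal lam * w s with hJ
  have hJle : ∀ x, J x ≤ I := fun x => setLIntegral_le_lintegral _ _
  have hJ0 : ∀ x < 0, J x = 0 := by
    intro x hx
    refine (setLIntegral_congr_fun measurableSet_Iic fun s hs => ?_).trans lintegral_zero
    simp only [hw0 s (lt_of_le_of_lt hs hx), mul_zero]
  have hJmono : Monotone J := fun a b hab =>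
    lintegral_mono_set (Set.Iic_subset_Iic.2 hab)
  have hJeq : ∀ x, J x = ∫⁻ y, (w (x - ℓ y) + J (x - ℓ y)) ∂m := by
    intro x
    rw [hJ]
    simp only
    rw [lintegral_Iic_eq_conv hlam hwm x, ← hlaw, lintegral_map _ hℓ]
    exact (hwm.comp (measurable_const.sub measurable_id)).add
      (hJmono.measurable.comp (measurable_const.sub measurable_id))
  set Ψ : ℝ → S → ℝ≥0∞ := fun x D => z x D + (w x + J x) with hΨ
  have hΨeq : Ψ = F + renewalStep m ℓ U Ψ := by
    funext x D
    have h1 : renewalStep m ℓ U Ψ x D =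
        ∫⁻ y, z (x - ℓ y) (U y D) ∂m + ∫⁻ y, (w (x - ℓ y) + J (x - ℓ y)) ∂m :=
      lintegral_add_left ((measurable_renewalStep_integrand hℓ hU hzm D).comp
        measurable_prodMk_left) _
    have h2 : ∫⁻ y, z (x - ℓ y) (U y D) ∂m = w x + renewalStep (m.restrict Gᶜ) ℓ U z x D := by
      rw [← lintegral_add_compl _ hG]
      congr 1
      exact setLIntegral_congr_fun hG fun y hy => by simp only [hA y hy]
    change z x D + (w x + J x) = F x D + renewalStep m ℓ U Ψ x D
    rw [h1, h2, ← hJeq, hzeq x D]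
    abel
  have hΨle : ∀ x D, Ψ x D ≤ ENNReal.ofReal (Real.exp (-(-1 * x))) *
      ((∑' k, γ ^ k).toNNReal * φ D +
        ((∑' k, γ ^ k * ((1 : ℝ≥0) * (0 + k : ℕ) + (0 : ℝ≥0))) + (W + I)).toNNReal) := by
    intro x D
    rcases lt_or_ge x 0 with hx | hx
    · simp only [hΨ, hz0 x hx, hw0 x hx, hJ0 x hx, add_zero]; exact zero_le
    · have ht1 : ∑' k, γ ^ k ≠ ⊤ := by simpa using tsum_pow_mul_ne_top hγ 0 1 0
      have ht2 := tsum_pow_mul_ne_top hγ 1 0 0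
      have hx1 : ∀ b : ℝ≥0∞, ENNReal.ofReal (Real.exp (-(c * x))) * b ≤ b := fun b => by
        refine mul_le_of_le_one_left zero_le (ENNReal.ofReal_le_one.2 ?_)
        rw [Real.exp_le_one_iff, neg_nonpos]
        positivity
      have hx2 : (1 : ℝ≥0∞) ≤ ENNReal.ofReal (Real.exp (-(-1 * x))) := by
        rw [ENNReal.one_le_ofReal, Real.one_le_exp_iff]
        linarith
      rw [ENNReal.coe_toNNReal ht1, ENNReal.coe_toNNReal (ENNReal.add_ne_top.2
        ⟨ht2, ENNReal.add_ne_top.2 ⟨hWtop, hItop⟩⟩)]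
      refine le_trans ?_ (le_mul_of_one_le_left zero_le hx2)
      have hZD : Z D = (∑' k, γ ^ k) * φ D +
          ∑' k, γ ^ k * ((1 : ℝ≥0) * (0 + k : ℕ) + (0 : ℝ≥0)) := by
        rw [hZ, ← ENNReal.tsum_mul_right, ← ENNReal.tsum_add]
        refine tsum_congr fun k => ?_
        push_cast
        ring
      rw [← add_assoc, ← hZD]
      exact add_le_add ((hzle x D).trans (hx1 _))
        (add_le_add ((hwle x).trans (hx1 _)) (hJle x))
  have hlim : ∀ x D, Tendsto (fun k => (renewalStep m ℓ U)^[k] Ψ x D) atTop (𝓝 0) := by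
    intro x D
    set β := ∫⁻ y, ENNReal.ofReal (Real.exp (-1 * ℓ y)) ∂m with hβ
    have hβ1 : β < 1 := by
      have : β = ENNReal.ofReal (lam / (lam - -1)) := by
        rw [← lintegral_exp_expMeasure hlam (by linarith), ← hlaw, lintegral_map (by fun_prop) hℓ]
      rw [this, ENNReal.ofReal_lt_one, div_lt_one (by linarith)]
      linarith
    have h1 := ENNReal.Tendsto.const_mul (a := ENNReal.ofReal (Real.exp (-(-1 * x))))
      (ENNReal.tendsto_atTop_zero_of_tsum_ne_top (tsum_pow_mul_ne_top hβ1
        (∑' k, γ ^ k).toNNReal ((∑' k, γ ^ k * ((1 : ℝ≥0) * (0 + k : ℕ) + (0 : ℝ≥0))) +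
          (W + I)).toNNReal (φ D))) (Or.inr ENNReal.ofReal_ne_top)
    rw [mul_zero] at h1
    exact tendsto_of_tendsto_of_tendsto_of_le_of_le tendsto_const_nhds h1
      (fun _ => zero_le) fun k => renewalStep_iterate_le hφ hℓ hΨle k x D
  have hsol : ∀ x, renewalSum m ℓ U F x D = z x D + (w x + J x) := fun x =>
    (eq_renewalSum hℓ hU hF hΨeq (hlim x D)).symm
  have hexp : ∀ b : ℝ≥0∞, b ≠ ⊤ →
      Tendsto (fun x => ENNReal.ofReal (Real.exp (-(c * x))) * b) atTop (𝓝 0) := by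
    intro b hb
    have h1 : Tendsto (fun x => Real.exp (-(c * x))) atTop (𝓝 0) :=
      Real.tendsto_exp_neg_atTop_nhds_zero.comp (tendsto_id.const_mul_atTop hc)
    have h2 := ENNReal.Tendsto.mul_const (ENNReal.tendsto_ofReal h1) (Or.inr hb)
    simpa using h2
  refine ⟨fun t => ?_, I, hItop, ?_⟩
  · rw [hsol]
    refine ENNReal.add_ne_top.2 ⟨ne_top_of_le_ne_top ?_ (hzle t D), ENNReal.add_ne_top.2
      ⟨ne_top_of_le_ne_top ?_ (hwle t), ne_top_of_le_ne_top hItop (hJle t)⟩⟩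
    · exact ENNReal.mul_ne_top ENNReal.ofReal_ne_top (hZtop D)
    · exact ENNReal.mul_ne_top ENNReal.ofReal_ne_top hWtop
  · simp only [hsol]
    have hz' : Tendsto (fun x => z x D) atTop (𝓝 0) :=
      tendsto_of_tendsto_of_tendsto_of_le_of_le tendsto_const_nhds (hexp _ (hZtop D))
        (fun _ => zero_le) fun x => hzle x D
    have hw' : Tendsto w atTop (𝓝 0) :=
      tendsto_of_tendsto_of_tendsto_of_le_of_le tendsto_const_nhds (hexp _ hWtop)
        (fun _ => zero_le) hwle
    have hJ' : Tendsto J atTop (𝓝 I) := by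
      have h1 := tendsto_measure_Iic_atTop (volume.withDensity fun s => ENNReal.ofReal lam * w s)
      rw [withDensity_apply _ MeasurableSet.univ, Measure.restrict_univ] at h1
      refine h1.congr fun x => ?_
      rw [withDensity_apply _ measurableSet_Iic]
    simpa using hz'.add (hw'.add hJ')

end RandomMaps

/-! ### The expected age as a renewal sum -/

lemma expMeasure_Ioi {lam : ℝ} (hlam : 0 < lam) {s : ℝ} (hs : 0 ≤ s) :
    expMeasure lam (Set.Ioi s) = ENNReal.ofReal (Real.exp (-(lam * s))) := by
  rw [← expMeasure_Ici hlam hs]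
  exact measure_congr ((withDensity_absolutelyContinuous _ _).ae_eq Ioi_ae_eq_Ici)

section NetworkRenewal

variable {Ω : Type*} {n : ℕ}

/-- The ages at the first self-update of the source, when it occurs at the time `y.1` and the ages
at time `0` are `D`. -/
noncomputable def nextAges (q B C : ℝ) (X : Ω → Inputs n) (y : ℝ × Ω) (D : Fin n → ℕ) :
    Fin n → ℕ :=
  agesBefore q B C ((X y.2).localInputs 0 0) D y.1 + 1

lemma nextAges_le (q B C : ℝ) (X : Ω → Inputs n) (y : ℝ × Ω) (D : Fin n → ℕ) (i : Fin n) :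
    nextAges q B C X y D i ≤ D i + 1 :=
  Nat.succ_le_succ (agesBefore_le ..)

variable [MeasurableSpace Ω]

/-- The expected age of node `i` at time `x`, on the event that the source has not updated itself
yet, when the ages at time `0` are `D`. -/
noncomputable def initialAge (P : Measure Ω) (lamE q B C : ℝ) (X : Ω → Inputs n) (i : Fin n)
    (x : ℝ) (D : Fin n → ℕ) : ℝ≥0∞ :=
  if 0 ≤ x then ENNReal.ofReal (Real.exp (-(lamE * x))) *
    ∫⁻ ω, agesAt q B C ((X ω).localInputs 0 0) D x i ∂P else 0

variable {P : Measure Ω} {X : Ω → Inputs n} {lamE lam q : ℝ}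

namespace IsNetwork

lemma measurable_nextAges (hX : IsNetwork P X lamE lam q) (B C : ℝ) (D : Fin n → ℕ) :
    Measurable fun y => nextAges q B C X y D :=
  ((RegularInputs.isMeasurableAt (x := fun z : ℝ × Ω => hX.regularInputs z.2)
    (hX.measurable_regularInputs.comp measurable_snd) (s := fun _ => 0) measurable_const
    measurable_fst 0).measurable_agesBefore D).add_const 1

lemma measurable_initial_agesAt (hX : IsNetwork P X lamE lam q) (B C : ℝ) (D : Fin n → ℕ) :
    Measurable fun y : ℝ × Ω => agesAt q B C ((X y.2).localInputs 0 0) D y.1 :=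
  (RegularInputs.isMeasurableAt (x := fun z : ℝ × Ω => hX.regularInputs z.2)
    (hX.measurable_regularInputs.comp measurable_snd) (s := fun _ => 0) measurable_const
    measurable_fst 0).measurable_agesAt D

lemma measurable_initialAge [SFinite P] (hX : IsNetwork P X lamE lam q) (B C : ℝ) (i : Fin n)
    (D : Fin n → ℕ) : Measurable fun x => initialAge P lamE q B C X i x D := by
  refine Measurable.ite measurableSet_Ici (Measurable.mul (by fun_prop) ?_) measurable_const
  exact (Measurable.of_discrete.comp ((measurable_pi_apply i).comp
    (hX.measurable_initial_agesAt B C D)) :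
    Measurable fun y : ℝ × Ω =>
      (agesAt q B C ((X y.2).localInputs 0 0) D y.1 i : ℝ≥0∞)).lintegral_prod_right'

lemma initialAge_le [IsProbabilityMeasure P] {x : ℝ} (hx : 0 ≤ x) (B C : ℝ) (i : Fin n)
    (D : Fin n → ℕ) :
    initialAge P lamE q B C X i x D ≤ ENNReal.ofReal (Real.exp (-(lamE * x))) * D i := by
  rw [initialAge, if_pos hx]
  refine mul_le_mul_right ((lintegral_mono (g := fun _ => (D i : ℝ≥0∞)) fun ω => ?_).trans_eq
    (by simp)) _
  exact Nat.cast_le.2 (agesAt_le ..)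

lemma measurable_age_summand (hX : IsNetwork P X lamE lam q) (B C t : ℝ) (i : Fin n) (k : ℕ) :
    Measurable fun ω =>
      if updateTime (X ω).τ k ≤ t ∧ t < updateTime (X ω).τ k + (X ω).τ k then
        (agesAt q B C ((X ω).localInputs (updateTime (X ω).τ k).toNNReal k)
          (ageChain q B C (X ω).τ (X ω) k) (t - updateTime (X ω).τ k) i : ℝ≥0∞) else 0 := by
  have hT := measurable_updateTime hX.measurable_times k
  have hag : Measurable fun ω => agesAt q B C
      ((X ω).localInputs (updateTime (X ω).τ k).toNNReal k)
      (ageChain q B C (X ω).τ (X ω) k) (t - updateTime (X ω).τ k) :=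
    measurable_of_fixed_ages (F := fun ω D => agesAt q B C
      ((X ω).localInputs (updateTime (X ω).τ k).toNNReal k) D (t - updateTime (X ω).τ k))
      (fun D => (RegularInputs.isMeasurableAt (x := hX.regularInputs)
        hX.measurable_regularInputs hT.real_toNNReal (hT.const_sub t) k).measurable_agesAt D)
      (measurable_ageChain_regular hX.measurable_times (x := hX.regularInputs)
        hX.measurable_regularInputs k)
  exact Measurable.ite ((measurableSet_le hT measurable_const).inter
    (measurableSet_lt measurable_const (hT.add (hX.measurable_τ k))))
    (Measurable.of_discrete.comp ((measurable_pi_apply i).comp hag)) measurable_const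

variable [IsProbabilityMeasure P]

/-- The times and ages at the self-updates of the source form a Markov renewal process. -/
lemma lintegral_ageChain (hX : IsNetwork P X lamE lam q) (hlamE : 0 < lamE) (hq1 : q ≤ 1)
    (B C t : ℝ) (k : ℕ) {h : ℝ → (Fin n → ℕ) → ℝ≥0∞} (hh : ∀ D, Measurable fun x => h x D) :
    ∫⁻ ω, h (t - updateTime (X ω).τ k) (ageChain q B C (X ω).τ (X ω) k) ∂P =
      (renewalStep ((expMeasure lamE).prod P) Prod.fst (nextAges q B C X))^[k] h t 0 := by
  have := isProbabilityMeasure_expMeasure hlamE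
  induction k generalizing h with
  | zero => simp [updateTime, ageChain]
  | succ k ih =>
    rw [Function.iterate_succ_apply,
      ← ih (measurable_renewalStep measurable_fst (hX.measurable_nextAges B C) hh)]
    have h1 := hX.lintegral_ages_step hq1 B C true k (h := fun s r A => h (t - (s + r)) (A + 1))
      (fun A => (hh _).comp (by fun_prop)) (ρ := fun _ r => r) measurable_snd
    simp only [updateTime_succ]
    refine (h1.trans (lintegral_congr fun ω => ?_))
    simp only [sub_add_eq_sub_sub]
    exact (lintegral_prod _ ((measurable_renewalStep_integrand measurable_fst
      (hX.measurable_nextAges B C) hh (ageChain q B C (X ω).τ (X ω) k)).comp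
        measurable_prodMk_left).aemeasurable).symm

lemma ae_exists_lt_updateTime (hX : IsNetwork P X lamE lam q) (hlamE : 0 < lamE) (hq1 : q ≤ 1)
    (t : ℝ) : ∀ᵐ ω ∂P, ∃ k, t < updateTime (X ω).τ k := by
  have := isProbabilityMeasure_expMeasure hlamE
  set β := ∫⁻ y : ℝ × Ω, ENNReal.ofReal (Real.exp (-1 * y.1)) ∂((expMeasure lamE).prod P) with hβ
  have hβ1 : β < 1 := by
    have : β = ENNReal.ofReal (lamE / (lamE - -1)) := by
      rw [← lintegral_exp_expMeasure hlamE (by linarith), hβ,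
        lintegral_prod _ (by fun_prop)]
      simp
    rw [this, ENNReal.ofReal_lt_one, div_lt_one (by linarith)]
    linarith
  have hm : ∀ k, Measurable fun ω => ENNReal.ofReal (Real.exp (-updateTime (X ω).τ k)) := fun k =>
    ((measurable_updateTime hX.measurable_times k).neg.exp).ennreal_ofReal
  have hle : ∀ k, ∫⁻ ω, ENNReal.ofReal (Real.exp (-updateTime (X ω).τ k)) ∂P ≤
      β ^ k * ((0 : ℝ≥0) * (0 + k : ℕ) + (1 : ℝ≥0)) := by
    intro k
    have h1 := hX.lintegral_ageChain hlamE hq1 0 0 0 k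
      (h := fun x _ => ENNReal.ofReal (Real.exp x)) (fun _ => by fun_prop)
    simp only [zero_sub] at h1
    rw [h1]
    have h2 := renewalStep_iterate_le (m := (expMeasure lamE).prod P) (ℓ := Prod.fst)
      (U := nextAges q 0 0 X) (φ := fun _ => 0) (fun _ _ => Nat.zero_le _) (c := -1)
      (h := fun x _ => ENNReal.ofReal (Real.exp x)) (b := 0) (d := 1) measurable_fst
      (fun x D => by simp) k 0 0
    simpa [hβ] using h2
  have hfin : ∫⁻ ω, ∑' k, ENNReal.ofReal (Real.exp (-updateTime (X ω).τ k)) ∂P ≠ ⊤ := by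
    rw [lintegral_tsum fun k => (hm k).aemeasurable]
    exact ne_top_of_le_ne_top (tsum_pow_mul_ne_top hβ1 0 1 0) (ENNReal.tsum_le_tsum hle)
  filter_upwards [ae_lt_top (Measurable.tsum hm) hfin] with ω hω
  have h1 := ENNReal.tendsto_atTop_zero_of_tsum_ne_top hω.ne
  obtain ⟨k, hk⟩ := (h1.eventually_lt_const
    (ENNReal.ofReal_pos.2 (Real.exp_pos (-t)))).exists
  refine ⟨k, ?_⟩
  rw [ENNReal.ofReal_lt_ofReal_iff (Real.exp_pos _), Real.exp_lt_exp] at hk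
  linarith

/-- The age at time `t` as a sum over the intervals, of which only the one that contains `t`
contributes. -/
lemma ae_age_eq_tsum (hX : IsNetwork P X lamE lam q) (hlamE : 0 < lamE) (hq1 : q ≤ 1)
    {B : ℝ} (hB : 0 ≤ B) (C : ℝ) {t : ℝ} (ht : 0 ≤ t) (i : Fin n) :
    ∀ᵐ ω ∂P, ((X ω).age q B C t i : ℝ≥0∞) = ∑' k,
      if updateTime (X ω).τ k ≤ t ∧ t < updateTime (X ω).τ k + (X ω).τ k then
        (agesAt q B C ((X ω).localInputs (updateTime (X ω).τ k).toNNReal k)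
          (ageChain q B C (X ω).τ (X ω) k) (t - updateTime (X ω).τ k) i : ℝ≥0∞) else 0 := by
  filter_upwards [hX.ae_time_pos, hX.ae_exists_lt_updateTime hlamE hq1 t] with ω hpos hex
  have hmono : StrictMono (updateTime (X ω).τ) := strictMono_nat_of_lt_succ fun j => by
    rw [updateTime_succ]
    linarith [hpos j]
  obtain ⟨k, hk1, hk2⟩ : ∃ k, updateTime (X ω).τ k ≤ t ∧ t < updateTime (X ω).τ (k + 1) := by
    classical
    have h0 : Nat.find hex ≠ 0 := fun h => by
      have := Nat.find_spec hex
      rw [h] at this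
      simp only [updateTime, Finset.range_zero, Finset.sum_empty] at this
      linarith
    obtain ⟨k, hk⟩ := Nat.exists_eq_succ_of_ne_zero h0
    refine ⟨k, not_lt.1 (Nat.find_min hex (by omega)), ?_⟩
    have := Nat.find_spec hex
    rwa [hk] at this
  rw [tsum_eq_single k, if_pos ⟨hk1, by rwa [← updateTime_succ]⟩,
    Inputs.age_eq (hX.isRegular ω) hB hpos hk1 hk2]
  intro j hj
  rw [if_neg]
  rintro ⟨h1, h2⟩
  rw [← updateTime_succ] at h2
  have h3 := hmono.lt_iff_lt.1 (hk1.trans_lt h2)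
  have h4 := hmono.lt_iff_lt.1 (h1.trans_lt hk2)
  omega

/-- The expected age at time `t` is the renewal sum over the self-updates of the source. -/
lemma lintegral_age_eq (hX : IsNetwork P X lamE lam q) (hlamE : 0 < lamE) (hq1 : q ≤ 1)
    {B : ℝ} (hB : 0 ≤ B) (C : ℝ) {t : ℝ} (ht : 0 ≤ t) (i : Fin n) :
    ∫⁻ ω, ((X ω).age q B C t i : ℝ≥0∞) ∂P =
      renewalSum ((expMeasure lamE).prod P) Prod.fst (nextAges q B C X)
        (initialAge P lamE q B C X i) t 0 := by
  rw [lintegral_congr_ae (hX.ae_age_eq_tsum hlamE hq1 hB C ht i),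
    lintegral_tsum fun k => (hX.measurable_age_summand B C t i k).aemeasurable]
  refine tsum_congr fun k => ?_
  rw [← hX.lintegral_ageChain hlamE hq1 B C t k (hX.measurable_initialAge B C i)]
  have h1 := hX.lintegral_ages_step hq1 B C false k
    (h := fun s r A => if s ≤ t ∧ t < s + r then (A i : ℝ≥0∞) else 0)
    (fun A => Measurable.ite ((measurableSet_le measurable_fst measurable_const).inter
      (measurableSet_lt measurable_const (measurable_fst.add measurable_snd)))
      measurable_const measurable_const) (ρ := fun s _ => t - s) (by fun_prop)
  refine h1.trans (lintegral_congr fun ω => ?_)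
  set s := updateTime (X ω).τ k
  set D := ageChain q B C (X ω).τ (X ω) k
  rw [initialAge]
  by_cases hs : s ≤ t
  · have h2 : ∀ r, ∫⁻ ω', (if s ≤ t ∧ t < s + r then
        (ages q B C false ((X ω').localInputs 0 0) D (t - s) i : ℝ≥0∞) else 0) ∂P =
        (Set.Ioi (t - s)).indicator (fun _ => ∫⁻ ω',
          (agesAt q B C ((X ω').localInputs 0 0) D (t - s) i : ℝ≥0∞) ∂P) r := by
      intro r
      by_cases hr : t < s + r
      · rw [Set.indicator_of_mem (Set.mem_Ioi.2 (by linarith))]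
        simp only [hs, hr, and_self, if_true]
        rfl
      · rw [Set.indicator_of_notMem (fun h => hr (by linarith [Set.mem_Ioi.1 h]))]
        simp only [hr, and_false, if_false, lintegral_zero]
    simp only [h2]
    rw [lintegral_indicator_const measurableSet_Ioi, expMeasure_Ioi hlamE (sub_nonneg.2 hs),
      if_pos (sub_nonneg.2 hs), mul_comm]
  · simp [hs]

lemma measure_forall_src_pos (hX : IsNetwork P X lamE lam q) (hlam : 0 < lam) :
    P {ω | ∀ i, 0 < (X ω).src i 1} ≠ 0 := by
  have hind : iIndep (fun i : Fin n => inputAlgebra X (Sum.inr (Sum.inl i))) P :=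
    hX.indep.precomp (g := fun i : Fin n => Sum.inr (Sum.inl i)) fun i i' h => by simpa using h
  have hset : {ω | ∀ i, 0 < (X ω).src i 1} = ⋂ i, {ω | 0 < (X ω).src i 1} := by
    ext ω; simp
  rw [hset, hind.meas_iInter, Finset.prod_ne_zero_iff]
  · intro i _ h0
    have hn : 0 < n := i.pos
    have h1 := (hX.poisson_src i).measure_eq_zero 1
    have hm : MeasurableSet {ω | (X ω).src i 1 = 0} :=
      (hX.poisson_src i).measurable 1 (measurableSet_singleton 0)
    have h2 := prob_compl_eq_zero_iff hm |>.1 (by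
      rw [← h0]
      congr 1
      ext ω
      simp [Nat.pos_iff_ne_zero])
    rw [h1] at h2
    have h3 : Real.exp (-(((lam / n).toNNReal : ℝ≥0) * (1 : ℝ≥0) : ℝ)) < 1 := by
      rw [Real.exp_lt_one_iff, neg_lt_zero]
      have : 0 < lam / n := div_pos hlam (by exact_mod_cast hn)
      simpa using this
    rw [← ENNReal.ofReal_lt_one] at h3
    exact h3.ne h2
  · intro i
    have h1 : Measurable[⨆ t : ℝ≥0, MeasurableSpace.comap (fun ω => (X ω).src i t) ⊤]
        fun ω => (X ω).src i 1 :=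
      measurable_iff_comap_le.2 (le_iSup (fun t : ℝ≥0 =>
        MeasurableSpace.comap (fun ω => (X ω).src i t) ⊤) 1)
    exact h1 (MeasurableSet.of_discrete (s := Set.Ioi 0))

/-- The age at a fixed time is a random variable with a finite expectation, which converges. The
chain of ages forgets its past whenever all nodes hear from the source in the same interval. -/
lemma exists_tendsto_integral_age (hX : IsNetwork P X lamE lam q) (hlamE : 0 < lamE)
    (hlam : 0 < lam) (hq1 : q ≤ 1) {B : ℝ} (hB : 0 ≤ B) (C : ℝ) (i : Fin n) :
    ∃ a : ℝ≥0, (∀ t, 0 ≤ t → Integrable (fun ω => ((X ω).age q B C t i : ℝ)) P) ∧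
      Tendsto (fun t : ℝ => ∫ ω, ((X ω).age q B C t i : ℝ) ∂P) atTop (𝓝 a) ∧
      Tendsto (fun t : ℝ => renewalSum ((expMeasure lamE).prod P) Prod.fst (nextAges q B C X)
        (initialAge P lamE q B C X i) t 0) atTop (𝓝 a) := by
  have := isProbabilityMeasure_expMeasure hlamE
  have hmap : ((expMeasure lamE).prod P).map Prod.fst = expMeasure lamE := by
    rw [Measure.map_fst_prod, measure_univ, one_smul]
  have hsrc : MeasurableSet {ω | ∀ i, 0 < (X ω).src i 1} := by
    rw [Set.ofPred_forall]
    exact MeasurableSet.iInter fun i =>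
      (hX.poisson_src i).measurable 1 (MeasurableSet.of_discrete (s := Set.Ioi 0))
  obtain ⟨hfin, a, ha, hlim⟩ := exists_tendsto_renewalSum (m := (expMeasure lamE).prod P)
    (ℓ := Prod.fst) (U := nextAges q B C X) hlamE measurable_fst hmap
    (hX.measurable_nextAges B C)
    (G := Set.Ioi (1 : ℝ) ×ˢ {ω | ∀ i, 0 < (X ω).src i 1}) (measurableSet_Ioi.prod hsrc)
    (by
      rw [Measure.prod_prod, expMeasure_Ioi hlamE zero_le_one]
      exact mul_ne_zero (ENNReal.ofReal_pos.2 (Real.exp_pos _)).ne'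
        (hX.measure_forall_src_pos hlam))
    (A := fun _ => 1) (fun y hy D => by
      funext l
      have h0 : agesBefore q B C ((X y.2).localInputs 0 0) D y.1 l = 0 := by
        refine agesBefore_eq_zero (fun j a b hab => ?_) (Set.mem_Ioi.1 hy.1) ?_
        · exact Nat.sub_le_sub_right ((hX.poisson_src j).mono y.2 (add_le_add_right hab 0)) _
        · simpa [Inputs.localInputs, (hX.poisson_src l).zero] using hy.2 l
      simp [nextAges, h0])
    (φ := fun D => D i) (fun y D => nextAges_le q B C X y D i)
    (hX.measurable_initialAge B C i) (fun x hx D => by simp [initialAge, hx.not_ge])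
    (fun x hx D => initialAge_le hx B C i D) 0
  lift a to ℝ≥0 using ha
  have hm : ∀ t, 0 ≤ t → AEMeasurable (fun ω => ((X ω).age q B C t i : ℝ≥0∞)) P := fun t ht =>
    ⟨_, Measurable.tsum fun k => hX.measurable_age_summand B C t i k,
      hX.ae_age_eq_tsum hlamE hq1 hB C ht i⟩
  refine ⟨a, fun t ht => ?_, ?_, hlim⟩
  · have h1 := integrable_toReal_of_lintegral_ne_top (hm t ht)
      (by rw [hX.lintegral_age_eq hlamE hq1 hB C ht i]; exact hfin t)
    simpa using h1
  · refine ((ENNReal.tendsto_toReal ENNReal.coe_ne_top).comp hlim).congr' ?_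
    filter_upwards [eventually_ge_atTop 0] with t ht
    have h1 := integral_toReal (hm t ht) (ae_of_all _ fun ω => ENNReal.natCast_lt_top _)
    simp only [ENNReal.toReal_natCast] at h1
    rw [h1, hX.lintegral_age_eq hlamE hq1 hB C ht i]
    rfl

end IsNetwork

end NetworkRenewal

/-! ### Laplace transforms of renewal sums -/

/-- The Abelian theorem for Laplace transforms, in the form of a bound for the limit. -/
lemma le_of_tendsto_of_lintegral_expMeasure_le {f : ℝ → ℝ≥0∞} {a : ℝ≥0∞}
    (hf : Tendsto f atTop (𝓝 a)) {c : ℝ≥0∞} {b : ℝ} (hb : 0 < b)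
    (h : ∀ θ, 0 < θ → θ < b → ∫⁻ x, f x ∂(expMeasure θ) ≤ c) : a ≤ c := by
  refine le_of_forall_lt fun a' ha' => ?_
  obtain ⟨a'', ha1, ha2⟩ := exists_between ha'
  refine ha1.trans_le ?_
  obtain ⟨t, ht⟩ := eventually_atTop.1 (hf.eventually_const_lt ha2)
  set s := max t 0 with hs
  have hs0 : 0 ≤ s := le_max_right _ _
  have h1 : ∀ θ, 0 < θ → θ < b → a'' * ENNReal.ofReal (Real.exp (-(θ * s))) ≤ c := by
    intro θ h0 h1
    refine le_trans ?_ (h θ h0 h1)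
    rw [← expMeasure_Ici h0 hs0, ← setLIntegral_const]
    refine (setLIntegral_mono_ae' measurableSet_Ici (ae_of_all _ fun x hx => ?_)).trans
      (setLIntegral_le_lintegral _ _)
    exact (ht x ((le_max_left _ _).trans hx)).le
  have h2 : Tendsto (fun θ : ℝ => a'' * ENNReal.ofReal (Real.exp (-(θ * s)))) (𝓝[>] 0)
      (𝓝 (a'' * ENNReal.ofReal (Real.exp (-(0 * s))))) := by
    refine ENNReal.Tendsto.const_mul (ENNReal.tendsto_ofReal ?_) (Or.inr ha2.ne_top)
    have : Continuous fun θ : ℝ => Real.exp (-(θ * s)) := by fun_prop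
    exact (this.tendsto 0).mono_left nhdsWithin_le_nhds
  simp only [zero_mul, neg_zero, Real.exp_zero, ENNReal.ofReal_one, mul_one] at h2
  refine le_of_tendsto h2 ?_
  filter_upwards [Ioo_mem_nhdsGT hb] with θ hθ
  exact h1 θ hθ.1 hθ.2

section Discounted

variable {Y S : Type*} [MeasurableSpace Y] {m : Measure Y} {ℓ : Y → ℝ} {U : Y → S → S} {θ : ℝ}

/-- One step of the embedded chain, acting on functions of the state and discounted at the rate `θ`
over the length of the step. -/
noncomputable def discountedStep (m : Measure Y) (ℓ : Y → ℝ) (U : Y → S → S) (θ : ℝ)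
    (f : S → ℝ≥0∞) (D : S) : ℝ≥0∞ :=
  ∫⁻ y, ENNReal.ofReal (Real.exp (-(θ * ℓ y))) * f (U y D) ∂m

/-- The total discounted value of `f` along the embedded chain. -/
noncomputable def discountedSum (m : Measure Y) (ℓ : Y → ℝ) (U : Y → S → S) (θ : ℝ)
    (f : S → ℝ≥0∞) (D : S) : ℝ≥0∞ :=
  ∑' k, (discountedStep m ℓ U θ)^[k] f D

lemma discountedStep_mono {f g : S → ℝ≥0∞} (h : f ≤ g) :
    discountedStep m ℓ U θ f ≤ discountedStep m ℓ U θ g :=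
  fun _ => lintegral_mono fun _ => mul_le_mul_right (h _) _

lemma discountedStep_iterate_mono {f g : S → ℝ≥0∞} (h : f ≤ g) (k : ℕ) :
    (discountedStep m ℓ U θ)^[k] f ≤ (discountedStep m ℓ U θ)^[k] g :=
  Monotone.iterate (fun _ _ h => discountedStep_mono h) k h

lemma discountedSum_mono {f g : S → ℝ≥0∞} (h : f ≤ g) (D : S) :
    discountedSum m ℓ U θ f D ≤ discountedSum m ℓ U θ g D :=
  ENNReal.tsum_le_tsum fun k => discountedStep_iterate_mono h k D

lemma discountedSum_eq (f : S → ℝ≥0∞) (D : S) :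
    discountedSum m ℓ U θ f D = f D + discountedSum m ℓ U θ (discountedStep m ℓ U θ f) D := by
  rw [discountedSum, tsum_eq_zero_add' ENNReal.summable]
  rfl

lemma discountedStep_iterate_le (hℓ : Measurable ℓ) {φ : S → ℕ} (hφ : ∀ y D, φ (U y D) ≤ φ D + 1)
    {g : ℕ → ℝ≥0∞} (hg : Monotone g) {f : S → ℝ≥0∞} (hf : ∀ D, f D ≤ g (φ D)) (k : ℕ) (D : S) :
    (discountedStep m ℓ U θ)^[k] f D ≤
      (∫⁻ y, ENNReal.ofReal (Real.exp (-(θ * ℓ y))) ∂m) ^ k * g (φ D + k) := by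
  induction k generalizing D with
  | zero => simpa using hf D
  | succ k ih =>
    rw [Function.iterate_succ_apply', pow_succ', mul_assoc,
      ← lintegral_mul_const _ (by fun_prop : Measurable fun y =>
        ENNReal.ofReal (Real.exp (-(θ * ℓ y))))]
    refine lintegral_mono fun y => mul_le_mul_right ((ih _).trans (mul_le_mul_right (hg ?_) _)) _
    have := hφ y D
    omega

lemma discountedSum_one (hℓ : Measurable ℓ) (D : S) :
    discountedSum m ℓ U θ 1 D = ∑' k, (∫⁻ y, ENNReal.ofReal (Real.exp (-(θ * ℓ y))) ∂m) ^ k := by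
  refine tsum_congr fun k => ?_
  induction k generalizing D with
  | zero => simp
  | succ k ih =>
    rw [Function.iterate_succ_apply', discountedStep, pow_succ']
    simp only [ih]
    exact lintegral_mul_const _ (by fun_prop)

variable [MeasurableSpace S] [DiscreteMeasurableSpace S]

lemma discountedStep_add (hℓ : Measurable ℓ) (hU : ∀ D, Measurable fun y => U y D)
    (f g : S → ℝ≥0∞) :
    discountedStep m ℓ U θ (f + g) = discountedStep m ℓ U θ f + discountedStep m ℓ U θ g := by
  funext D
  simp only [discountedStep, Pi.add_apply, mul_add]
  exact lintegral_add_left (Measurable.mul (by fun_prop) (Measurable.of_discrete.comp (hU D))) _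

lemma discountedStep_const_mul (hℓ : Measurable ℓ) (hU : ∀ D, Measurable fun y => U y D)
    (c : ℝ≥0∞) (f : S → ℝ≥0∞) :
    discountedStep m ℓ U θ (fun D => c * f D) = fun D => c * discountedStep m ℓ U θ f D := by
  funext D
  simp only [discountedStep, mul_left_comm _ c]
  exact lintegral_const_mul _ (Measurable.mul (by fun_prop) (Measurable.of_discrete.comp (hU D)))

lemma discountedSum_add (hℓ : Measurable ℓ) (hU : ∀ D, Measurable fun y => U y D)
    (f g : S → ℝ≥0∞) (D : S) :
    discountedSum m ℓ U θ (f + g) D = discountedSum m ℓ U θ f D + discountedSum m ℓ U θ g D := by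
  rw [discountedSum, discountedSum, discountedSum, ← ENNReal.tsum_add]
  refine tsum_congr fun k => ?_
  have : (discountedStep m ℓ U θ)^[k] (f + g) =
      (discountedStep m ℓ U θ)^[k] f + (discountedStep m ℓ U θ)^[k] g := by
    induction k with
    | zero => rfl
    | succ k ih => rw [Function.iterate_succ_apply', Function.iterate_succ_apply',
        Function.iterate_succ_apply', ih, discountedStep_add hℓ hU]
  rw [this, Pi.add_apply]

lemma discountedSum_const_mul (hℓ : Measurable ℓ) (hU : ∀ D, Measurable fun y => U y D)
    (c : ℝ≥0∞) (f : S → ℝ≥0∞) (D : S) :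
    discountedSum m ℓ U θ (fun D => c * f D) D = c * discountedSum m ℓ U θ f D := by
  rw [discountedSum, discountedSum, ← ENNReal.tsum_mul_left]
  refine tsum_congr fun k => ?_
  have : (discountedStep m ℓ U θ)^[k] (fun D => c * f D) =
      fun D => c * (discountedStep m ℓ U θ)^[k] f D := by
    induction k with
    | zero => rfl
    | succ k ih => rw [Function.iterate_succ_apply', Function.iterate_succ_apply',
        ih, discountedStep_const_mul hℓ hU]
  rw [this]

variable [Countable S] [SFinite m]

/-- The Laplace transform turns a step of the renewal process into a discounted step. -/
lemma lintegral_renewalStep (hθ : 0 < θ) (hℓ : Measurable ℓ) (hpos : ∀ᵐ y ∂m, 0 ≤ ℓ y)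
    (hU : ∀ D, Measurable fun y => U y D) {h : ℝ → S → ℝ≥0∞}
    (hh : ∀ D, Measurable fun x => h x D) (hneg : ∀ x < 0, ∀ D, h x D = 0) (D : S) :
    ∫⁻ x, renewalStep m ℓ U h x D ∂(expMeasure θ) =
      discountedStep m ℓ U θ (fun D => ∫⁻ x, h x D ∂(expMeasure θ)) D := by
  have := isProbabilityMeasure_expMeasure hθ
  have hpdf := measurable_exponentialPDF θ
  simp only [renewalStep]
  rw [lintegral_lintegral_swap (measurable_renewalStep_integrand hℓ hU hh D).aemeasurable]
  refine lintegral_congr_ae ?_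
  filter_upwards [hpos] with y hy
  have hm : Measurable fun x => h (x - ℓ y) (U y D) := (hh _).comp (by fun_prop)
  rw [lintegral_expMeasure _ hm, lintegral_expMeasure _ (hh _),
    ← lintegral_const_mul (f := fun x => exponentialPDF θ x * h x (U y D)) _ (hpdf.mul (hh _)),
    ← lintegral_add_right_eq_self (fun x => exponentialPDF θ x * h (x - ℓ y) (U y D)) (ℓ y)]
  refine lintegral_congr fun x => ?_
  rw [add_sub_cancel_right]
  rcases lt_or_ge x 0 with hx | hx
  · simp [hneg x hx]
  · rw [exponentialPDF_of_nonneg (by linarith), exponentialPDF_of_nonneg hx, ← mul_assoc,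
      ← ENNReal.ofReal_mul (Real.exp_pos _).le, mul_left_comm, ← Real.exp_add]
    ring_nf

lemma lintegral_renewalSum (hθ : 0 < θ) (hℓ : Measurable ℓ) (hpos : ∀ᵐ y ∂m, 0 ≤ ℓ y)
    (hU : ∀ D, Measurable fun y => U y D) {h : ℝ → S → ℝ≥0∞}
    (hh : ∀ D, Measurable fun x => h x D) (hneg : ∀ x < 0, ∀ D, h x D = 0) (D : S) :
    ∫⁻ x, renewalSum m ℓ U h x D ∂(expMeasure θ) =
      discountedSum m ℓ U θ (fun D => ∫⁻ x, h x D ∂(expMeasure θ)) D := by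
  simp only [renewalSum]
  rw [lintegral_tsum fun k => (measurable_renewalStep_iterate hℓ hU hh k D).aemeasurable]
  refine tsum_congr fun k => ?_
  induction k generalizing h with
  | zero => rfl
  | succ k ih =>
    rw [Function.iterate_succ_apply, ih (measurable_renewalStep hℓ hU hh)
      fun x hx D => renewalStep_of_neg hpos hneg hx D, Function.iterate_succ_apply]
    exact congrFun (congrArg (discountedStep m ℓ U θ)^[k]
      (funext fun D => lintegral_renewalStep hθ hℓ hpos hU hh hneg D)) D

end Discounted

/-! ### Probabilities of messages -/

/-- A uniformly random set of `f` elements of `s` contains a given element of `s` with a probability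
of at least `f / s.card`. -/
lemma div_le_card_filter_mem {α : Type*} [DecidableEq α] (s : Finset α) {a : α} (ha : a ∈ s)
    {f : ℕ} (hf : f ≤ s.card) :
    (f : ℝ) / s.card ≤ ((s.powersetCard f).filter (a ∈ ·)).card / s.card.choose f := by
  have hs : 0 < s.card := Finset.card_pos.2 ⟨a, ha⟩
  rcases f.eq_zero_or_pos with rfl | hf0
  · simp
  obtain ⟨g, rfl⟩ := Nat.exists_eq_succ_of_ne_zero hf0.ne'
  obtain ⟨N, hN⟩ := Nat.exists_eq_succ_of_ne_zero hs.ne'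
  have hcard : N.choose g ≤ ((s.powersetCard (g + 1)).filter (a ∈ ·)).card := by
    have h1 : ((s.erase a).powersetCard g).card = N.choose g := by
      rw [Finset.card_powersetCard, Finset.card_erase_of_mem ha, hN, Nat.succ_sub_one]
    rw [← h1]
    refine Finset.card_le_card_of_injOn (insert a) (fun A hA => ?_) fun A hA A' hA' h => ?_
    · obtain ⟨hA1, hA2⟩ := Finset.mem_powersetCard.1 hA
      have haA : a ∉ A := fun h => Finset.notMem_erase a s (hA1 h)
      simp only [Finset.coe_filter, Finset.mem_powersetCard, Set.mem_ofPred_eq]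
      exact ⟨⟨Finset.insert_subset ha (hA1.trans (Finset.erase_subset _ _)),
        by rw [Finset.card_insert_of_notMem haA, hA2]⟩, Finset.mem_insert_self _ _⟩
    · have haA : a ∉ A := fun h => Finset.notMem_erase a s ((Finset.mem_powersetCard.1 hA).1 h)
      have haA' : a ∉ A' := fun h =>
        Finset.notMem_erase a s ((Finset.mem_powersetCard.1 hA').1 h)
      rw [← Finset.erase_insert haA, h, Finset.erase_insert haA']
  have hch : (0 : ℝ) < (s.card.choose (g + 1) : ℕ) := by exact_mod_cast Nat.choose_pos hf
  rw [div_le_div_iff₀ (by exact_mod_cast hs) hch]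
  have h2 := Nat.add_one_mul_choose_eq N g
  rw [hN]
  calc ((g.succ : ℕ) : ℝ) * ((N.succ.choose (g + 1) : ℕ) : ℝ)
      = ((N.succ.choose g.succ * g.succ : ℕ) : ℝ) := by push_cast; ring
    _ = (N.choose g : ℝ) * (N.succ : ℕ) := by rw [← h2]; push_cast; ring
    _ ≤ _ := by gcongr

/-- Convexity of the power function. Its role: if a Poisson process of messages is split among `b`
senders, each of which is connected with probability `a` and sends nothing with probability `y`, then
it is at least as probable that a message comes through as without the splitting. -/
lemma pow_le_of_convex {a y : ℝ} (ha : 0 ≤ a) (ha1 : a ≤ 1) (hy : 0 ≤ y) (b : ℕ) :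
    (1 - a * (1 - y)) ^ b ≤ 1 - a * (1 - y ^ b) := by
  have h1 := (convexOn_pow b).2 (x := (1 : ℝ)) (y := y) (Set.mem_Ici.2 zero_le_one)
    (Set.mem_Ici.2 hy) (sub_nonneg.2 ha1) ha (by ring)
  simp only [smul_eq_mul, one_pow, mul_one] at h1
  calc (1 - a * (1 - y)) ^ b = (1 - a + a * y) ^ b := by ring
    _ ≤ _ := h1
    _ = _ := by ring

namespace IsNetwork

variable {Ω : Type*} {n : ℕ}

lemma measurableSet_recv_iSup (X : Ω → Inputs n)
    {S : Set (ℕ ⊕ Fin n ⊕ (ℕ × Fin n × Fin n) ⊕ (ℕ × Fin n))} {j : Fin n} (i : Fin n)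
    (hj : Sum.inr (Sum.inr (Sum.inr (0, j))) ∈ S) :
    MeasurableSet[⨆ c ∈ S, inputAlgebra X c] {ω | i ∈ (X ω).recv 0 j} :=
  comap_recv_le X hj _ ⟨{A | i ∈ A}, trivial, rfl⟩

lemma measurableSet_clock_iSup (X : Ω → Inputs n)
    {S : Set (ℕ ⊕ Fin n ⊕ (ℕ × Fin n × Fin n) ⊕ (ℕ × Fin n))} {j i : Fin n} (t : ℝ≥0)
    (hj : Sum.inr (Sum.inr (Sum.inl (0, j, i))) ∈ S) :
    MeasurableSet[⨆ c ∈ S, inputAlgebra X c] {ω | (X ω).clock 0 j i t = 0} :=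
  ((measurable_pi_apply t).comp (measurable_iff_comap_le.2 (comap_clock_le X hj)))
    (MeasurableSet.of_discrete (s := {0}))

/-- The event that node `i` gets no gossip from the nodes in `M`, when each gossip clock is run up
to its reading `t`. -/
def noGossip (X : Ω → Inputs n) (i : Fin n) (t : ℝ≥0) (M : Finset (Fin n)) : Set Ω :=
  {ω | ∀ j ∈ M, ¬(i ∈ (X ω).recv 0 j ∧ 0 < (X ω).clock 0 j i t)}

lemma measurableSet_noGossip_iSup (X : Ω → Inputs n) (i : Fin n) (t : ℝ≥0) (M : Finset (Fin n)) :
    MeasurableSet[⨆ c ∈ {c | ∃ j ∈ M, c = Sum.inr (Sum.inr (Sum.inl (0, j, i))) ∨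
      c = Sum.inr (Sum.inr (Sum.inr (0, j)))}, inputAlgebra X c] (noGossip X i t M) := by
  have hset : noGossip X i t M =
      ⋂ j ∈ M, ({ω | i ∈ (X ω).recv 0 j} ∩ {ω | (X ω).clock 0 j i t = 0}ᶜ)ᶜ := by
    ext ω; simp [noGossip, Nat.pos_iff_ne_zero]
  rw [hset]
  refine M.measurableSet_biInter fun j hj => (MeasurableSet.inter
    (measurableSet_recv_iSup X i ?_) (measurableSet_clock_iSup X t ?_).compl).compl
  · exact ⟨j, hj, Or.inr rfl⟩
  · exact ⟨j, hj, Or.inl rfl⟩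

variable [MeasurableSpace Ω] {P : Measure Ω} {X : Ω → Inputs n} {lamE lam q : ℝ}

lemma measure_forall_src_eq_zero (hX : IsNetwork P X lamE lam q) (hn : 0 < n) (hlam : 0 ≤ lam)
    (t : ℝ≥0) : P {ω | ∀ i, (X ω).src i t = 0} = ENNReal.ofReal (Real.exp (-(lam * t))) := by
  have hind : iIndep (fun i : Fin n => inputAlgebra X (Sum.inr (Sum.inl i))) P :=
    hX.indep.precomp (g := fun i : Fin n => Sum.inr (Sum.inl i)) fun i i' h => by simpa using h
  have hset : {ω | ∀ i, (X ω).src i t = 0} = ⋂ i, {ω | (X ω).src i t = 0} := by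
    ext ω; simp
  have hn' : (n : ℝ) ≠ 0 := by exact_mod_cast hn.ne'
  rw [hset, hind.meas_iInter, Finset.prod_congr rfl fun i _ =>
    (hX.poisson_src i).measure_eq_zero t, Finset.prod_const, Finset.card_univ, Fintype.card_fin,
    ← ENNReal.ofReal_pow (Real.exp_pos _).le, ← Real.exp_nat_mul,
    Real.coe_toNNReal _ (div_nonneg hlam (Nat.cast_nonneg n))]
  · congr 2
    field_simp
  · intro i
    have h1 : Measurable[⨆ t : ℝ≥0, MeasurableSpace.comap (fun ω => (X ω).src i t) ⊤]
        fun ω => (X ω).src i t :=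
      measurable_iff_comap_le.2 (le_iSup (fun t : ℝ≥0 =>
        MeasurableSpace.comap (fun ω => (X ω).src i t) ⊤) t)
    exact h1 (MeasurableSet.of_discrete (s := {0}))

lemma measure_inter_of_disjoint (hX : IsNetwork P X lamE lam q)
    {S T : Set (ℕ ⊕ Fin n ⊕ (ℕ × Fin n × Fin n) ⊕ (ℕ × Fin n))} (hST : Disjoint S T)
    {E F : Set Ω} (hE : MeasurableSet[⨆ c ∈ S, inputAlgebra X c] E)
    (hF : MeasurableSet[⨆ c ∈ T, inputAlgebra X c] F) : P (E ∩ F) = P E * P F :=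
  (Indep_iff _ _ _).1 (indep_iSup_of_disjoint hX.inputAlgebra_le hX.indep hST) E F hE hF

lemma le_measure_mem_recv (hX : IsNetwork P X lamE lam q) (hq1 : q ≤ 1) {i j : Fin n}
    (hij : i ≠ j) :
    ENNReal.ofReal ((fanout n q : ℝ) / ((n - 1 : ℕ) : ℝ)) ≤ P {ω | i ∈ (X ω).recv 0 j} := by
  classical
  set F := Finset.powersetCard (fanout n q) (Finset.univ.erase j) with hF
  have hcard : (Finset.univ.erase j).card = n - 1 := by
    rw [Finset.card_erase_of_mem (Finset.mem_univ j), Finset.card_univ, Fintype.card_fin]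
  have hfan := fanout_le j.pos hq1
  have h0 : (0 : ℝ) < ((n - 1).choose (fanout n q) : ℕ) := by
    exact_mod_cast Nat.choose_pos hfan
  calc ENNReal.ofReal ((fanout n q : ℝ) / ((n - 1 : ℕ) : ℝ))
      ≤ ENNReal.ofReal ((F.filter (i ∈ ·)).card / (n - 1).choose (fanout n q)) := by
        have h1 := div_le_card_filter_mem (Finset.univ.erase j) (a := i) (f := fanout n q)
          (Finset.mem_erase.2 ⟨hij, Finset.mem_univ i⟩) (by rw [hcard]; exact hfan)
        rw [hcard] at h1
        exact ENNReal.ofReal_le_ofReal h1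
    _ = ∑ A ∈ F.filter (i ∈ ·), P {ω | (X ω).recv 0 j = A} := by
        rw [Finset.sum_congr rfl fun A hA => hX.law_recv 0 j A (Finset.mem_filter.1 hA).1,
          Finset.sum_const, nsmul_eq_mul, ENNReal.ofReal_div_of_pos h0, ENNReal.ofReal_natCast,
          ENNReal.ofReal_natCast, ENNReal.div_eq_inv_mul, mul_comm]
    _ = P (⋃ A ∈ F.filter (i ∈ ·), {ω | (X ω).recv 0 j = A}) :=
        (measure_biUnion_finset (fun A _ A' _ hAA' => Set.disjoint_left.2 fun ω h h' =>
          hAA' (h.symm.trans h')) fun A _ => hX.measurable_recv 0 j A).symm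
    _ ≤ _ := by
        refine measure_mono fun ω hω => ?_
        simp only [Set.mem_iUnion] at hω
        obtain ⟨A, hA, rfl⟩ := hω
        exact (Finset.mem_filter.1 hA).2

lemma measurableSet_noGossip (hX : IsNetwork P X lamE lam q) (i : Fin n) (t : ℝ≥0)
    (M : Finset (Fin n)) : MeasurableSet (noGossip X i t M) :=
  (iSup₂_le fun c _ => hX.inputAlgebra_le c) _ (measurableSet_noGossip_iSup X i t M)

variable [IsProbabilityMeasure P]

lemma measure_noGossip_singleton_le (hX : IsNetwork P X lamE lam q) (hq1 : q ≤ 1) {i j : Fin n}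
    (hij : i ≠ j) (t : ℝ≥0) :
    P (noGossip X i t {j}) ≤
      ENNReal.ofReal (1 - fanout n q / ((n - 1 : ℕ) : ℝ) * (1 - Real.exp (-t))) := by
  have hset : noGossip X i t {j} =
      ({ω | i ∈ (X ω).recv 0 j} ∩ {ω | (X ω).clock 0 j i t = 0}ᶜ)ᶜ := by
    ext ω; simp [noGossip, Nat.pos_iff_ne_zero]
  have hm1 : MeasurableSet {ω | i ∈ (X ω).recv 0 j} := hX.measurableSet_recv_mem 0 j {A | i ∈ A}
  have hm2 : MeasurableSet {ω | (X ω).clock 0 j i t = 0} :=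
    (hX.poisson_clock 0 j i).measurable t (measurableSet_singleton 0)
  have hmul : P ({ω | i ∈ (X ω).recv 0 j} ∩ {ω | (X ω).clock 0 j i t = 0}ᶜ) =
      P {ω | i ∈ (X ω).recv 0 j} * P {ω | (X ω).clock 0 j i t = 0}ᶜ := by
    refine hX.measure_inter_of_disjoint (S := {Sum.inr (Sum.inr (Sum.inr (0, j)))})
      (T := {Sum.inr (Sum.inr (Sum.inl (0, j, i)))}) (by simp)
      (measurableSet_recv_iSup X i rfl) (MeasurableSet.compl (measurableSet_clock_iSup X t rfl))
  have hclock : P {ω | (X ω).clock 0 j i t = 0}ᶜ = ENNReal.ofReal (1 - Real.exp (-t)) := by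
    rw [prob_compl_eq_one_sub hm2, (hX.poisson_clock 0 j i).measure_eq_zero t,
      ENNReal.ofReal_sub _ (Real.exp_pos _).le, ENNReal.ofReal_one, NNReal.coe_one, one_mul]
  have he : 0 ≤ 1 - Real.exp (-(t : ℝ)) := by simp
  have ha0 : (0 : ℝ) ≤ fanout n q / ((n - 1 : ℕ) : ℝ) := by positivity
  rw [hset, prob_compl_eq_one_sub (hm1.inter hm2.compl), hmul, hclock,
    ENNReal.ofReal_sub _ (mul_nonneg ha0 he), ENNReal.ofReal_one, ENNReal.ofReal_mul ha0]
  exact tsub_le_tsub_left (mul_le_mul_left (hX.le_measure_mem_recv hq1 hij) _) _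

lemma measure_noGossip_le (hX : IsNetwork P X lamE lam q) (hq1 : q ≤ 1) {i : Fin n} (t : ℝ≥0)
    {M : Finset (Fin n)} (hi : i ∉ M) :
    P (noGossip X i t M) ≤
      ENNReal.ofReal (1 - fanout n q / ((n - 1 : ℕ) : ℝ) * (1 - Real.exp (-t))) ^ M.card := by
  classical
  induction M using Finset.induction_on with
  | empty => simpa using prob_le_one
  | insert j M hj ih =>
    have hset : noGossip X i t (insert j M) = noGossip X i t {j} ∩ noGossip X i t M := by
      ext ω; simp [noGossip]
    rw [hset, hX.measure_inter_of_disjoint ?_ (measurableSet_noGossip_iSup X i t {j})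
      (measurableSet_noGossip_iSup X i t M), Finset.card_insert_of_notMem hj, pow_succ']
    · simp only [Finset.mem_insert, not_or] at hi
      exact mul_le_mul' (hX.measure_noGossip_singleton_le hq1 hi.1 t) (ih hi.2)
    · rw [Set.disjoint_left]
      rintro c ⟨l, hl, hc⟩ ⟨l', hl', hc'⟩
      rw [Finset.mem_singleton] at hl
      subst hl
      have : l = l' := by
        rcases hc with rfl | rfl <;> rcases hc' with h | h <;> simp at h <;> exact h
      exact hj (this ▸ hl')

/-- A node that has not the minimum age gets gossip up to the elapsed time `r` at least as probably
as if a single neighbour sent with the total rate `B / fanout n q`. -/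
lemma le_measure_gossip (hX : IsNetwork P X lamE lam q) (hq1 : q ≤ 1) {B : ℝ} (hB : 0 ≤ B)
    (C : ℝ) {D : Fin n → ℕ} {i : Fin n} (hi : i ∉ minAgeNodes D) (r : ℝ) :
    ENNReal.ofReal (fanout n q / ((n - 1 : ℕ) : ℝ) *
        (1 - Real.exp (-(B / fanout n q * max (r - C * minAge D) 0)))) ≤
      P (noGossip X i (gossipReading q B C D r) (minAgeNodes D))ᶜ := by
  set a : ℝ := fanout n q / ((n - 1 : ℕ) : ℝ) with ha
  set t := gossipReading q B C D r with ht
  have hfan := fanout_le i.pos hq1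
  have ha0 : 0 ≤ a := by positivity
  have ha1 : a ≤ 1 := div_le_one_of_le₀ (by exact_mod_cast hfan) (Nat.cast_nonneg _)
  have hb : 0 < (minAgeNodes D).card := by
    obtain ⟨j, hj⟩ := Nat.sInf_mem (⟨D i, i, rfl⟩ : (Set.range D).Nonempty)
    exact Finset.card_pos.2 ⟨j, Finset.mem_filter.2 ⟨Finset.mem_univ j, hj⟩⟩
  have hbt : ((minAgeNodes D).card : ℝ) * t = B / fanout n q * max (r - C * minAge D) 0 := by
    have hb' : ((minAgeNodes D).card : ℝ) ≠ 0 := by exact_mod_cast hb.ne'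
    have hrate := gossipRate_nonneg (q := q) hB D
    have hmax := mul_max_of_nonneg (r - C * minAge D) 0 hrate
    rw [mul_zero] at hmax
    rw [ht, gossipReading, Real.coe_toNNReal', ← hmax, ← mul_assoc, gossipRate]
    congr 1
    rcases (fanout n q).eq_zero_or_pos with h0 | h0
    · simp [h0]
    · field_simp
  rw [prob_compl_eq_one_sub (hX.measurableSet_noGossip i t _)]
  have hy1 : Real.exp (-(t : ℝ)) ≤ 1 := by simp
  have h2 : P (noGossip X i t (minAgeNodes D)) ≤ ENNReal.ofReal
      (1 - a * (1 - Real.exp (-(B / fanout n q * max (r - C * minAge D) 0)))) := by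
    refine (hX.measure_noGossip_le hq1 t hi).trans ?_
    rw [← ENNReal.ofReal_pow (by nlinarith [Real.exp_pos (-(t : ℝ))]), ← hbt, ← mul_neg,
      Real.exp_nat_mul]
    exact ENNReal.ofReal_le_ofReal (pow_le_of_convex ha0 ha1 (Real.exp_pos _).le _)
  refine le_trans ?_ (tsub_le_tsub_left h2 1)
  rw [← ENNReal.ofReal_one, ← ENNReal.ofReal_sub]
  · exact ENNReal.ofReal_le_ofReal (by linarith)
  · have : Real.exp (-(B / fanout n q * max (r - C * minAge D) 0)) ≤ 1 := by
      rw [← hbt, Real.exp_le_one_iff, neg_nonpos]; positivity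
    nlinarith [Real.exp_pos (-(B / fanout n q * max (r - C * minAge D) 0))]

end IsNetwork

/-! ### Drift inequalities for the chain of ages -/

lemma ENNReal.add_mul_le_of_le {x y c c' a b : ℝ≥0∞} (hc : c ≤ c') (hc' : c' ≠ ⊤) (ha : a ≠ ⊤)
    (hba : b ≤ a) (h : x + c' * a ≤ y + c' * b) : x + c * a ≤ y + c * b := by
  obtain ⟨d, rfl⟩ := exists_add_of_le hc
  have hd : d ≠ ⊤ := (ENNReal.add_ne_top.1 hc').2
  have hda : d * a ≠ ⊤ := ENNReal.mul_ne_top hd ha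
  refine (ENNReal.add_le_add_iff_right hda).1 ?_
  calc x + c * a + d * a = x + (c + d) * a := by ring
    _ ≤ y + (c + d) * b := h
    _ = y + c * b + d * b := by ring
    _ ≤ _ := by gcongr

/-- A lower bound for the probability that a node that has not the minimum age gets gossip during
the first `x` time units of a gossiping phase. -/
noncomputable def gossipChance (n : ℕ) (q B x : ℝ) : ℝ :=
  fanout n q / ((n - 1 : ℕ) : ℝ) * (1 - Real.exp (-(B / fanout n q * x)))

lemma continuous_gossipChance (n : ℕ) (q B : ℝ) : Continuous (gossipChance n q B) := by
  unfold gossipChance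
  fun_prop

section Drift

variable {Ω : Type*} [MeasurableSpace Ω] {P : Measure Ω} {n : ℕ}
  {X : Ω → Inputs n} {lamE lam q : ℝ}

namespace IsNetwork

lemma measurable_initial_agesBefore (hX : IsNetwork P X lamE lam q) (B C : ℝ) (D : Fin n → ℕ)
    (r : ℝ) (i : Fin n) :
    Measurable fun ω => (agesBefore q B C ((X ω).localInputs 0 0) D r i : ℝ≥0∞) :=
  Measurable.of_discrete.comp ((measurable_pi_apply i).comp
    ((isMeasurableAt_id r).measurable_agesBefore D |>.comp (hX.measurable_localInputs 0 0)))

variable [IsProbabilityMeasure P]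

/-- Gossip makes the age of a node drift towards the minimum age. -/
lemma lintegral_agesBefore_add_le (hX : IsNetwork P X lamE lam q) (hq1 : q ≤ 1) {B C : ℝ}
    (hB : 0 ≤ B) (hC : 0 ≤ C) (D : Fin n → ℕ) (i : Fin n) (r : ℝ) :
    ∫⁻ ω, (agesBefore q B C ((X ω).localInputs 0 0) D r i : ℝ≥0∞) ∂P +
        ENNReal.ofReal (gossipChance n q B (max (r - C * minAge D) 0)) * D i ≤
      D i + ENNReal.ofReal (gossipChance n q B (max (r - C * minAge D) 0)) * minAge D := by
  by_cases hi : i ∈ minAgeNodes D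
  · rw [eq_minAge_of_mem hi]
    gcongr
    calc _ ≤ ∫⁻ _, (minAge D : ℝ≥0∞) ∂P := lintegral_mono fun ω =>
          Nat.cast_le.2 ((agesBefore_le ..).trans_eq (eq_minAge_of_mem hi))
      _ = _ := by simp
  -- only messages strictly before the elapsed time `r` count
  have key : ∀ r' < r, ∫⁻ ω, (agesBefore q B C ((X ω).localInputs 0 0) D r i : ℝ≥0∞) ∂P +
        ENNReal.ofReal (gossipChance n q B (max (r' - C * minAge D) 0)) * D i ≤
      D i + ENNReal.ofReal (gossipChance n q B (max (r' - C * minAge D) 0)) * minAge D := by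
    intro r' hr
    set E := (noGossip X i (gossipReading q B C D r') (minAgeNodes D))ᶜ with hE
    have hEm : MeasurableSet E := (hX.measurableSet_noGossip i _ _).compl
    refine ENNReal.add_mul_le_of_le (hX.le_measure_gossip hq1 hB C hi r') (measure_ne_top _ _)
      (ENNReal.natCast_ne_top _) (Nat.cast_le.2 (minAge_le D i)) ?_
    rw [mul_comm (P E), mul_comm (P E), ← lintegral_indicator_const hEm,
      ← lintegral_indicator_const hEm,
      ← lintegral_add_left (hX.measurable_initial_agesBefore B C D r i)]
    calc _ ≤ ∫⁻ ω, ((D i : ℝ≥0∞) + E.indicator (fun _ => (minAge D : ℝ≥0∞)) ω) ∂P := by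
          refine lintegral_mono fun ω => ?_
          by_cases hω : ω ∈ E
          · rw [Set.indicator_of_mem hω, Set.indicator_of_mem hω, add_comm]
            refine add_le_add_right (Nat.cast_le.2 ?_) _
            simp only [hE, noGossip, Set.mem_compl_iff, Set.mem_ofPred_eq, not_forall,
              not_not] at hω
            obtain ⟨j, hj, hji, hclock⟩ := hω
            have hread : gossipReading q B C D 0 = 0 := Real.toNNReal_of_nonpos
              (mul_nonpos_of_nonneg_of_nonpos (gossipRate_nonneg hB D) (by
                rw [zero_sub, neg_nonpos]; positivity))
            refine agesBefore_le_minAge (fun j l => (hX.poisson_clock 0 j l).mono ω) hB hr hj hji ?_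
            rw [hread]
            simpa [Inputs.localInputs, (hX.poisson_clock 0 j i).zero] using hclock
          · rw [Set.indicator_of_notMem hω, Set.indicator_of_notMem hω, add_zero, add_zero]
            exact Nat.cast_le.2 (agesBefore_le ..)
      _ = _ := by
          rw [lintegral_add_left measurable_const, lintegral_const, measure_univ, mul_one]
  have hlim : ∀ c : ℕ, Tendsto (fun r' : ℝ => ENNReal.ofReal
      (gossipChance n q B (max (r' - C * minAge D) 0)) * c) (𝓝[<] r)
      (𝓝 (ENNReal.ofReal (gossipChance n q B (max (r - C * minAge D) 0)) * c)) := fun c => by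
    have hc : Continuous fun r' : ℝ => gossipChance n q B (max (r' - C * minAge D) 0) :=
      (continuous_gossipChance n q B).comp (by fun_prop)
    exact ENNReal.Tendsto.mul_const (ENNReal.tendsto_ofReal
      ((hc.tendsto r).mono_left nhdsWithin_le_nhds)) (Or.inr (ENNReal.natCast_ne_top _))
  exact le_of_tendsto_of_tendsto ((hlim _).const_add _) ((hlim _).const_add _)
    (eventually_nhdsWithin_of_forall key)

/-- The minimum age returns to `0` as soon as the source sends any update. -/
lemma lintegral_minAge_le (hX : IsNetwork P X lamE lam q) (hn : 0 < n) (hlam : 0 ≤ lam) (B C : ℝ)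
    (D : Fin n → ℕ) {r : ℝ} (hr : 0 ≤ r) :
    ∫⁻ ω, (minAge (nextAges q B C X (r, ω) D) : ℝ≥0∞) ∂P ≤
      1 + ENNReal.ofReal (Real.exp (-(lam * r))) * minAge D := by
  obtain ⟨j, hj⟩ : ∃ j, D j = minAge D :=
    Nat.sInf_mem (⟨D ⟨0, hn⟩, ⟨0, hn⟩, rfl⟩ : (Set.range D).Nonempty)
  have hle : ∀ ω, minAge (nextAges q B C X (r, ω) D) ≤ 1 + minAge D := fun ω => by
    rw [← hj, add_comm]
    exact (minAge_le _ j).trans (nextAges_le ..)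
  rcases hr.eq_or_lt with rfl | hr
  · calc _ ≤ ∫⁻ _, (1 + minAge D : ℝ≥0∞) ∂P := lintegral_mono fun ω => by
          exact (Nat.cast_le.2 (hle ω)).trans_eq (by push_cast; rfl)
      _ = _ := by simp
  have key : ∀ r' ∈ Set.Ioo 0 r, ∫⁻ ω, (minAge (nextAges q B C X (r, ω) D) : ℝ≥0∞) ∂P ≤
      1 + ENNReal.ofReal (Real.exp (-(lam * r'))) * minAge D := by
    intro r' hr'
    set E := {ω | ∀ i, (X ω).src i r'.toNNReal = 0} with hE
    have hEm : MeasurableSet E := by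
      rw [hE, Set.ofPred_forall]
      exact MeasurableSet.iInter fun i =>
        (hX.poisson_src i).measurable _ (measurableSet_singleton 0)
    have hEP : P E = ENNReal.ofReal (Real.exp (-(lam * r'))) := by
      rw [hX.measure_forall_src_eq_zero hn hlam, Real.coe_toNNReal _ hr'.1.le]
    rw [← hEP, mul_comm, ← lintegral_indicator_const hEm]
    calc _ ≤ ∫⁻ ω, (1 + E.indicator (fun _ => (minAge D : ℝ≥0∞)) ω) ∂P := by
          refine lintegral_mono fun ω => ?_
          by_cases hω : ω ∈ E
          · rw [Set.indicator_of_mem hω]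
            exact (Nat.cast_le.2 (hle ω)).trans_eq (by push_cast; rfl)
          · rw [Set.indicator_of_notMem hω, add_zero, ← Nat.cast_one]
            simp only [hE, Set.mem_ofPred_eq, not_forall] at hω
            obtain ⟨l, hl⟩ := hω
            have h0 : agesBefore q B C ((X ω).localInputs 0 0) D r l = 0 := by
              refine agesBefore_eq_zero (fun j a b hab => ?_) hr'.2 ?_
              · exact Nat.sub_le_sub_right ((hX.poisson_src j).mono ω (add_le_add_right hab 0)) _
              · simpa [Inputs.localInputs, (hX.poisson_src l).zero, Nat.pos_iff_ne_zero] using hl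
            refine Nat.cast_le.2 ((minAge_le _ l).trans ?_)
            simp [nextAges, h0]
      _ = _ := by rw [lintegral_add_left measurable_const, lintegral_const, measure_univ, mul_one]
  have hc : Continuous fun r' : ℝ => Real.exp (-(lam * r')) := by fun_prop
  have hlim : Tendsto (fun r' : ℝ => 1 + ENNReal.ofReal (Real.exp (-(lam * r'))) * minAge D)
      (𝓝[<] r) (𝓝 (1 + ENNReal.ofReal (Real.exp (-(lam * r))) * minAge D)) :=
    (ENNReal.Tendsto.mul_const (ENNReal.tendsto_ofReal
      ((hc.tendsto r).mono_left nhdsWithin_le_nhds))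
        (Or.inr (ENNReal.natCast_ne_top _))).const_add _
  refine ge_of_tendsto hlim ?_
  filter_upwards [Ioo_mem_nhdsLT hr] with r' hr'
  exact key r' hr'

/-- The chain of ages, discounted at the rate `θ`. -/
noncomputable abbrev ageStep (P : Measure Ω) (lamE q B C : ℝ) (X : Ω → Inputs n) (θ : ℝ) :
    ((Fin n → ℕ) → ℝ≥0∞) → (Fin n → ℕ) → ℝ≥0∞ :=
  discountedStep ((expMeasure lamE).prod P) Prod.fst (nextAges q B C X) θ

lemma ageStep_eq (hX : IsNetwork P X lamE lam q) (B C θ : ℝ) (f : (Fin n → ℕ) → ℝ≥0∞)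
    (D : Fin n → ℕ) :
    ageStep P lamE q B C X θ f D = ∫⁻ r, ENNReal.ofReal (Real.exp (-(θ * r))) *
      ∫⁻ ω, f (nextAges q B C X (r, ω) D) ∂P ∂(expMeasure lamE) := by
  have hm : Measurable fun y : ℝ × Ω => f (nextAges q B C X y D) :=
    Measurable.of_discrete.comp (hX.measurable_nextAges B C D)
  have hm' : Measurable fun y : ℝ × Ω =>
      ENNReal.ofReal (Real.exp (-(θ * y.1))) * f (nextAges q B C X y D) :=
    Measurable.mul (by fun_prop) hm
  rw [ageStep, discountedStep, lintegral_prod _ hm'.aemeasurable]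
  refine lintegral_congr fun r => ?_
  have hr : Measurable fun ω => f (nextAges q B C X (r, ω) D) := hm.comp measurable_prodMk_left
  exact lintegral_const_mul (ENNReal.ofReal (Real.exp (-(θ * r)))) hr

lemma ageStep_minAge_le (hX : IsNetwork P X lamE lam q) (hn : 0 < n) (hlamE : 0 < lamE)
    (hlam : 0 ≤ lam) (B C : ℝ) {θ : ℝ} (hθ : 0 ≤ θ) (D : Fin n → ℕ) :
    ageStep P lamE q B C X θ (fun D => minAge D) D ≤
      ENNReal.ofReal (lamE / (lamE + θ)) + ENNReal.ofReal (lamE / (lamE + θ + lam)) * minAge D := by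
  rw [hX.ageStep_eq]
  calc _ ≤ ∫⁻ r, (ENNReal.ofReal (Real.exp (-θ * r)) +
        ENNReal.ofReal (Real.exp (-(θ + lam) * r)) * minAge D) ∂(expMeasure lamE) := by
        refine lintegral_mono_ae ?_
        filter_upwards [ae_nonneg_expMeasure lamE] with r hr
        refine (mul_le_mul_right (hX.lintegral_minAge_le hn hlam B C D hr) _).trans_eq ?_
        rw [mul_add, mul_one, ← mul_assoc, ← ENNReal.ofReal_mul (Real.exp_pos _).le,
          ← Real.exp_add, neg_mul]
        ring_nf
    _ = _ := by
        rw [lintegral_add_left (by fun_prop), lintegral_mul_const _ (by fun_prop),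
          lintegral_exp_expMeasure hlamE (by linarith),
          lintegral_exp_expMeasure hlamE (by linarith), sub_neg_eq_add, sub_neg_eq_add, add_assoc]

lemma ageStep_minAge_mul_le (hX : IsNetwork P X lamE lam q) (hlamE : 0 < lamE)
    (hlam : 0 ≤ lam) (B C : ℝ) {θ : ℝ} (hθ : 0 ≤ θ) (i : Fin n) (D : Fin n → ℕ) :
    ageStep P lamE q B C X θ (fun D => minAge D * D i) D ≤
      (ENNReal.ofReal (lamE / (lamE + θ)) +
        ENNReal.ofReal (lamE / (lamE + θ + lam)) * minAge D) * (1 + D i) := by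
  refine le_trans ?_ (mul_le_mul_left (hX.ageStep_minAge_le i.pos hlamE hlam B C hθ D) _)
  have hm : Measurable fun y : ℝ × Ω => (minAge (nextAges q B C X y D) : ℝ≥0∞) :=
    (Measurable.of_discrete (f := fun D : Fin n → ℕ => (minAge D : ℝ≥0∞))).comp
      (hX.measurable_nextAges B C D)
  have hm' : Measurable fun y : ℝ × Ω =>
      ENNReal.ofReal (Real.exp (-(θ * y.1))) * (minAge (nextAges q B C X y D) : ℝ≥0∞) :=
    Measurable.mul (by fun_prop) hm
  rw [ageStep, discountedStep, discountedStep, ← lintegral_mul_const _ hm']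
  refine lintegral_mono fun y => ?_
  rw [mul_assoc]
  gcongr
  rw [add_comm]
  exact_mod_cast nextAges_le q B C X y D i

/-- A lower bound for the discounted probability of gossip in a step, when the gossiping phase begins
after the waiting time `s`. -/
lemma le_lintegral_gossipChance (hlamE : 0 < lamE) {B θ s : ℝ}
    (hB : 0 ≤ B) (hθ : 0 ≤ θ) (hs : 0 ≤ s) :
    ENNReal.ofReal (fanout n q / ((n - 1 : ℕ) : ℝ) * (lamE / (lamE + θ)) *
        (B / fanout n q / (lamE + θ + B / fanout n q)) * Real.exp (-((lamE + θ) * s))) ≤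
      ∫⁻ r, ENNReal.ofReal (Real.exp (-(θ * r))) *
        ENNReal.ofReal (gossipChance n q B (max (r - s) 0)) ∂(expMeasure lamE) := by
  set a : ℝ := fanout n q / ((n - 1 : ℕ) : ℝ) with ha
  set μ : ℝ := B / fanout n q with hμ
  have ha0 : 0 ≤ a := by positivity
  have hμ0 : 0 ≤ μ := by positivity
  refine le_trans ?_ (setLIntegral_le_lintegral (Set.Ici s) _)
  set I := ∫⁻ r in Set.Ici s, ENNReal.ofReal (Real.exp (-(θ * r))) *
    ENNReal.ofReal (gossipChance n q B (max (r - s) 0)) ∂(expMeasure lamE) with hI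
  have h1 : I + ENNReal.ofReal (a * Real.exp (μ * s)) *
      ∫⁻ r in Set.Ici s, ENNReal.ofReal (Real.exp (-(θ + μ) * r)) ∂(expMeasure lamE) =
      ENNReal.ofReal a *
        ∫⁻ r in Set.Ici s, ENNReal.ofReal (Real.exp (-θ * r)) ∂(expMeasure lamE) := by
    rw [← lintegral_const_mul _ (by fun_prop), ← lintegral_const_mul _ (by fun_prop),
      ← lintegral_add_right _ (by fun_prop)]
    refine setLIntegral_congr_fun measurableSet_Ici fun r hr => ?_
    have hr' : 0 ≤ r - s := sub_nonneg.2 hr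
    have he : Real.exp (-(μ * (r - s))) ≤ 1 := by
      rw [Real.exp_le_one_iff, neg_nonpos]; positivity
    simp only [gossipChance, ← ha, ← hμ]
    rw [max_eq_left hr', ← ENNReal.ofReal_mul (Real.exp_pos _).le,
      ← ENNReal.ofReal_mul (by positivity), ← ENNReal.ofReal_mul ha0, ← ENNReal.ofReal_add
        (mul_nonneg (Real.exp_pos _).le (mul_nonneg ha0 (sub_nonneg.2 he))) (by positivity)]
    congr 1
    have e1 : Real.exp (μ * s) * Real.exp (-(θ + μ) * r) =
        Real.exp (-θ * r) * Real.exp (-(μ * (r - s))) := by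
      rw [← Real.exp_add, ← Real.exp_add]; ring_nf
    rw [mul_assoc a, e1, neg_mul]
    ring
  rw [lintegral_Ici_exp_expMeasure hlamE (by linarith) hs,
    lintegral_Ici_exp_expMeasure hlamE (by linarith) hs, ← ENNReal.ofReal_mul (by positivity),
    ← ENNReal.ofReal_mul ha0] at h1
  rw [ENNReal.eq_sub_of_add_eq ENNReal.ofReal_ne_top h1, ← ENNReal.ofReal_sub]
  · refine le_of_eq (congrArg ENNReal.ofReal ?_)
    have e2 : Real.exp (μ * s) * Real.exp (-((lamE - -(θ + μ)) * s)) =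
        Real.exp (-((lamE + θ) * s)) := by
      rw [← Real.exp_add]; ring_nf
    have h3 : lamE + θ ≠ 0 := by positivity
    have h4 : lamE + θ + μ ≠ 0 := by positivity
    calc _ = a * (lamE / (lamE + θ) - lamE / (lamE + θ + μ)) * Real.exp (-((lamE + θ) * s)) := by
          field_simp
          ring
      _ = a * (lamE / (lamE - -θ)) * Real.exp (-((lamE - -θ) * s)) -
          a * (lamE / (lamE - -(θ + μ))) *
            (Real.exp (μ * s) * Real.exp (-((lamE - -(θ + μ)) * s))) := by
          rw [e2, sub_neg_eq_add, sub_neg_eq_add, ← add_assoc]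
          ring
      _ = _ := by ring
  · rw [sub_neg_eq_add]; positivity

/-- The drift of the age of a node towards the minimum age, with the waiting time before the gossiping
phase accounted for by the product of the two ages. -/
lemma ageStep_apply_le (hX : IsNetwork P X lamE lam q) (hlamE : 0 < lamE) (hq1 : q ≤ 1) {B C : ℝ}
    (hB : 0 ≤ B) (hC : 0 ≤ C) {θ p : ℝ} (hθ : 0 ≤ θ) (hp0 : 0 ≤ p)
    (hp : p ≤ fanout n q / ((n - 1 : ℕ) : ℝ) * (lamE / (lamE + θ)) *
        (B / fanout n q / (lamE + θ + B / fanout n q))) (i : Fin n) (D : Fin n → ℕ) :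
    ageStep P lamE q B C X θ (fun D => D i) D + ENNReal.ofReal p * D i ≤
      ENNReal.ofReal (lamE / (lamE + θ)) * (1 + D i) + ENNReal.ofReal p * minAge D +
        ENNReal.ofReal (p * (lamE + θ) * C) * (minAge D * D i) := by
  set e := Real.exp (-((lamE + θ) * (C * minAge D))) with he
  set G := ∫⁻ r, ENNReal.ofReal (Real.exp (-(θ * r))) *
    ENNReal.ofReal (gossipChance n q B (max (r - C * minAge D) 0)) ∂(expMeasure lamE) with hG
  have hme : ∀ c : ℝ, Measurable fun r : ℝ => ENNReal.ofReal (Real.exp (-(c * r))) := fun c => by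
    fun_prop
  have hmg : Measurable fun r : ℝ => ENNReal.ofReal
      (gossipChance n q B (max (r - C * minAge D) 0)) :=
    ((continuous_gossipChance n q B).comp (by fun_prop)).measurable.ennreal_ofReal
  have hmeg : Measurable fun r : ℝ => ENNReal.ofReal (Real.exp (-(θ * r))) * ENNReal.ofReal
      (gossipChance n q B (max (r - C * minAge D) 0)) := (hme θ).mul hmg
  have hexp : ∫⁻ r, ENNReal.ofReal (Real.exp (-(θ * r))) ∂(expMeasure lamE) =
      ENNReal.ofReal (lamE / (lamE + θ)) := by
    have := lintegral_exp_expMeasure (b := -θ) hlamE (by linarith)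
    simpa only [neg_mul, sub_neg_eq_add] using this
  have h1 : ageStep P lamE q B C X θ (fun D => D i) D + G * D i ≤
      ENNReal.ofReal (lamE / (lamE + θ)) * (1 + D i) + G * minAge D := by
    rw [hX.ageStep_eq, hG, ← hexp, ← lintegral_mul_const _ hmeg,
      ← lintegral_mul_const _ hmeg, ← lintegral_mul_const _ (hme θ),
      ← lintegral_add_right _ (hmeg.mul_const _),
      ← lintegral_add_right _ (hmeg.mul_const _)]
    refine lintegral_mono fun r => ?_
    have h2 := hX.lintegral_agesBefore_add_le hq1 hB hC D i r
    have h3 : ∫⁻ ω, (nextAges q B C X (r, ω) D i : ℝ≥0∞) ∂P =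
        ∫⁻ ω, (agesBefore q B C ((X ω).localInputs 0 0) D r i : ℝ≥0∞) ∂P + 1 := by
      simp only [nextAges, Pi.add_apply, Pi.one_apply, Nat.cast_add, Nat.cast_one]
      rw [lintegral_add_right _ measurable_const, lintegral_const, measure_univ, mul_one]
    rw [h3, mul_assoc, ← mul_add, mul_assoc, ← mul_add]
    refine mul_le_mul_right ?_ _
    calc _ = 1 + (∫⁻ ω, (agesBefore q B C ((X ω).localInputs 0 0) D r i : ℝ≥0∞) ∂P +
          ENNReal.ofReal (gossipChance n q B (max (r - C * minAge D) 0)) * D i) := by ring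
      _ ≤ 1 + (D i + ENNReal.ofReal (gossipChance n q B (max (r - C * minAge D) 0)) *
          minAge D) := by gcongr
      _ = _ := by ring
  have he1 : e ≤ 1 := by
    rw [he, Real.exp_le_one_iff, neg_nonpos]; positivity
  have hpe : ENNReal.ofReal (p * e) ≤ G := (ENNReal.ofReal_le_ofReal
    (mul_le_mul_of_nonneg_right hp (Real.exp_pos _).le)).trans
      (le_lintegral_gossipChance hlamE hB hθ (by positivity))
  have hG1 : G ≠ ⊤ := by
    refine ne_top_of_le_ne_top (b := ENNReal.ofReal (lamE / (lamE + θ)) *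
      ENNReal.ofReal (fanout n q / ((n - 1 : ℕ) : ℝ))) (by finiteness) ?_
    rw [hG, ← hexp, ← lintegral_mul_const _ (hme θ)]
    refine lintegral_mono fun r => mul_le_mul_right (ENNReal.ofReal_le_ofReal ?_) _
    refine mul_le_of_le_one_right (by positivity) ?_
    linarith [Real.exp_pos (-(B / fanout n q * max (r - C * minAge D) 0))]
  have h2 := ENNReal.add_mul_le_of_le hpe hG1 (ENNReal.natCast_ne_top (D i))
    (Nat.cast_le.2 (minAge_le D i)) h1
  have hsplit : ENNReal.ofReal p = ENNReal.ofReal (p * e) + ENNReal.ofReal (p * (1 - e)) := by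
    rw [← ENNReal.ofReal_add (mul_nonneg hp0 (Real.exp_pos _).le)
      (mul_nonneg hp0 (sub_nonneg.2 he1))]
    congr 1
    ring
  have hdef : ENNReal.ofReal (p * (1 - e)) ≤
      ENNReal.ofReal (p * (lamE + θ) * C) * minAge D := by
    rw [← ENNReal.ofReal_natCast (minAge D), ← ENNReal.ofReal_mul (by positivity)]
    refine ENNReal.ofReal_le_ofReal ?_
    have := Real.add_one_le_exp (-((lamE + θ) * (C * minAge D)))
    rw [← he] at this
    calc p * (1 - e) ≤ p * ((lamE + θ) * (C * minAge D)) := by gcongr; linarith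
      _ = _ := by ring
  calc _ = (ageStep P lamE q B C X θ (fun D => D i) D + ENNReal.ofReal (p * e) * D i) +
        ENNReal.ofReal (p * (1 - e)) * D i := by rw [hsplit]; ring
    _ ≤ (ENNReal.ofReal (lamE / (lamE + θ)) * (1 + D i) + ENNReal.ofReal (p * e) * minAge D) +
        ENNReal.ofReal (p * (lamE + θ) * C) * minAge D * D i := by gcongr
    _ ≤ (ENNReal.ofReal (lamE / (lamE + θ)) * (1 + D i) + ENNReal.ofReal p * minAge D) +
        ENNReal.ofReal (p * (lamE + θ) * C) * minAge D * D i := by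
          gcongr
          exact mul_le_of_le_one_right hp0 he1
    _ = _ := by ring

end IsNetwork

end Drift

/-! ### The bound for the average age -/

/-- The drift inequalities, summed along the chain: `u`, `v` and `w` stand for the discounted
sums of the age of a node, of the minimum age and of their product, and `s` for that of `1`. -/
lemma mul_le_of_drift {β s η V p κ u v w : ℝ} (hβ : β ≤ 1) (hs : s * (1 - β) = 1)
    (hη1 : η ≤ 1) (hV : 1 ≤ (1 - η) * V) (hp : 0 < p) (hκ : 0 ≤ κ) (hu : 0 ≤ u) (hv : 0 ≤ v)
    (hw : 0 ≤ w) (h1 : v ≤ β * s + η * v) (h2 : u + p * u ≤ β * (s + u) + p * v + p * κ * w)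
    (h3 : w ≤ β * (s + u) + η * (v + w)) :
    (1 - β) * u * (1 - κ * V) ≤ 1 / p + V + κ * V * (1 + V) := by
  have hβ0 : 0 ≤ 1 - β := sub_nonneg.2 hβ
  have hη0 : 0 ≤ 1 - η := sub_nonneg.2 hη1
  have hV0 : 0 ≤ V := by
    by_contra! h
    nlinarith
  set u' := (1 - β) * u with hu'
  set v' := (1 - β) * v with hv'
  set w' := (1 - β) * w with hw'
  have hu0 : 0 ≤ u' := mul_nonneg hβ0 hu
  have hv0 : 0 ≤ v' := mul_nonneg hβ0 hv
  have hw0 : 0 ≤ w' := mul_nonneg hβ0 hw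
  have e1 : (1 - η) * v' ≤ 1 := by
    have := mul_le_mul_of_nonneg_left h1 hβ0
    have e : (1 - β) * (β * s + η * v) = β * (s * (1 - β)) + η * v' := by rw [hv']; ring
    rw [e, hs, ← hv'] at this
    linarith
  have e3 : (1 - η) * w' ≤ 1 + u' + v' := by
    have := mul_le_mul_of_nonneg_left h3 hβ0
    have e : (1 - β) * (β * (s + u) + η * (v + w)) = β * (s * (1 - β) + u') + η * (v' + w') := by
      rw [hv', hu', hw']; ring
    rw [e, hs, ← hw'] at this
    nlinarith
  have e2 : p * u' ≤ 1 + p * v' + p * κ * w' := by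
    have := mul_le_mul_of_nonneg_left h2 hβ0
    have e : (1 - β) * (β * (s + u) + p * v + p * κ * w) =
        β * (s * (1 - β) + u') + p * v' + p * κ * w' := by rw [hv', hu', hw']; ring
    have e' : (1 - β) * (u + p * u) = u' + p * u' := by rw [hu']; ring
    rw [e, hs, e'] at this
    nlinarith
  have hvV : v' ≤ V := by
    calc v' ≤ (1 - η) * V * v' := le_mul_of_one_le_left hv0 hV
      _ = V * ((1 - η) * v') := by ring
      _ ≤ V * 1 := by gcongr
      _ = V := mul_one V
  have hwV : w' ≤ V * (1 + u' + V) := by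
    calc w' ≤ (1 - η) * V * w' := le_mul_of_one_le_left hw0 hV
      _ = V * ((1 - η) * w') := by ring
      _ ≤ V * (1 + u' + V) := by gcongr; linarith
  have e4 : u' ≤ 1 / p + v' + κ * w' := by
    rw [← mul_le_mul_iff_right₀ hp]
    refine e2.trans_eq ?_
    field_simp
  have e5 : κ * w' ≤ κ * (V * (1 + u' + V)) := by gcongr
  nlinarith

lemma tsum_pow_mul_sq_ne_top {γ : ℝ≥0∞} (hγ : γ < 1) : ∑' k : ℕ, γ ^ k * (k : ℝ≥0∞) ^ 2 ≠ ⊤ := by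
  lift γ to ℝ≥0 using (hγ.trans ENNReal.one_lt_top).ne
  have hγ' : γ < 1 := by exact_mod_cast hγ
  have h1 : ∀ k : ℕ, (γ : ℝ≥0∞) ^ k * (k : ℝ≥0∞) ^ 2 =
      ((γ ^ k * (k : ℝ≥0) ^ 2 : ℝ≥0) : ℝ≥0∞) := fun k => by push_cast; rfl
  simp only [h1]
  rw [ENNReal.tsum_coe_ne_top_iff_summable, ← NNReal.summable_coe]
  have hn : ‖(γ : ℝ)‖ < 1 := by simpa using hγ'
  refine (summable_pow_mul_geometric_of_norm_lt_one 2 hn).congr fun k => ?_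
  push_cast
  ring

section Bound

variable {Ω : Type*} [MeasurableSpace Ω] {P : Measure Ω} {n : ℕ}
  {X : Ω → Inputs n} {lamE lam q : ℝ}

/-- The discounted sum of `f` along the chain of ages that starts with all ages equal to `0`. -/
noncomputable abbrev ageSum (P : Measure Ω) (lamE q B C : ℝ) (X : Ω → Inputs n) (θ : ℝ)
    (f : (Fin n → ℕ) → ℝ≥0∞) : ℝ≥0∞ :=
  discountedSum ((expMeasure lamE).prod P) Prod.fst (nextAges q B C X) θ f 0

lemma minAge_zero : minAge (0 : Fin n → ℕ) = 0 := by
  rcases n.eq_zero_or_pos with rfl | hn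
  · simp [minAge, Set.range_eq_empty]
  · exact Nat.le_zero.1 (minAge_le 0 ⟨0, hn⟩)

namespace IsNetwork

lemma ageSum_add (hX : IsNetwork P X lamE lam q) (B C θ : ℝ) (f g : (Fin n → ℕ) → ℝ≥0∞) :
    ageSum P lamE q B C X θ (fun D => f D + g D) =
      ageSum P lamE q B C X θ f + ageSum P lamE q B C X θ g :=
  discountedSum_add measurable_fst (hX.measurable_nextAges B C) f g 0

lemma ageSum_const_mul (hX : IsNetwork P X lamE lam q) (B C θ : ℝ) (c : ℝ≥0∞)
    (f : (Fin n → ℕ) → ℝ≥0∞) :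
    ageSum P lamE q B C X θ (fun D => c * f D) = c * ageSum P lamE q B C X θ f :=
  discountedSum_const_mul measurable_fst (hX.measurable_nextAges B C) c f 0

lemma ageSum_eq (B C θ : ℝ) {f : (Fin n → ℕ) → ℝ≥0∞} (hf : f 0 = 0) :
    ageSum P lamE q B C X θ f = ageSum P lamE q B C X θ (ageStep P lamE q B C X θ f) := by
  rw [ageSum, discountedSum_eq, hf, zero_add]

variable [IsProbabilityMeasure P]

lemma lintegral_prod_exp_neg (hlamE : 0 < lamE) {θ : ℝ} (hθ : 0 ≤ θ) :
    ∫⁻ y : ℝ × Ω, ENNReal.ofReal (Real.exp (-(θ * y.1))) ∂((expMeasure lamE).prod P) =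
      ENNReal.ofReal (lamE / (lamE + θ)) := by
  have h := lintegral_exp_expMeasure (b := -θ) hlamE (by linarith)
  simp only [neg_mul, sub_neg_eq_add] at h
  rw [lintegral_prod _ (by fun_prop), ← h]
  simp

lemma ageSum_one (hlamE : 0 < lamE) {θ : ℝ} (hθ : 0 < θ) (B C : ℝ) :
    ageSum P lamE q B C X θ 1 = ENNReal.ofReal ((lamE + θ) / θ) := by
  have h1 : 0 < lamE + θ := by positivity
  rw [ageSum, discountedSum_one measurable_fst, lintegral_prod_exp_neg hlamE hθ.le,
    ENNReal.tsum_geometric, ← ENNReal.ofReal_one, ← ENNReal.ofReal_sub _ (by positivity),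
    show 1 - lamE / (lamE + θ) = θ / (lamE + θ) by field_simp; ring,
    ← ENNReal.ofReal_inv_of_pos (by positivity), inv_div]

lemma ageSum_ne_top (hlamE : 0 < lamE) {θ : ℝ} (hθ : 0 < θ) (B C : ℝ) (i : Fin n)
    {f : (Fin n → ℕ) → ℝ≥0∞} (hf : ∀ D, f D ≤ (D i : ℝ≥0∞) ^ 2) :
    ageSum P lamE q B C X θ f ≠ ⊤ := by
  have hβ1 : ENNReal.ofReal (lamE / (lamE + θ)) < 1 := by
    rw [ENNReal.ofReal_lt_one, div_lt_one (by linarith)]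
    linarith
  refine ne_top_of_le_ne_top (tsum_pow_mul_sq_ne_top hβ1) (ENNReal.tsum_le_tsum fun k => ?_)
  have := discountedStep_iterate_le (m := (expMeasure lamE).prod P) (θ := θ) measurable_fst
    (φ := fun D : Fin n → ℕ => D i) (fun y D => nextAges_le q B C X y D i)
    (g := fun k => (k : ℝ≥0∞) ^ 2) (fun a b hab => by simp only; gcongr) hf k 0
  rwa [lintegral_prod_exp_neg hlamE hθ.le, Pi.zero_apply, zero_add] at this

/-- A bound for the discounted average of the age of a node. -/
lemma ageSum_apply_le (hX : IsNetwork P X lamE lam q) (hlamE : 0 < lamE) (hlam : 0 < lam)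
    (hq1 : q ≤ 1) {B C : ℝ} (hB : 0 ≤ B) (hC : 0 ≤ C) {θ p : ℝ} (hθ : 0 < θ) (hp0 : 0 < p)
    (hp : p ≤ fanout n q / ((n - 1 : ℕ) : ℝ) * (lamE / (lamE + θ)) *
        (B / fanout n q / (lamE + θ + B / fanout n q))) (i : Fin n) :
    θ / (lamE + θ) * (ageSum P lamE q B C X θ fun D => D i).toReal *
        (1 - (lamE + θ) * C * (1 + lamE / lam)) ≤
      1 / p + (1 + lamE / lam) + (lamE + θ) * C * (1 + lamE / lam) * (1 + (1 + lamE / lam)) := by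
  set β := lamE / (lamE + θ) with hβ
  set η := lamE / (lamE + θ + lam) with hη
  set κ := (lamE + θ) * C with hκ
  have h0 : 0 < lamE + θ := by positivity
  have hβ0 : 0 ≤ β := by positivity
  have hη0 : 0 ≤ η := by positivity
  have hκ0 : 0 ≤ κ := by positivity
  have hψφ : ∀ D : Fin n → ℕ, (minAge D : ℝ≥0∞) ≤ D i := fun D => Nat.cast_le.2 (minAge_le D i)
  have hsq : ∀ D : Fin n → ℕ, (D i : ℝ≥0∞) ≤ (D i : ℝ≥0∞) ^ 2 := fun D => by
    exact_mod_cast Nat.le_self_pow two_ne_zero (D i)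
  set s := ageSum P lamE q B C X θ 1 with hs
  set u := ageSum P lamE q B C X θ (fun D => D i) with hu
  set v := ageSum P lamE q B C X θ (fun D => minAge D) with hv
  set w := ageSum P lamE q B C X θ (fun D => minAge D * D i) with hw
  have hs' : s = ENNReal.ofReal ((lamE + θ) / θ) := ageSum_one hlamE hθ B C
  have hs1top : s ≠ ⊤ := by rw [hs']; exact ENNReal.ofReal_ne_top
  have hutop : u ≠ ⊤ := ageSum_ne_top hlamE hθ B C i hsq
  have hvtop : v ≠ ⊤ := ageSum_ne_top hlamE hθ B C i fun D => (hψφ D).trans (hsq D)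
  have hwtop : w ≠ ⊤ := ageSum_ne_top hlamE hθ B C i fun D => by
    rw [sq]; exact mul_le_mul_left (hψφ D) _
  have hconst : ∀ c : ℝ≥0∞, ageSum P lamE q B C X θ (fun _ => c) = c * s := fun c => by
    have := hX.ageSum_const_mul B C θ c 1
    simpa using this
  have i1 : v ≤ ENNReal.ofReal β * s + ENNReal.ofReal η * v := by
    calc v = ageSum P lamE q B C X θ (ageStep P lamE q B C X θ fun D => minAge D) :=
          ageSum_eq B C θ (by simp [minAge_zero])
      _ ≤ ageSum P lamE q B C X θ (fun D => ENNReal.ofReal β + ENNReal.ofReal η * minAge D) :=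
          discountedSum_mono (fun D => hX.ageStep_minAge_le i.pos hlamE hlam.le B C hθ.le D) 0
      _ = _ := by rw [hX.ageSum_add, hconst, hX.ageSum_const_mul]
  have i2 : u + ENNReal.ofReal p * u ≤ ENNReal.ofReal β * (s + u) + ENNReal.ofReal p * v +
      ENNReal.ofReal (p * κ) * w := by
    calc u + ENNReal.ofReal p * u
        = ageSum P lamE q B C X θ (fun D => ageStep P lamE q B C X θ (fun D => D i) D +
            ENNReal.ofReal p * D i) := by
          rw [hX.ageSum_add, hX.ageSum_const_mul, ← ageSum_eq B C θ (by simp)]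
      _ ≤ ageSum P lamE q B C X θ (fun D => ENNReal.ofReal β * (1 + D i) +
            ENNReal.ofReal p * minAge D + ENNReal.ofReal (p * κ) * (minAge D * D i)) := by
          refine discountedSum_mono (fun D => ?_) 0
          rw [hκ, ← mul_assoc p]
          exact hX.ageStep_apply_le hlamE hq1 hB hC hθ.le hp0.le hp i D
      _ = _ := by
          rw [hX.ageSum_add, hX.ageSum_add, hX.ageSum_const_mul, hX.ageSum_const_mul,
            hX.ageSum_const_mul, hX.ageSum_add, hconst, one_mul]
  have i3 : w ≤ ENNReal.ofReal β * (s + u) + ENNReal.ofReal η * (v + w) := by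
    calc w = ageSum P lamE q B C X θ (ageStep P lamE q B C X θ fun D => minAge D * D i) :=
          ageSum_eq B C θ (by simp)
      _ ≤ ageSum P lamE q B C X θ (fun D => ENNReal.ofReal β * (1 + D i) +
            ENNReal.ofReal η * (minAge D + minAge D * D i)) := by
          refine discountedSum_mono (fun D => (hX.ageStep_minAge_mul_le hlamE hlam.le B C
            hθ.le i D).trans_eq ?_) 0
          ring
      _ = _ := by
          rw [hX.ageSum_add, hX.ageSum_const_mul, hX.ageSum_const_mul, hX.ageSum_add,
            hX.ageSum_add, hconst, one_mul]
  have hβs : 1 - β = θ / (lamE + θ) := by rw [hβ]; field_simp; ring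
  rw [← hβs]
  have r1 := ENNReal.toReal_mono (by finiteness) i1
  have r2 := ENNReal.toReal_mono (by finiteness) i2
  have r3 := ENNReal.toReal_mono (by finiteness) i3
  rw [ENNReal.toReal_add (by finiteness) (by finiteness), ENNReal.toReal_mul, ENNReal.toReal_mul,
    ENNReal.toReal_ofReal hβ0, ENNReal.toReal_ofReal hη0] at r1
  rw [ENNReal.toReal_add (by finiteness) (by finiteness),
    ENNReal.toReal_add (by finiteness) (by finiteness),
    ENNReal.toReal_add (by finiteness) (by finiteness), ENNReal.toReal_mul, ENNReal.toReal_mul,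
    ENNReal.toReal_mul, ENNReal.toReal_mul, ENNReal.toReal_add hs1top hutop,
    ENNReal.toReal_ofReal hβ0, ENNReal.toReal_ofReal hp0.le,
    ENNReal.toReal_ofReal (by positivity)] at r2
  rw [ENNReal.toReal_add (by finiteness) (by finiteness), ENNReal.toReal_mul, ENNReal.toReal_mul,
    ENNReal.toReal_ofReal hβ0, ENNReal.toReal_ofReal hη0, ENNReal.toReal_add hs1top hutop,
    ENNReal.toReal_add hvtop hwtop] at r3
  refine mul_le_of_drift (s := s.toReal) (η := η) (v := v.toReal) (w := w.toReal) ?_ ?_ ?_ ?_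
    hp0 hκ0 ENNReal.toReal_nonneg ENNReal.toReal_nonneg ENNReal.toReal_nonneg r1 r2 r3
  · exact div_le_one_of_le₀ (by linarith) h0.le
  · rw [hβs, hs', ENNReal.toReal_ofReal (by positivity)]
    field_simp
  · exact div_le_one_of_le₀ (by linarith) (by positivity)
  · have hle : η ≤ lamE / (lamE + lam) := by
      rw [hη]; gcongr; linarith
    calc (1 : ℝ) = (1 - lamE / (lamE + lam)) * (1 + lamE / lam) := by field_simp; ring
      _ ≤ _ := by gcongr

lemma lintegral_initialAge_le (hlamE : 0 < lamE) {θ : ℝ}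
    (hθ : 0 < θ) (B C : ℝ) (i : Fin n) (D : Fin n → ℕ) :
    ∫⁻ x, initialAge P lamE q B C X i x D ∂(expMeasure θ) ≤
      ENNReal.ofReal (θ / (lamE + θ)) * D i := by
  have h := lintegral_exp_expMeasure (b := -lamE) hθ (by linarith)
  rw [sub_neg_eq_add, add_comm θ] at h
  rw [← h, ← lintegral_mul_const _ (by fun_prop)]
  refine lintegral_mono_ae ?_
  filter_upwards [ae_nonneg_expMeasure θ] with x hx
  simpa only [neg_mul] using initialAge_le hx B C i D

/-- The bound for the limit of the expected age, for all discount rates `θ < lamE / 4` at once. The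
factor `16 / 25` is the price for not letting `θ` tend to `0`. -/
lemma limit_age_le (hX : IsNetwork P X lamE lam q) (hlamE : 0 < lamE) (hlam : 0 < lam)
    (hq1 : q ≤ 1) {B C : ℝ} (hB : 0 < B) (hC : 0 ≤ C) (hfan : 0 < fanout n q) (i : Fin n)
    (hsmall : 2 * lamE * C * (1 + lamE / lam) < 1) {a : ℝ≥0}
    (ha : Tendsto (fun t : ℝ => renewalSum ((expMeasure lamE).prod P) Prod.fst
      (nextAges q B C X) (initialAge P lamE q B C X i) t 0) atTop (𝓝 a)) :
    (a : ℝ) ≤ (1 / (16 / 25 * (fanout n q / ((n - 1 : ℕ) : ℝ)) *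
        (B / fanout n q / (lamE + B / fanout n q))) + (1 + lamE / lam) +
        2 * lamE * C * (1 + lamE / lam) * (1 + (1 + lamE / lam))) /
      (1 - 2 * lamE * C * (1 + lamE / lam)) := by
  set V := 1 + lamE / lam with hV
  set μ := B / fanout n q with hμ
  set b : ℝ := fanout n q / ((n - 1 : ℕ) : ℝ) with hb
  set p := 16 / 25 * b * (μ / (lamE + μ)) with hp
  have hfan' := fanout_le i.pos hq1
  have hμ0 : 0 < μ := div_pos hB (by exact_mod_cast hfan)
  have hb0 : 0 < b := div_pos (by exact_mod_cast hfan) (by exact_mod_cast hfan.trans_le hfan')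
  have hV0 : 0 < V := by positivity
  have hp0 : 0 < p := by positivity
  have := isProbabilityMeasure_expMeasure hlamE
  have hden : 0 < 1 - 2 * lamE * C * V := by linarith
  have hbound : (a : ℝ≥0∞) ≤ ENNReal.ofReal ((1 / p + V + 2 * lamE * C * V * (1 + V)) /
      (1 - 2 * lamE * C * V)) := by
    refine le_of_tendsto_of_lintegral_expMeasure_le ha (b := lamE / 4) (by positivity) ?_
    intro θ hθ hθ1
    have hpos : ∀ᵐ y : ℝ × Ω ∂((expMeasure lamE).prod P), 0 ≤ y.1 :=
      Measure.quasiMeasurePreserving_fst.ae (ae_nonneg_expMeasure lamE)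
    rw [lintegral_renewalSum hθ measurable_fst hpos (hX.measurable_nextAges B C)
      (hX.measurable_initialAge B C i) (fun x hx D => by simp [initialAge, hx.not_ge])]
    have hpθ : p ≤ b * (lamE / (lamE + θ)) * (μ / (lamE + θ + μ)) := by
      have h1 : (4 : ℝ) / 5 ≤ lamE / (lamE + θ) := by
        rw [div_le_div_iff₀ (by norm_num) (by linarith)]; linarith
      have h2 : 4 / 5 * (μ / (lamE + μ)) ≤ μ / (lamE + θ + μ) := by
        rw [← mul_div_assoc, div_le_div_iff₀ (by linarith) (by linarith)]
        nlinarith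
      calc p = b * (4 / 5) * (4 / 5 * (μ / (lamE + μ))) := by rw [hp]; ring
        _ ≤ _ := by gcongr
    have hmain := hX.ageSum_apply_le hlamE hlam hq1 hB.le hC hθ hp0 hpθ i
    have hutop : ageSum P lamE q B C X θ (fun D => D i) ≠ ⊤ :=
      ageSum_ne_top hlamE hθ B C i fun D => by
        exact_mod_cast Nat.le_self_pow two_ne_zero (D i)
    calc _ ≤ ageSum P lamE q B C X θ fun D => ENNReal.ofReal (θ / (lamE + θ)) * D i :=
          discountedSum_mono (fun D => lintegral_initialAge_le hlamE hθ B C i D) 0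
      _ = ENNReal.ofReal (θ / (lamE + θ) * (ageSum P lamE q B C X θ fun D => D i).toReal) := by
          rw [hX.ageSum_const_mul, ENNReal.ofReal_mul (by positivity), ENNReal.ofReal_toReal hutop]
      _ ≤ _ := by
          refine ENNReal.ofReal_le_ofReal ?_
          rw [le_div_iff₀ hden]
          set z := θ / (lamE + θ) * (ageSum P lamE q B C X θ fun D => D i).toReal
          have hz : 0 ≤ z := by positivity
          have hκ : (lamE + θ) * C * V ≤ 2 * lamE * C * V := by
            gcongr; linarith
          calc z * (1 - 2 * lamE * C * V) ≤ z * (1 - (lamE + θ) * C * V) := by gcongr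
            _ ≤ _ := hmain
            _ ≤ _ := by gcongr
  rw [ENNReal.le_ofReal_iff_toReal_le ENNReal.coe_ne_top (by positivity)] at hbound
  simpa using hbound

end IsNetwork

end Bound

/-! ### The limit of large networks -/

lemma tendsto_fanout_div {q : ℝ} (hq : 0 ≤ q) :
    Tendsto (fun n : ℕ => (fanout n q : ℝ) / ((n - 1 : ℕ) : ℝ)) atTop (𝓝 q) := by
  have h1 : Tendsto (fun n : ℕ => ((n - 1 : ℕ) : ℝ)) atTop atTop :=
    tendsto_natCast_atTop_atTop.comp (tendsto_sub_atTop_nat 1)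
  refine ((tendsto_nat_floor_mul_div_atTop hq).comp h1).congr' ?_
  filter_upwards [eventually_ge_atTop 1] with n hn
  simp [fanout, Nat.cast_sub hn]

lemma tendsto_div_fanout {q : ℝ} (hq : 0 < q) :
    Tendsto (fun n : ℕ => (n : ℝ) / fanout n q) atTop (𝓝 q⁻¹) := by
  have h1 : Tendsto (fun n : ℕ => (n : ℝ) / ((n - 1 : ℕ) : ℝ)) atTop (𝓝 1) := by
    have h2 : Tendsto (fun n : ℕ => 1 + 1 / ((n - 1 : ℕ) : ℝ)) atTop (𝓝 (1 + 0)) :=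
      (tendsto_const_nhds.div_atTop
        (tendsto_natCast_atTop_atTop.comp (tendsto_sub_atTop_nat 1))).const_add 1
    rw [add_zero] at h2
    refine h2.congr' ?_
    filter_upwards [eventually_ge_atTop 2] with n hn
    have h3 : (0 : ℝ) < ((n - 1 : ℕ) : ℝ) := by
      exact_mod_cast Nat.sub_pos_of_lt (by omega : 1 < n)
    have h4 : (n : ℝ) = ((n - 1 : ℕ) : ℝ) + 1 := by
      rw [Nat.cast_sub (by omega)]; simp
    rw [h4]
    field_simp
  have h2 := h1.div (tendsto_fanout_div hq.le) hq.ne'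
  rw [one_div] at h2
  refine h2.congr' ?_
  filter_upwards [eventually_ge_atTop 2] with n hn
  have h3 : ((n - 1 : ℕ) : ℝ) ≠ 0 := by
    exact_mod_cast (Nat.sub_pos_of_lt (by omega : 1 < n)).ne'
  exact div_div_div_cancel_right₀ h3 _ _

lemma tendsto_age_bound {lamE lam q : ℝ} (hlamE : 0 < lamE) (hlam : 0 < lam) (hq : 0 < q)
    {C : ℕ → ℝ} (hC0 : Tendsto C atTop (𝓝 0)) :
    Tendsto (fun n : ℕ => (1 / (16 / 25 * (fanout n q / ((n - 1 : ℕ) : ℝ)) *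
        (n * lam / fanout n q / (lamE + n * lam / fanout n q))) + (1 + lamE / lam) +
        2 * lamE * C n * (1 + lamE / lam) * (1 + (1 + lamE / lam))) /
      (1 - 2 * lamE * C n * (1 + lamE / lam))) atTop
      (𝓝 (25 / 16 * ((lam + q * lamE) / (q * lam)) + (1 + lamE / lam))) := by
  have h1 := tendsto_fanout_div hq.le
  have h2 : Tendsto (fun n : ℕ => (n : ℝ) * lam / fanout n q) atTop (𝓝 (q⁻¹ * lam)) :=
    ((tendsto_div_fanout hq).mul_const lam).congr fun n => by ring
  have h3 : Tendsto (fun n : ℕ => 2 * lamE * C n * (1 + lamE / lam)) atTop (𝓝 0) := by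
    simpa using (hC0.const_mul (2 * lamE)).mul_const (1 + lamE / lam)
  have hμ : 0 < q⁻¹ * lam := by positivity
  have h4 := ((tendsto_const_nhds (x := (1 : ℝ))).div ((h1.const_mul (16 / 25)).mul
    (h2.div (h2.const_add lamE) (by positivity))) (by positivity)).add_const (1 + lamE / lam)
  have h5 := (h4.add (h3.mul_const (1 + (1 + lamE / lam)))).div (h3.const_sub 1) (by norm_num)
  have hval : (1 / (16 / 25 * q * (q⁻¹ * lam / (lamE + q⁻¹ * lam))) + (1 + lamE / lam) +
      0 * (1 + (1 + lamE / lam))) / (1 - 0) =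
      25 / 16 * ((lam + q * lamE) / (q * lam)) + (1 + lamE / lam) := by
    rw [zero_mul, add_zero, sub_zero, div_one]
    congr 1
    field_simp
    ring
  rw [hval] at h5
  exact h5

theorem theorem2 (lamE lam q : ℝ) (hlamE : 0 < lamE) (hlam : 0 < lam) (hq : 0 < q) (hq1 : q ≤ 1)
    (C : ℕ → ℝ) (hC : ∀ n, 0 ≤ C n) (hC0 : Tendsto C atTop (𝓝 0))
    {Ω : ℕ → Type*} [∀ n, MeasurableSpace (Ω n)] (P : ∀ n, Measure (Ω n))
    [∀ n, IsProbabilityMeasure (P n)] (X : ∀ n, Ω n → Inputs n)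
    (hX : ∀ n, IsNetwork (P n) (X n) lamE lam q) :
    ∃ a : ∀ n, Fin n → ℝ,
      (∀ n (i : Fin n),
        (∀ t : ℝ, 0 ≤ t →
          Integrable (fun ω => ((X n ω).age q (n * lam) (C n) t i : ℝ)) (P n)) ∧
        Tendsto (fun t : ℝ => ∫ ω, ((X n ω).age q (n * lam) (C n) t i : ℝ) ∂(P n)) atTop
          (𝓝 (a n i))) ∧
      (∃ K : ℝ, ∀ n (i : Fin n), |a n i| ≤ K) ∧
      ∀ ε > 0, ∀ᶠ n : ℕ in atTop, ∀ i : Fin n,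
        a n i ≤ 1 + lamE / lam +
          1 / (q * lam ^ 2 / ((lamE + 2 * lam) * (lam + q * lamE))) + ε := by
  choose a hint hlim hren using fun n (i : Fin n) => (hX n).exists_tendsto_integral_age hlamE hlam
    hq1 (B := n * lam) (by positivity) (C n) i
  set T := 1 + lamE / lam + 1 / (q * lam ^ 2 / ((lamE + 2 * lam) * (lam + q * lamE))) with hT
  have hlt : 25 / 16 * ((lam + q * lamE) / (q * lam)) + (1 + lamE / lam) < T := by
    have h1 : 1 / (q * lam ^ 2 / ((lamE + 2 * lam) * (lam + q * lamE))) =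
        (2 + lamE / lam) * ((lam + q * lamE) / (q * lam)) := by
      field_simp
      ring
    have h2 : 0 < (lam + q * lamE) / (q * lam) := by positivity
    have h3 : 0 < lamE / lam := by positivity
    rw [hT, h1]
    nlinarith [mul_pos h3 h2]
  have hbound : ∀ᶠ n : ℕ in atTop, ∀ i : Fin n, (a n i : ℝ) ≤ T := by
    have h3 : Tendsto (fun n : ℕ => 2 * lamE * C n * (1 + lamE / lam)) atTop (𝓝 0) := by
      simpa using (hC0.const_mul (2 * lamE)).mul_const (1 + lamE / lam)
    filter_upwards [(tendsto_age_bound hlamE hlam hq hC0).eventually_lt_const hlt,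
      h3.eventually_lt_const one_pos, (tendsto_fanout_div hq.le).eventually_const_lt hq]
      with n hn hsmall hfan i
    have hfan' : 0 < fanout n q := Nat.pos_of_ne_zero fun h => by simp [h] at hfan
    have hn0 : (0 : ℝ) < n := by exact_mod_cast i.pos
    exact ((hX n).limit_age_le hlamE hlam hq1 (by positivity) (hC n) hfan' i hsmall
      (hren n i)).trans hn.le
  refine ⟨fun n i => a n i, fun n i => ⟨hint n i, hlim n i⟩, ?_, fun ε hε => ?_⟩
  · -- finitely many small networks are not covered by the asymptotic bound
    obtain ⟨N, hN⟩ := eventually_atTop.1 hbound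
    have hT0 : 0 ≤ T := by positivity
    refine ⟨T + ∑ n ∈ Finset.range N, ∑ i : Fin n, (a n i : ℝ), fun n i => ?_⟩
    refine (abs_of_nonneg (NNReal.coe_nonneg (a n i))).trans_le ?_
    have hsum : 0 ≤ ∑ n ∈ Finset.range N, ∑ i : Fin n, (a n i : ℝ) := by positivity
    rcases le_or_gt N n with h | h
    · exact (hN n h i).trans (le_add_of_nonneg_right hsum)
    · calc (a n i : ℝ) ≤ ∑ i : Fin n, (a n i : ℝ) :=
            Finset.single_le_sum (f := fun i => (a n i : ℝ)) (fun _ _ => NNReal.coe_nonneg _)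
              (Finset.mem_univ i)
        _ ≤ ∑ n ∈ Finset.range N, ∑ i : Fin n, (a n i : ℝ) :=
            Finset.single_le_sum (f := fun n => ∑ i : Fin n, (a n i : ℝ))
              (fun _ _ => by positivity) (Finset.mem_range.2 h)
        _ ≤ _ := le_add_of_nonneg_left hT0
  · filter_upwards [hbound] with n hn i
    exact (hn i).trans (le_add_of_nonneg_right hε.le)
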